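/- **Instances.** Let $k,d,n,m\ge 1$ be integers with $nd=mk$. A $d$-regular $k$-NAE-SAT instance $\mathcal G$ consists of $n$ variables with $d$ half-edges each, $m$ clauses with $k$ half-edges each, a perfect matching of the variable half-edges with the clause half-edges (the $nd$ edges; multiple edges are allowed), and a literal $\mathtt L_e\in\{0,1\}$ for every edge $e$. $\mathbb E$ denotes expectation over a uniformly random matching and uniformly random literals. **Messages.** Messages are finite unordered labelled trees, up to isomorphism. The basic ones are the bits $0,1$ (a single labelled edge) and the box $\square$ (a single unlabelled edge). Define two classes of free messages inductively. An element of $\dot\Omega_{\mathtt f}$ is a join $\dot T(\hat\tau_1,\dots,\hat\tau_{d-1})$, at a free variable, of $d-1$ elements of $\hat\Omega_{\mathtt f}$. An element of $\hat\Omega_{\mathtt f}$ is either $\square$, or a join $\hat J(\dot\tau_1,\dots,\dot\tau_{k-1})$, at a clause, of $k-1$ messages, each of which is in $\dot\Omega_{\mathtt f}$ or equal to one and the same bit $x$, not all of them equal to $x$. For a message list, $\hat T(\dot\tau_1,\dots,\dot\tau_{k-1})$ is $\square$ if both bits occur among the $\dot\tau_i$, and $\hat J(\dot\tau_1,\dots,\dot\tau_{k-1})$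 otherwise. Negation $\tau\oplus 1$ exchanges the labels $0,1$ throughout the tree. The size $|\tau|$ is the number of join vertices of type $\dot T$ in $\tau$. The belief $\mathtt m(\tau)\in[0,1]$ is given by $\mathtt m(x)=x$ for bits, $\mathtt m(\square)=1/2$, $$\mathtt m(\dot T(\hat\tau_i)_i)=\frac{\prod_i\mathtt m(\hat\tau_i)}{\prod_i\mathtt m(\hat\tau_i)+\prod_i(1-\mathtt m(\hat\tau_i))},\qquad \mathtt m(\hat J(\dot\tau_i)_i)=\frac{1-\prod_i\mathtt m(\dot\tau_i)}{2-\prod_i\mathtt m(\dot\tau_i)-\prod_i(1-\mathtt m(\dot\tau_i))}.$$ **Colors.** The colors are $\mathtt r_0,\mathtt r_1$ (red), $\mathtt b_0,\mathtt b_1$ (blue) and the free colors $(\dot\tau,\hat\tau)\in\dot\Omega_{\mathtt f}\times\hat\Omega_{\mathtt f}$. Their sizes are $|\mathtt r_x|=|\mathtt b_x|=0$ and $|(\dot\tau,\hat\tau)|=|\dot\tau|+|\hat\tau|$, and $\Omega_T$ is the finite set of colors of size at most $T$. The variable-to-clause part $\dot\sigma$ of a color $\sigma$ is $\sigma$ itself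 if $\sigma$ is red or blue, and $\dot\tau$ if $\sigma=(\dot\tau,\hat\tau)$; $\dot\Omega_T$ is the set of variable-to-clause parts of colors in $\Omega_T$. Literals act on colors by negation ($\mathtt r_x\oplus l=\mathtt r_{x\oplus l}$, and so on). When a belief or a join is evaluated at a blue color $\mathtt b_x$, its message is the bit $x$; at $(\dot\tau,\hat\tau)$ the variable-to-clause message is $\dot\tau$ and the clause-to-variable message is $\hat\tau$. *Variables.* $\zeta\in\Omega_T^d$ is compatible if either for some $x$ all $\zeta_i\in\{\mathtt r_x,\mathtt b_x\}$ and at least one $\zeta_i=\mathtt r_x$, or all $\zeta_i=(\dot\tau_i,\hat\tau_i)$ are free with $\dot\tau_i=\dot T((\hat\tau_j)_{j\ne i})$ for every $i$. Put $\dot\Phi(\zeta)=0$ if $\zeta$ is not compatible, $1$ in the first case, and $\prod_i\mathtt m(\hat\tau_i)+\prod_i(1-\mathtt m(\hat\tau_i))$ in the second. *Clauses.* $\xi\in\Omega_T^k$ is compatible if either $\xi_i=\mathtt r_x$ and $\xi_j=\mathtt b_{1\oplus x}$ for all $j\ne i$, for some $i,x$; or no $\xi_i$ is red, there are no $i,x$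 with $\xi_j=\mathtt b_x$ for all $j\ne i$, and for each free $\xi_i=(\dot\tau_i,\hat\tau_i)$ one has $\hat\tau_i=\hat T((\dot\tau_j)_{j\ne i})$. Put $\hat\Phi(\xi)=0$ if $\xi$ is not compatible; $1$ if it is compatible and contains a red color or both blue colors; and otherwise $1-\prod_i\mathtt m(\dot\tau_i)-\prod_i(1-\mathtt m(\dot\tau_i))$. *Edges.* $\bar\Phi(\mathtt r_x)=\bar\Phi(\mathtt b_x)=1$ and $\bar\Phi(\dot\tau,\hat\tau)=\big(\mathtt m(\dot\tau)\mathtt m(\hat\tau)+(1-\mathtt m(\dot\tau))(1-\mathtt m(\hat\tau))\big)^{-1}$. For $\lambda\in[0,1]$ set $\hat\Phi_\lambda(\xi)=2^{-k}\sum_{\mathtt L\in\{0,1\}^k}\hat\Phi(\xi\oplus\mathtt L)^\lambda$, where here and below $0^\lambda=0$, also for $\lambda=0$. Let $\hat v(\xi)$ be the fraction of $\mathtt L\in\{0,1\}^k$ with $\xi\oplus\mathtt L$ compatible, and $\hat\Phi^{\max}(\xi)=\max_{\mathtt L}\hat\Phi(\xi\oplus\mathtt L)$. **Colorings.** A (valid)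 $T$-coloring of $\mathcal G$ is a map $\sigma$ from the edges to $\Omega_T$ which is compatible at every variable and, after every color is shifted by the literal of its edge, at every clause. Its weight is $$w(\sigma)=\prod_v\dot\Phi(\sigma_{\delta v})\prod_a\hat\Phi\big((\sigma\oplus\mathtt L)_{\delta a}\big)\prod_e\bar\Phi(\sigma_e),$$ where $\delta v,\delta a$ are the edges at $v$, $a$. The empirical measure of $\sigma$ is the triple $H=(\dot H,\hat H,\bar H)$, where $\dot H(\zeta)$, $\hat H(\xi)$, $\bar H(s)$ are the fractions of variables $v$ with $\sigma_{\delta v}=\zeta$, of clauses $a$ with $\sigma_{\delta a}=\xi$, and of edges $e$ with $\sigma_e=s$. Call a triple of probability measures on $\Omega_T^d,\Omega_T^k,\Omega_T$ admissible if $\dot H$ is carried by compatible $\zeta$, $\hat H$ is carried by $\xi$ with $\hat v(\xi)>0$, and $\bar H$ is the average of the $d$ coordinate marginals of $\dot H$ and also the average of the $k$ coordinate marginals of $\hat H$. With $\mathcal H$ denoting Shannon entropy, put $$F(H)=\mathcal H(\dot H)+\tfrac dk\mathcal H(\hat H)-d\,\mathcal H(\bar H)+\tfrac dk\langle\log\hat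 v,\hat H\rangle+\lambda\Big(\langle\log\dot\Phi,\dot H\rangle+\tfrac dk\langle\log\hat\Phi^{\max},\hat H\rangle+d\langle\log\bar\Phi,\bar H\rangle\Big).$$ **Belief propagation.** For a probability measure $q$ on $\dot\Omega_T$ let $Q_q$ be the probability measure on $\Omega_T$ proportional to $\sigma\mapsto q(\dot\sigma)$. For a measure $Q$ on $\Omega_T$ let $\hat B(Q)$ and $\dot B(Q)$ be the probability measures on $\Omega_T$ with $$\hat B(Q)(\sigma)\propto\bar\Phi(\sigma)^\lambda\sum_{\eta\in\Omega_T^{k-1}}\hat\Phi_\lambda(\sigma,\eta)\prod_{i}Q(\eta_i),\qquad \dot B(Q)(\sigma)\propto\bar\Phi(\sigma)^\lambda\sum_{\eta\in\Omega_T^{d-1}}\dot\Phi(\sigma,\eta)^\lambda\prod_{i}Q(\eta_i).$$ Call $q$ a fixed point if $\dot B(\hat B(Q_q))=Q_q$. For $C\in\mathbb R$ let $\Gamma_C$ be the set of probability measures $q$ on $\dot\Omega_T$ that are invariant under negation and satisfy, with $\mathtt r=\{\mathtt r_0,\mathtt r_1\}$, $\mathtt b=\{\mathtt b_0,\mathtt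 b_1\}$, $\mathtt f=\dot\Omega_T\cap\dot\Omega_{\mathtt f}$, $$q(\mathtt r)+2^kq(\mathtt f)\le C\,q(\mathtt b),\qquad (1-C2^{-k})\,q(\mathtt b)\le q(\mathtt r).$$ For a fixed point $q$, put $\hat Q_q=\hat B(Q_q)$ and let $H_\star=(\dot H_\star,\hat H_\star,\bar H_\star)$ be the triple of probability measures with $$\dot H_\star(\zeta)\propto\dot\Phi(\zeta)^\lambda\prod_{i=1}^d\hat Q_q(\zeta_i),\qquad \hat H_\star(\xi)\propto\hat\Phi_\lambda(\xi)\prod_{i=1}^kQ_q(\xi_i),\qquad \bar H_\star(\sigma)\propto\bar\Phi(\sigma)^{-\lambda}Q_q(\sigma)\hat Q_q(\sigma).$$ **Separable colorings.** Let $\mathbf N$ be the set of triples $H$ with $\|H-H_\star\|_1\le n^{-1/3}$; write $\sigma\in\mathbf N$ if $\sigma$ is a $T$-coloring of $\mathcal G$ with empirical measure in $\mathbf N$. The frozen configuration $x(\sigma)$ has $x_v(\sigma)=x$ if an edge at $v$ has color $\mathtt r_x$, and $x_v(\sigma)=\mathtt f$ ("free") if no edge at $v$ is red. Let $\delta(\sigma,\sigma')$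 be the fraction of variables $v$ with $x_v(\sigma)\ne x_v(\sigma')$, let $$I_{\mathrm{sep}}=\Big[\tfrac12\big(1-k^4/2^{k/2}\big),\ \tfrac12\big(1+k^4/2^{k/2}\big)\Big],$$ and write $\sigma'\succcurlyeq\sigma$ if $x(\sigma')$ has at least as many free variables as $x(\sigma)$. A coloring $\sigma\in\mathbf N$ is *separable* if $$\big|\{\sigma'\in\mathbf N:\ \sigma'\succcurlyeq\sigma,\ \delta(\sigma,\sigma')\notin I_{\mathrm{sep}}\}\big|\le\exp\{(\log n)^4\}.$$ Let $Z(\mathbf N)=\sum_{\sigma\in\mathbf N}w(\sigma)^\lambda$, and let $S(\mathbf N)$ be the same sum restricted to the separable $\sigma\in\mathbf N$. **Proposition.** For every $C$ there is $k_0=k_0(C)$ such that the following holds for all $k\ge k_0$, all $d$ with $(2^{k-1}-2)\log 2\le d/k\le 2^{k-1}\log 2$, all $\lambda\in[0,1]$ and all integers $T\ge1$ for which $F(H)\ge0$ for some admissible $H$. If $q\in\Gamma_C$ is a fixed point of belief propagation and $\mathbf N$ is defined through the corresponding $H_\star$, then $$\mathbb E\,S(\mathbf N)=(1-o(1))\,\mathbb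 E\,Z(\mathbf N)\qquad\text{as }n\to\infty$$ along the $n$ for which $m=nd/k$ is an integer (with $k,d,\lambda,T,q$ fixed). -/

import Mathlib

open scoped Classical
open Filter Topology

noncomputable section

namespace NAESat

/-! ## Messages: unordered labelled trees -/

/-- Plane trees. `bit x` is a frozen message (a single edge labelled `x`), `box` is the single
unlabelled edge sent by a separating clause, `var l` joins the incoming clause-to-variable trees
`l` at a free variable, and `cls l` joins the incoming variable-to-clause trees `l` at a
non-separating clause. -/
inductive PTree : Type
  | bit (x : Bool) : PTree
  | box : PTree
  | var (l : List PTree) : PTree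
  | cls (l : List PTree) : PTree

/-- One elementary rearrangement: permute the subtrees joined at one vertex of the tree. -/
inductive PTree.Step : PTree → PTree → Prop
  | permVar {l l' : List PTree} (h : l.Perm l') : PTree.Step (.var l) (.var l')
  | permCls {l l' : List PTree} (h : l.Perm l') : PTree.Step (.cls l) (.cls l')
  | inVar {s t : PTree} (l l' : List PTree) (h : PTree.Step s t) :
      PTree.Step (.var (l ++ s :: l')) (.var (l ++ t :: l'))
  | inCls {s t : PTree} (l l' : List PTree) (h : PTree.Step s t) :
      PTree.Step (.cls (l ++ s :: l')) (.cls (l ++ t :: l'))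

/-- Isomorphism classes of trees: plane trees modulo the equivalence relation generated by
rearrangements. -/
def Tree : Type := Quot PTree.Step

namespace PTree

mutual
/-- Bottom-up evaluation of a plane tree; the values of the subtrees enter as a multiset. -/
def fold {α : Type} (fbit : Bool → α) (fbox : α) (fvar fcls : Multiset α → α) : PTree → α
  | .bit x => fbit x
  | .box => fbox
  | .var l => fvar (foldList fbit fbox fvar fcls l)
  | .cls l => fcls (foldList fbit fbox fvar fcls l)
/-- The list of values of a list of plane trees. -/
def foldList {α : Type} (fbit : Bool → α) (fbox : α) (fvar fcls : Multiset α → α) :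
    List PTree → List α
  | [] => []
  | t :: l => fold fbit fbox fvar fcls t :: foldList fbit fbox fvar fcls l
end

theorem foldList_eq {α : Type} (fbit : Bool → α) (fbox : α) (fvar fcls : Multiset α → α)
    (l : List PTree) :
    foldList fbit fbox fvar fcls l = l.map (fold fbit fbox fvar fcls) := by
  induction l with
  | nil => simp [foldList]
  | cons t l ih => simp [foldList, ih]

theorem fold_step {α : Type} (fbit : Bool → α) (fbox : α) (fvar fcls : Multiset α → α)
    {s t : PTree} (h : Step s t) :
    fold fbit fbox fvar fcls s = fold fbit fbox fvar fcls t := by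
  induction h with
  | permVar h =>
    simp only [fold, foldList_eq]
    exact congrArg fvar (Multiset.coe_eq_coe.mpr (h.map _))
  | permCls h =>
    simp only [fold, foldList_eq]
    exact congrArg fcls (Multiset.coe_eq_coe.mpr (h.map _))
  | inVar l l' _ ih => simp only [fold, foldList_eq, List.map_append, List.map_cons, ih]
  | inCls l l' _ ih => simp only [fold, foldList_eq, List.map_append, List.map_cons, ih]

end PTree

namespace Tree

/-- The frozen message `x`. -/
def bit (x : Bool) : Tree := Quot.mk _ (.bit x)

/-- The single unlabelled edge. -/
def box : Tree := Quot.mk _ .box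

/-- Join of a multiset of clause-to-variable trees at a variable. -/
def var (ms : Multiset Tree) : Tree := Quot.mk _ (.var (ms.toList.map Quot.out))

/-- Join of a multiset of variable-to-clause trees at a clause. -/
def cls (ms : Multiset Tree) : Tree := Quot.mk _ (.cls (ms.toList.map Quot.out))

/-- Bottom-up evaluation of a tree. -/
def fold {α : Type} (fbit : Bool → α) (fbox : α) (fvar fcls : Multiset α → α) : Tree → α :=
  Quot.lift (PTree.fold fbit fbox fvar fcls) fun _ _ h => PTree.fold_step _ _ _ _ h

theorem fold_out {α : Type} (fbit : Bool → α) (fbox : α) (fvar fcls : Multiset α → α)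
    (ms : Multiset Tree) :
    (((ms.toList.map Quot.out).map (PTree.fold fbit fbox fvar fcls) : List α) : Multiset α)
      = ms.map (fold fbit fbox fvar fcls) := by
  have key : ∀ l : List Tree, ((l.map Quot.out).map (PTree.fold fbit fbox fvar fcls) : List α)
      = l.map (fold fbit fbox fvar fcls) := by
    intro l
    induction l with
    | nil => rfl
    | cons t l ih =>
      have ht : PTree.fold fbit fbox fvar fcls (Quot.out t) = fold fbit fbox fvar fcls t := by
        conv_rhs => rw [← Quot.out_eq t]
        rfl
      exact congrArg₂ List.cons ht ih
  conv_rhs => rw [← Multiset.coe_toList ms]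
  rw [key, Multiset.map_coe]

theorem fold_var {α : Type} (fbit : Bool → α) (fbox : α) (fvar fcls : Multiset α → α)
    (ms : Multiset Tree) :
    fold fbit fbox fvar fcls (var ms) = fvar (ms.map (fold fbit fbox fvar fcls)) := by
  rw [← fold_out]
  simp only [fold, var, PTree.fold, PTree.foldList_eq]

theorem fold_cls {α : Type} (fbit : Bool → α) (fbox : α) (fvar fcls : Multiset α → α)
    (ms : Multiset Tree) :
    fold fbit fbox fvar fcls (cls ms) = fcls (ms.map (fold fbit fbox fvar fcls)) := by
  rw [← fold_out]
  simp only [fold, cls, PTree.fold, PTree.foldList_eq]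

/-- Negation: exchange the labels `0` and `1` throughout the tree. -/
def neg : Tree → Tree := fold (fun x => bit (!x)) box var cls

/-- `l ⊕ t`. -/
def flip (l : Bool) (t : Tree) : Tree := if l then t.neg else t

/-- Number of free variables of a tree (the root variable of a clause-to-variable tree is not
counted). -/
def size : Tree → ℕ := fold (fun _ => 0) 0 (fun s => 1 + s.sum) (fun s => s.sum)

/-- The probability that the message assigns to the value `1`, given by the belief propagation
recursion. -/
def belief : Tree → ℝ :=
  fold (fun x => if x then 1 else 0) (1 / 2)
    (fun s => s.prod / (s.prod + (s.map fun p => 1 - p).prod))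
    (fun s => (1 - s.prod) / (2 - s.prod - (s.map fun p => 1 - p).prod))

mutual
/-- The free variable-to-clause messages. -/
inductive IsDot (d k : ℕ) : Tree → Prop
  | join (ms : Multiset Tree) (hcard : ms.card = d - 1) (h : ∀ t ∈ ms, IsHat d k t) :
      IsDot d k (var ms)
/-- The free clause-to-variable messages: the box, or a join of `k - 1` messages that are
free or equal to one and the same bit, and are not all equal to that bit. -/
inductive IsHat (d k : ℕ) : Tree → Prop
  | box : IsHat d k Tree.box
  | join (x : Bool) (ms : Multiset Tree) (hcard : ms.card = k - 1)
      (h : ∀ t ∈ ms, t ≠ bit x → IsDot d k t) (hne : ∃ t ∈ ms, t ≠ bit x) :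
      IsHat d k (cls ms)
end

theorem finite_multisets {α : Type} {S : Set α} (hS : S.Finite) (n : ℕ) :
    {ms : Multiset α | ms.card = n ∧ ∀ t ∈ ms, t ∈ S}.Finite := by
  refine (Finset.finite_toSet ((hS.toFinset.sym n).image
    (fun s : Sym α n => (s : Multiset α)))).subset ?_
  rintro ms ⟨hc, hm⟩
  simp only [Finset.coe_image, Set.mem_image, Finset.mem_coe, Finset.mem_sym_iff]
  exact ⟨⟨ms, hc⟩, fun t ht => hS.mem_toFinset.mpr (hm t ht), rfl⟩

theorem size_var (ms : Multiset Tree) : size (var ms) = 1 + (ms.map size).sum := by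
  simp only [size, fold_var]

theorem size_cls (ms : Multiset Tree) : size (cls ms) = (ms.map size).sum := by
  simp only [size, fold_cls]

theorem size_le_sum {ms : Multiset Tree} {t : Tree} (h : t ∈ ms) : size t ≤ (ms.map size).sum :=
  Multiset.single_le_sum (fun _ _ => Nat.zero_le _) _ (Multiset.mem_map_of_mem size h)

theorem finite_hat_of_dot (d k n : ℕ) (h : {t | IsDot d k t ∧ size t ≤ n}.Finite) :
    {t | IsHat d k t ∧ size t ≤ n}.Finite := by
  have h2 : ({bit false, bit true} ∪ {t | IsDot d k t ∧ size t ≤ n}).Finite :=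
    Set.Finite.union (by simp) h
  refine (((finite_multisets h2 (k - 1)).image cls).union (Set.finite_singleton box)).subset ?_
  rintro t ⟨ht, hs⟩
  cases ht with
  | box => exact Or.inr rfl
  | join x ms hcard hall hne =>
    refine Or.inl ⟨ms, ⟨hcard, fun t ht => ?_⟩, rfl⟩
    by_cases hb : t = bit x
    · left
      cases x <;> simp [hb]
    · right
      refine ⟨hall t ht hb, le_trans (size_le_sum ht) ?_⟩
      rwa [size_cls] at hs

theorem finite_dot (d k n : ℕ) : {t | IsDot d k t ∧ size t ≤ n}.Finite := by
  induction n with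
  | zero =>
    refine Set.finite_empty.subset ?_
    rintro t ⟨ht, hs⟩
    cases ht with
    | join ms hcard hall => rw [size_var] at hs; omega
  | succ n ih =>
    refine ((finite_multisets (finite_hat_of_dot d k n ih) (d - 1)).image var).subset ?_
    rintro t ⟨ht, hs⟩
    cases ht with
    | join ms hcard hall =>
      refine ⟨ms, ⟨hcard, fun t ht => ⟨hall t ht, ?_⟩⟩, rfl⟩
      rw [size_var] at hs
      have := size_le_sum ht
      omega

theorem finite_hat (d k n : ℕ) : {t | IsHat d k t ∧ size t ≤ n}.Finite :=
  finite_hat_of_dot d k n (finite_dot d k n)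

end Tree

/-! ## Colors -/

/-- Edge colors: `r x` (red), `b x` (blue), and free colors, which are pairs of a
variable-to-clause tree and a clause-to-variable tree. -/
inductive Col : Type
  | r (x : Bool) : Col
  | b (x : Bool) : Col
  | f (dt ht : Tree) : Col

/-- Variable-to-clause parts of colors. -/
inductive Spin : Type
  | r (x : Bool) : Spin
  | b (x : Bool) : Spin
  | f (t : Tree) : Spin

namespace Col

/-- The variable-to-clause part of a color. -/
def dot : Col → Spin
  | r x => .r x
  | b x => .b x
  | f dt _ => .f dt

/-- `σ ⊕ l`. -/
def flip (l : Bool) : Col → Col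
  | r x => r (xor x l)
  | b x => b (xor x l)
  | f dt ht => f (dt.flip l) (ht.flip l)

/-- The variable-to-clause message of a blue or free color (never used for red). -/
def dotTree : Col → Tree
  | r x => .bit x
  | b x => .bit x
  | f dt _ => dt

/-- The clause-to-variable message of a free color (never used for red or blue). -/
def hatTree : Col → Tree
  | r x => .bit x
  | b x => .bit x
  | f _ ht => ht

/-- The color is red. -/
def IsRed (s : Col) : Prop := ∃ x, s = r x

/-- The color is free. -/
def IsFree (s : Col) : Prop := ∃ dt ht, s = f dt ht

/-- Number of free variables encoded by a color. -/
def size : Col → ℕ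
  | r _ => 0
  | b _ => 0
  | f dt ht => dt.size + ht.size

/-- The color is one of the four frozen colors or a pair of free messages. -/
def IsColor (d k : ℕ) : Col → Prop
  | r _ => True
  | b _ => True
  | f dt ht => dt.IsDot d k ∧ ht.IsHat d k

theorem finite_size_le (d k T : ℕ) : {s : Col | s.IsColor d k ∧ s.size ≤ T}.Finite := by
  have h1 := ((Tree.finite_dot d k T).prod (Tree.finite_hat d k T)).image
    (fun p : Tree × Tree => f p.1 p.2)
  have h2 : ({r false, r true, b false, b true} : Set Col).Finite := by simp
  refine (h2.union h1).subset ?_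
  rintro s ⟨hc, hs⟩
  cases s with
  | r x => left; cases x <;> simp
  | b x => left; cases x <;> simp
  | f dt ht =>
    right
    simp only [IsColor] at hc
    simp only [size] at hs
    have h3 : dt.size ≤ T := by omega
    have h4 : ht.size ≤ T := by omega
    exact ⟨(dt, ht), ⟨⟨hc.1, h3⟩, ⟨hc.2, h4⟩⟩, rfl⟩

end Col

namespace Spin

/-- Negation of the variable-to-clause part of a color. -/
def neg : Spin → Spin
  | r x => r (!x)
  | b x => b (!x)
  | f t => f t.neg

end Spin

/-- The finite set `Ω_T` of colors that encode at most `T` free variables. -/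
def OmegaT (d k T : ℕ) : Finset Col := (Col.finite_size_le d k T).toFinset

/-- The variable-to-clause parts of the colors in `Ω_T`. -/
def OmegaDotT (d k T : ℕ) : Finset Spin := (OmegaT d k T).image Col.dot

/-! ## Local constraints and weights -/

/-- The colors `ζ` around a variable are compatible. -/
def VarOK {N : ℕ} (ζ : Fin N → Col) : Prop :=
  (∃ x, (∃ i, ζ i = .r x) ∧ ∀ i, ζ i = .r x ∨ ζ i = .b x) ∨
  ((∀ i, (ζ i).IsFree) ∧
    ∀ i, (ζ i).dotTree = Tree.var ((Finset.univ.erase i).val.map fun j => (ζ j).hatTree))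

/-- The message of a non-forcing clause to one of its variables, given the messages it
receives from its other variables. -/
def hatT (ms : Multiset Tree) : Tree :=
  if Tree.bit false ∈ ms ∧ Tree.bit true ∈ ms then Tree.box else Tree.cls ms

/-- The colors `ξ` around a clause, all of whose literals are affirmative, are compatible:
either the clause is forcing, or it is not forcing in any direction and sends the right
messages to its free variables. -/
def ClauseOK {N : ℕ} (ξ : Fin N → Col) : Prop :=
  (∃ i x, ξ i = .r x ∧ ∀ j, j ≠ i → ξ j = .b (!x)) ∨
  ((∀ i, ¬ (ξ i).IsRed) ∧ (¬ ∃ i x, ∀ j, j ≠ i → ξ j = .b x) ∧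
    ∀ i, (ξ i).IsFree →
      (ξ i).hatTree = hatT ((Finset.univ.erase i).val.map fun j => (ξ j).dotTree))

/-- The variable factor. -/
def varWeight {N : ℕ} (ζ : Fin N → Col) : ℝ :=
  if ¬ VarOK ζ then 0
  else if ∃ i, (ζ i).IsRed then 1
  else (∏ i, (ζ i).hatTree.belief) + ∏ i, (1 - (ζ i).hatTree.belief)

/-- The clause factor (all literals affirmative). -/
def clauseWeight {N : ℕ} (ξ : Fin N → Col) : ℝ :=
  if ¬ ClauseOK ξ then 0
  else if ∃ i, (ξ i).IsRed then 1
  else if (∃ i, ξ i = .b false) ∧ (∃ i, ξ i = .b true) then 1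
  else 1 - (∏ i, (ξ i).dotTree.belief) - ∏ i, (1 - (ξ i).dotTree.belief)

/-- The edge factor. -/
def edgeWeight : Col → ℝ
  | .r _ => 1
  | .b _ => 1
  | .f dt ht => (dt.belief * ht.belief + (1 - dt.belief) * (1 - ht.belief))⁻¹

/-- `x ^ lam` with the convention that `0 ^ 0 = 0`. -/
def tilt (lam x : ℝ) : ℝ := if x = 0 then 0 else x ^ lam

/-- The average over uniformly random literals of the `lam`-th power of the clause factor. -/
def avgClause (lam : ℝ) {N : ℕ} (ξ : Fin N → Col) : ℝ :=
  (∑ L : Fin N → Bool, tilt lam (clauseWeight fun i => (ξ i).flip (L i))) / 2 ^ N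

/-- The fraction of literal assignments that are compatible with `ξ`. -/
def vhat {N : ℕ} (ξ : Fin N → Col) : ℝ :=
  (∑ L : Fin N → Bool, if ClauseOK (fun i => (ξ i).flip (L i)) then (1 : ℝ) else 0) / 2 ^ N

/-- The maximum over literal assignments of the clause factor. -/
def maxClause {N : ℕ} (ξ : Fin N → Col) : ℝ :=
  ⨆ L : Fin N → Bool, clauseWeight fun i => (ξ i).flip (L i)

/-! ## Random instances and colorings -/

/-- A `d`-regular `k`-NAE-SAT instance with `n` variables and `m` clauses: a perfect matching of
the variable half-edges with the clause half-edges (multiple edges are allowed), and a literal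
for every edge. Edges are named by their variable half-edge. -/
abbrev Instance (n m d k : ℕ) : Type :=
  ((Fin n × Fin d) ≃ (Fin m × Fin k)) × (Fin n × Fin d → Bool)

/-- Expectation with respect to the uniformly random instance. -/
def expectation {n m d k : ℕ} (X : Instance n m d k → ℝ) : ℝ :=
  (∑ G, X G) / Fintype.card (Instance n m d k)

/-- Edge configurations. -/
abbrev Config (n d : ℕ) : Type := Fin n × Fin d → Col

/-- The colors on the edges around a variable. -/
def atVar {n d : ℕ} (σ : Config n d) (v : Fin n) : Fin d → Col := fun i => σ (v, i)

/-- The colors on the edges around a clause. -/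
def atClause {n m d k : ℕ} (G : Instance n m d k) (σ : Config n d) (a : Fin m) : Fin k → Col :=
  fun j => σ (G.1.symm (a, j))

/-- The colors around a clause, each shifted by the literal of its edge. -/
def atClauseLit {n m d k : ℕ} (G : Instance n m d k) (σ : Config n d) (a : Fin m) :
    Fin k → Col :=
  fun j => (σ (G.1.symm (a, j))).flip (G.2 (G.1.symm (a, j)))

/-- The valid `T`-colorings of an instance. -/
def colorings {n m d k : ℕ} (T : ℕ) (G : Instance n m d k) : Finset (Config n d) :=
  (Fintype.piFinset fun _ => OmegaT d k T).filter fun σ =>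
    (∀ v, VarOK (atVar σ v)) ∧ ∀ a, ClauseOK (atClauseLit G σ a)

/-- The weight of a coloring (the size of the cluster that it encodes). -/
def weight {n m d k : ℕ} (G : Instance n m d k) (σ : Config n d) : ℝ :=
  (∏ v, varWeight (atVar σ v)) * (∏ a, clauseWeight (atClauseLit G σ a)) * ∏ e, edgeWeight (σ e)

/-! ## Empirical measures -/

/-- A triple of a variable measure, a clause measure and an edge measure. -/
structure Profile (d k : ℕ) where
  /-- measure on the colors around a variable -/
  dot : (Fin d → Col) → ℝ
  /-- measure on the colors around a clause -/
  hat : (Fin k → Col) → ℝ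
  /-- measure on the colors of an edge -/
  bar : Col → ℝ

/-- The empirical measure of an edge configuration. -/
def empirical {n m d k : ℕ} (G : Instance n m d k) (σ : Config n d) : Profile d k where
  dot ζ := ((Finset.univ.filter fun v => atVar σ v = ζ).card : ℝ) / n
  hat ξ := ((Finset.univ.filter fun a => atClause G σ a = ξ).card : ℝ) / m
  bar s := ((Finset.univ.filter fun e => σ e = s).card : ℝ) / (n * d)

/-- The `ℓ¹` distance of two triples of measures on `Ω_T^d`, `Ω_T^k` and `Ω_T`. -/
def profileDist {d k : ℕ} (T : ℕ) (H H' : Profile d k) : ℝ :=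
  (∑ ζ ∈ Fintype.piFinset fun _ => OmegaT d k T, |H.dot ζ - H'.dot ζ|) +
  (∑ ξ ∈ Fintype.piFinset fun _ => OmegaT d k T, |H.hat ξ - H'.hat ξ|) +
  ∑ s ∈ OmegaT d k T, |H.bar s - H'.bar s|

/-- The triples of probability measures that are carried by compatible tuples of colors in
`Ω_T` and are consistent: the edge measure is the edge marginal of the variable measure and of
the clause measure. -/
structure Profile.Admissible {d k : ℕ} (T : ℕ) (H : Profile d k) : Prop where
  dot_nonneg : ∀ ζ, 0 ≤ H.dot ζ
  hat_nonneg : ∀ ξ, 0 ≤ H.hat ξ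
  dot_supp : ∀ ζ, H.dot ζ ≠ 0 → (∀ i, ζ i ∈ OmegaT d k T) ∧ VarOK ζ
  hat_supp : ∀ ξ, H.hat ξ ≠ 0 → (∀ i, ξ i ∈ OmegaT d k T) ∧ vhat ξ ≠ 0
  dot_sum : ∑ ζ ∈ Fintype.piFinset fun _ => OmegaT d k T, H.dot ζ = 1
  hat_sum : ∑ ξ ∈ Fintype.piFinset fun _ => OmegaT d k T, H.hat ξ = 1
  bar_dot : ∀ s, d * H.bar s = ∑ ζ ∈ Fintype.piFinset fun _ => OmegaT d k T,
    H.dot ζ * (Finset.univ.filter fun i => ζ i = s).card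
  bar_hat : ∀ s, k * H.bar s = ∑ ξ ∈ Fintype.piFinset fun _ => OmegaT d k T,
    H.hat ξ * (Finset.univ.filter fun i => ξ i = s).card

/-- The exponential rate `F(H) = Σ(H) + lam * s(H)` of the expected contribution of the
empirical measure `H` to the partition function. -/
def rate {d k : ℕ} (lam : ℝ) (T : ℕ) (H : Profile d k) : ℝ :=
  (∑ ζ ∈ Fintype.piFinset fun _ => OmegaT d k T, Real.negMulLog (H.dot ζ)) +
  (d / k : ℝ) * (∑ ξ ∈ Fintype.piFinset fun _ => OmegaT d k T, Real.negMulLog (H.hat ξ)) -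
  d * (∑ s ∈ OmegaT d k T, Real.negMulLog (H.bar s)) +
  (d / k : ℝ) * (∑ ξ ∈ Fintype.piFinset fun _ => OmegaT d k T, H.hat ξ * Real.log (vhat ξ)) +
  lam *
    ((∑ ζ ∈ Fintype.piFinset fun _ => OmegaT d k T, H.dot ζ * Real.log (varWeight ζ)) +
    (d / k : ℝ) *
      (∑ ξ ∈ Fintype.piFinset fun _ => OmegaT d k T, H.hat ξ * Real.log (maxClause ξ)) +
    d * ∑ s ∈ OmegaT d k T, H.bar s * Real.log (edgeWeight s))

/-! ## Belief propagation and the typical empirical measure -/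

/-- Restrict a function to `Ω_T` and normalize it to total mass one. -/
def normalize (d k T : ℕ) (g : Col → ℝ) (s : Col) : ℝ :=
  (if s ∈ OmegaT d k T then g s else 0) / ∑ s' ∈ OmegaT d k T, g s'

/-- The variable recursion of belief propagation. -/
def varBP (d k T : ℕ) (lam : ℝ) (Q : Col → ℝ) : Col → ℝ :=
  normalize d k T fun s => edgeWeight s ^ lam *
    ∑ η ∈ Fintype.piFinset fun _ : Fin (d - 1) => OmegaT d k T,
      tilt lam (varWeight (Matrix.vecCons s η)) * ∏ i, Q (η i)

/-- The clause recursion of belief propagation, averaged over the literals. -/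
def clauseBP (d k T : ℕ) (lam : ℝ) (Q : Col → ℝ) : Col → ℝ :=
  normalize d k T fun s => edgeWeight s ^ lam *
    ∑ η ∈ Fintype.piFinset fun _ : Fin (k - 1) => OmegaT d k T,
      avgClause lam (Matrix.vecCons s η) * ∏ i, Q (η i)

/-- The measure on `Ω_T` that depends only on the variable-to-clause part of the color,
through `q`. -/
def lift (d k T : ℕ) (q : Spin → ℝ) : Col → ℝ := normalize d k T fun s => q s.dot

/-- `q` is a one-sided fixed point of belief propagation. -/
def IsBPFixedPoint (d k T : ℕ) (lam : ℝ) (q : Spin → ℝ) : Prop :=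
  varBP d k T lam (clauseBP d k T lam (lift d k T q)) = lift d k T q

/-- The set of measures on which belief propagation is analyzed, with `C` for the implied
constants: probability measures on the variable-to-clause parts of the colors in `Ω_T`,
invariant under negation, with `q(r) + 2^k q(f) ≤ C q(b)` and `(1 - C / 2^k) q(b) ≤ q(r)`. -/
structure Gamma (C : ℝ) (d k T : ℕ) (q : Spin → ℝ) : Prop where
  nonneg : ∀ s, 0 ≤ q s
  supp : ∀ s, s ∉ OmegaDotT d k T → q s = 0
  sum_eq_one : ∑ s ∈ OmegaDotT d k T, q s = 1
  neg_invariant : ∀ s, q s.neg = q s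
  upper : (q (.r false) + q (.r true)) +
      2 ^ k * (∑ s ∈ (OmegaDotT d k T).filter fun s => ∃ t, s = .f t, q s)
    ≤ C * (q (.b false) + q (.b true))
  lower : (1 - C / 2 ^ k) * (q (.b false) + q (.b true)) ≤ q (.r false) + q (.r true)

/-- The typical empirical measure `H_⋆` given by a belief propagation fixed point `q`. -/
def Hstar (d k T : ℕ) (lam : ℝ) (q : Spin → ℝ) : Profile d k where
  dot ζ := tilt lam (varWeight ζ) * (∏ i, clauseBP d k T lam (lift d k T q) (ζ i)) /
    ∑ ζ' ∈ Fintype.piFinset fun _ : Fin d => OmegaT d k T,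
      tilt lam (varWeight ζ') * ∏ i, clauseBP d k T lam (lift d k T q) (ζ' i)
  hat ξ := avgClause lam ξ * (∏ i, lift d k T q (ξ i)) /
    ∑ ξ' ∈ Fintype.piFinset fun _ : Fin k => OmegaT d k T,
      avgClause lam ξ' * ∏ i, lift d k T q (ξ' i)
  bar := normalize d k T fun s => edgeWeight s ^ (-lam) *
    (lift d k T q s * clauseBP d k T lam (lift d k T q) s)

/-! ## Separable colorings -/

/-- The valid `T`-colorings with empirical measure within distance `n ^ (-1/3)` of `H`. -/
def near {n m d k : ℕ} (T : ℕ) (H : Profile d k) (G : Instance n m d k) :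
    Finset (Config n d) :=
  (colorings T G).filter fun σ => profileDist T (empirical G σ) H ≤ (n : ℝ) ^ (-(1 / 3) : ℝ)

/-- The frozen configuration of a coloring: a variable has value `x` if it has an incident edge
of color `r x`, and it is free (`none`) if it has no incident red edge. -/
def frozen {n d : ℕ} (σ : Config n d) (v : Fin n) : Option Bool :=
  if ∃ i, σ (v, i) = .r false then some false
  else if ∃ i, σ (v, i) = .r true then some true
  else none

/-- The number of free variables of a coloring. -/
def numFree {n d : ℕ} (σ : Config n d) : ℕ :=
  (Finset.univ.filter fun v => frozen σ v = none).card

/-- The fraction of variables at which the frozen configurations differ. -/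
def overlap {n d : ℕ} (σ σ' : Config n d) : ℝ :=
  ((Finset.univ.filter fun v => frozen σ v ≠ frozen σ' v).card : ℝ) / n

/-- The interval of nearly uncorrelated pairs. -/
def Isep (k : ℕ) : Set ℝ :=
  Set.Icc ((1 - (k : ℝ) ^ 4 / (2 : ℝ) ^ ((k : ℝ) / 2)) / 2)
    ((1 + (k : ℝ) ^ 4 / (2 : ℝ) ^ ((k : ℝ) / 2)) / 2)

/-- Separability: at most `exp ((log n) ^ 4)` of the colorings near `H` have at least as many
free variables as `σ` and an overlap with `σ` outside the interval. -/
def Separable {n m d k : ℕ} (T : ℕ) (H : Profile d k) (G : Instance n m d k)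
    (σ : Config n d) : Prop :=
  (((near T H G).filter fun σ' => numFree σ ≤ numFree σ' ∧ overlap σ σ' ∉ Isep k).card : ℝ)
    ≤ Real.exp (Real.log n ^ 4)

/-- The contribution of the colorings near `H` to the partition function. -/
def Znear {n m d k : ℕ} (lam : ℝ) (T : ℕ) (H : Profile d k) (G : Instance n m d k) : ℝ :=
  ∑ σ ∈ near T H G, weight G σ ^ lam

/-- The contribution of the separable colorings near `H` to the partition function. -/
def Snear {n m d k : ℕ} (lam : ℝ) (T : ℕ) (H : Profile d k) (G : Instance n m d k) : ℝ :=
  ∑ σ ∈ (near T H G).filter (Separable T H G), weight G σ ^ lam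

end NAESat

end

namespace NAESat

-- Negation, sizes and beliefs of trees; signs of the local weights.

namespace PTree

-- The argument is a first moment computation relative to one fixed coloring `σ`. The contribution
-- of `σ` to the partition function depends on the instance only through the colors and literals
-- that meet at each clause. It is unchanged when the half-edges of one blue color `b x` are
-- permuted among themselves, the literals staying with the clauses. Hence, in an expectation
-- weighted by this contribution, any statistic may be averaged over these permutations
-- (`sum_contribution_mul_le`), and up to a polynomial factor a random permutation behaves like
-- independent sampling of blue half-edges (`sum_colorPerms_le`). It suffices that, uniformly in
-- `σ`, the expected number of obstructions to separability tends to zero.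
--
-- Obstructions are counted through frozen configurations, which determine colorings
-- (`coloring_ext`). Only the necessary conditions `FrozenValid` are used; they are invariant under
-- global negation. If `σ'` has at least as many free variables as `σ` and an overlap outside the
-- interval, then either its frozen configuration or the negation of it changes at most `n / (8k)`
-- frozen variables of `σ`, or it lies at intermediate distance (`intermediate_of_overlap`).
--
-- Small distance. Suppose `j` frozen variables change. A red edge at a changed variable must share
-- its clause with a blue edge at a changed variable, since otherwise its variable would still be
-- forced. At most `j` free variables become frozen. Following the forcing backwards, these are
-- governed by the ones forced at a clause that contains a changed frozen variable; the regress is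
-- well founded because messages are finite trees (`agree_of_agree_triggered`). Each required
-- coincidence in a clause has probability of order `k j / n`. In a typical coloring few frozen
-- variables have few red edges, and few edges are free, so the expected number of configurations is
-- at most a polynomial in `n` times `exp (-j)` (`Typical.sum_card_nearbyFrozen_le`). Those with `j
-- ≥ (log n) ^ 2` are therefore negligible, and the others lie in two Hamming balls with fewer than
-- `exp ((log n) ^ 4)` points in total.
--
-- Intermediate distance. At an all-blue clause where `x'` agrees and disagrees with `σ` at least
-- twice each, two of the literal patterns allowed by `σ` violate `x'`; averaging over literals
-- costs a factor `1 - 2 / 2 ^ k` (`sum_contribution_frozenValid_le`). Since `2 m / 2 ^ k` is about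
-- `n log 2`, flipping a fraction `t` of the variables costs about `n log 2 * (1 - extremeProb k
-- t)`, against an entropy `n * binEntropy t`. The entropy is at most `log 2 - (t - 1/2) ^ 2` per
-- variable, and outside the excluded window this deficit, or near the ends the smallness of the
-- entropy, beats `extremeProb` and the error terms (`entropy_energy`).
--
-- Typicality of every coloring near `Hstar` comes from the inequalities that define `Gamma`: all
-- blue patterns at a clause have nearly equal frequency, and a red message from a clause is at
-- least `2 ^ (-k)` times as likely as a blue one, so that a frozen variable, of degree about `k 2 ^
-- k`, rarely has few red edges (`Gamma.typical_of_near`).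

theorem fold_mem {α : Type} (s : Set α) (fbit : Bool → α) (fbox : α) (fvar fcls : Multiset α → α)
    (h1 : ∀ x, fbit x ∈ s) (h2 : fbox ∈ s) (h3 : ∀ m : Multiset α, (∀ a ∈ m, a ∈ s) → fvar m ∈ s)
    (h4 : ∀ m : Multiset α, (∀ a ∈ m, a ∈ s) → fcls m ∈ s) (p : PTree) :
    fold fbit fbox fvar fcls p ∈ s := by
  refine PTree.rec (motive_1 := fun p => fold fbit fbox fvar fcls p ∈ s)
    (motive_2 := fun l => ∀ a ∈ foldList fbit fbox fvar fcls l, a ∈ s) ?_ ?_ ?_ ?_ ?_ ?_ p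
  · intro x; simpa [fold] using h1 x
  · simpa [fold] using h2
  · intro l hl; simpa [fold] using h3 _ (by simpa using hl)
  · intro l hl; simpa [fold] using h4 _ (by simpa using hl)
  · simp [foldList]
  · intro t l ht hl
    simpa [foldList] using ⟨ht, hl⟩

end PTree

namespace Tree

theorem prod_mem_unit {m : Multiset ℝ} (h : ∀ a ∈ m, a ∈ Set.Icc (0 : ℝ) 1) :
    m.prod ∈ Set.Icc (0 : ℝ) 1 := by
  induction m using Multiset.induction with
  | empty => simp
  | cons a m ih =>
    have ha := h a (by simp)
    have hm := ih fun b hb => h b (by simp [hb])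
    rw [Multiset.prod_cons]
    exact ⟨mul_nonneg ha.1 hm.1, mul_le_one₀ ha.2 hm.1 hm.2⟩

theorem prod_compl_mem_unit {m : Multiset ℝ} (h : ∀ a ∈ m, a ∈ Set.Icc (0 : ℝ) 1) :
    (m.map fun p => 1 - p).prod ∈ Set.Icc (0 : ℝ) 1 := by
  refine prod_mem_unit fun a ha => ?_
  obtain ⟨b, hb, rfl⟩ := Multiset.mem_map.1 ha
  have := h b hb
  exact ⟨by linarith [this.2], by linarith [this.1]⟩

/-- The denominators may vanish; the quotient is then `0`, which still lies in the unit interval. -/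
theorem belief_mem (t : Tree) : belief t ∈ Set.Icc (0 : ℝ) 1 := by
  induction t using Quot.ind with
  | mk p =>
  refine PTree.fold_mem (Set.Icc (0 : ℝ) 1) _ _ _ _ ?_ ?_ ?_ ?_ p
  · intro x; cases x <;> simp
  · norm_num
  · intro m hm
    have h1 := prod_mem_unit hm
    have h2 := prod_compl_mem_unit hm
    exact ⟨div_nonneg h1.1 (add_nonneg h1.1 h2.1),
      div_le_one_of_le₀ (by linarith [h2.1]) (add_nonneg h1.1 h2.1)⟩
  · intro m hm
    have h1 := prod_mem_unit hm
    have h2 := prod_compl_mem_unit hm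
    have h3 : 0 ≤ 2 - m.prod - (m.map fun p => 1 - p).prod := by linarith [h1.2, h2.2]
    exact ⟨div_nonneg (by linarith [h1.2]) h3, div_le_one_of_le₀ (by linarith [h2.2]) h3⟩

theorem belief_nonneg (t : Tree) : 0 ≤ belief t := (belief_mem t).1

theorem belief_le_one (t : Tree) : belief t ≤ 1 := (belief_mem t).2

@[simp] theorem neg_bit (x : Bool) : neg (bit x) = bit (!x) := rfl

theorem neg_var (ms : Multiset Tree) : neg (var ms) = var (ms.map neg) := fold_var _ _ _ _ _

theorem neg_cls (ms : Multiset Tree) : neg (cls ms) = cls (ms.map neg) := fold_cls _ _ _ _ _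

theorem size_bit (x : Bool) : size (bit x) = 0 := rfl

/-- The induction follows the two message classes, whose constructors are the joins `var ms` and
`cls ms` on which `neg` and `size` compute. -/
theorem neg_neg_and_size {d k : ℕ} {t : Tree} (h : IsDot d k t ∨ IsHat d k t) :
    neg (neg t) = t ∧ size (neg t) = size t := by
  have key : (∀ t, IsDot d k t → neg (neg t) = t ∧ size (neg t) = size t) ∧
      (∀ t, IsHat d k t → neg (neg t) = t ∧ size (neg t) = size t) := by
    have aux : ∀ ms : Multiset Tree, (∀ t ∈ ms, neg (neg t) = t ∧ size (neg t) = size t) →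
        (ms.map neg).map neg = ms ∧ ((ms.map neg).map size).sum = (ms.map size).sum := by
      intro ms hms
      rw [Multiset.map_map, Multiset.map_map]
      refine ⟨?_, ?_⟩
      · conv_rhs => rw [← Multiset.map_id ms]
        exact Multiset.map_congr rfl fun t ht => (hms t ht).1
      · exact congrArg Multiset.sum (Multiset.map_congr rfl fun t ht => (hms t ht).2)
    refine ⟨fun t ht => ?_, fun t ht => ?_⟩
    · refine IsDot.rec (motive_1 := fun t _ => neg (neg t) = t ∧ size (neg t) = size t)
        (motive_2 := fun t _ => neg (neg t) = t ∧ size (neg t) = size t) ?_ ?_ ?_ ht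
      · intro ms _ _ ih
        obtain ⟨h1, h2⟩ := aux ms ih
        rw [neg_var, neg_var, h1, size_var, size_var, h2]
        exact ⟨rfl, rfl⟩
      · exact ⟨rfl, rfl⟩
      · intro x ms _ _ _ ih
        obtain ⟨h1, h2⟩ := aux ms fun t ht => by
          by_cases hb : t = bit x
          · subst hb; simp [size_bit]
          · exact ih t ht hb
        rw [neg_cls, neg_cls, h1, size_cls, size_cls, h2]
        exact ⟨rfl, rfl⟩
    · refine IsHat.rec (motive_1 := fun t _ => neg (neg t) = t ∧ size (neg t) = size t)
        (motive_2 := fun t _ => neg (neg t) = t ∧ size (neg t) = size t) ?_ ?_ ?_ ht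
      · intro ms _ _ ih
        obtain ⟨h1, h2⟩ := aux ms ih
        rw [neg_var, neg_var, h1, size_var, size_var, h2]
        exact ⟨rfl, rfl⟩
      · exact ⟨rfl, rfl⟩
      · intro x ms _ _ _ ih
        obtain ⟨h1, h2⟩ := aux ms fun t ht => by
          by_cases hb : t = bit x
          · subst hb; simp [size_bit]
          · exact ih t ht hb
        rw [neg_cls, neg_cls, h1, size_cls, size_cls, h2]
        exact ⟨rfl, rfl⟩
  exact h.elim (key.1 t) (key.2 t)

theorem flip_flip {d k : ℕ} {t : Tree} (h : IsDot d k t ∨ IsHat d k t) (l : Bool) :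
    (t.flip l).flip l = t := by
  cases l
  · rfl
  · exact (neg_neg_and_size h).1

theorem size_flip {d k : ℕ} {t : Tree} (h : IsDot d k t ∨ IsHat d k t) (l : Bool) :
    size (t.flip l) = size t := by
  cases l
  · rfl
  · exact (neg_neg_and_size h).2

/-- A join at a variable has size at least one, a bit has size zero. -/
theorem IsDot.ne_bit {d k : ℕ} {t : Tree} (h : IsDot d k t) (x : Bool) : t ≠ bit x := by
  intro he
  cases h with
  | join ms hc hh =>
    have h1 := congrArg size he
    rw [size_var, size_bit] at h1
    omega

theorem bit_injective : Function.Injective bit := by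
  intro x y h
  have h1 : ∀ z, belief (bit z) = if z then 1 else 0 := fun z => rfl
  have := congrArg belief h
  rw [h1, h1] at this
  cases x <;> cases y <;> simp_all

theorem flip_bit (l x : Bool) : (bit x).flip l = bit (xor x l) := by
  cases l <;> simp [flip]

theorem flip_ne_bit {d k : ℕ} {t : Tree} (h : IsDot d k t) (l x : Bool) :
    t.flip l ≠ bit x := by
  intro he
  apply h.ne_bit (xor x l)
  rw [← flip_flip (Or.inl h) l, he, flip_bit]

end Tree

theorem varWeight_nonneg {N : ℕ} (ζ : Fin N → Col) : 0 ≤ varWeight ζ := by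
  unfold varWeight
  split_ifs
  · exact zero_le_one
  · exact add_nonneg (Finset.prod_nonneg fun i _ => Tree.belief_nonneg _)
      (Finset.prod_nonneg fun i _ => sub_nonneg.2 (Tree.belief_le_one _))
  · exact le_rfl

theorem edgeWeight_nonneg (s : Col) : 0 ≤ edgeWeight s := by
  cases s with
  | r x => exact zero_le_one
  | b x => exact zero_le_one
  | f dt ht =>
    exact inv_nonneg.2 (add_nonneg (mul_nonneg (Tree.belief_nonneg _) (Tree.belief_nonneg _))
      (mul_nonneg (sub_nonneg.2 (Tree.belief_le_one _)) (sub_nonneg.2 (Tree.belief_le_one _))))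

/-- Keeping one factor of each product leaves `p + (1 - p)`. The index set must be nonempty, because
two empty products add up to `2`. -/
theorem prod_add_prod_compl_le {N : ℕ} (hN : 0 < N) {p : Fin N → ℝ}
    (hp : ∀ i, p i ∈ Set.Icc (0 : ℝ) 1) : (∏ i, p i) + ∏ i, (1 - p i) ≤ 1 := by
  have h1 : ∏ i, p i ≤ p ⟨0, hN⟩ := by
    rw [← Finset.mul_prod_erase _ _ (Finset.mem_univ (⟨0, hN⟩ : Fin N))]
    exact mul_le_of_le_one_right (hp _).1 (Finset.prod_le_one (fun i _ => (hp i).1)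
      fun i _ => (hp i).2)
  have h2 : ∏ i, (1 - p i) ≤ 1 - p ⟨0, hN⟩ := by
    rw [← Finset.mul_prod_erase _ _ (Finset.mem_univ (⟨0, hN⟩ : Fin N))]
    exact mul_le_of_le_one_right (sub_nonneg.2 (hp _).2)
      (Finset.prod_le_one (fun i _ => sub_nonneg.2 (hp i).2)
      fun i _ => by linarith [(hp i).1])
  linarith

theorem clauseWeight_nonneg {N : ℕ} (hN : 0 < N) (ξ : Fin N → Col) : 0 ≤ clauseWeight ξ := by
  unfold clauseWeight
  split_ifs
  · exact zero_le_one
  · exact zero_le_one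
  · have := prod_add_prod_compl_le hN fun i => Tree.belief_mem (ξ i).dotTree
    linarith
  · exact le_rfl

theorem clauseWeight_le_one {N : ℕ} (ξ : Fin N → Col) : clauseWeight ξ ≤ 1 := by
  unfold clauseWeight
  split_ifs
  · exact le_rfl
  · exact le_rfl
  · have h1 : 0 ≤ ∏ i, (ξ i).dotTree.belief := Finset.prod_nonneg fun i _ => Tree.belief_nonneg _
    have h2 : 0 ≤ ∏ i, (1 - (ξ i).dotTree.belief) :=
      Finset.prod_nonneg fun i _ => sub_nonneg.2 (Tree.belief_le_one _)
    linarith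
  · exact zero_le_one

theorem tilt_nonneg {lam x : ℝ} (hx : 0 ≤ x) : 0 ≤ tilt lam x := by
  unfold tilt
  split_ifs
  · exact le_rfl
  · exact Real.rpow_nonneg hx _

theorem tilt_le_one {lam x : ℝ} (hl : 0 ≤ lam) (hx : 0 ≤ x) (hx1 : x ≤ 1) : tilt lam x ≤ 1 := by
  unfold tilt
  split_ifs
  · exact zero_le_one
  · exact Real.rpow_le_one hx hx1 hl

@[simp] theorem tilt_one {lam : ℝ} : tilt lam 1 = 1 := by simp [tilt]

theorem mem_OmegaT {d k T : ℕ} {s : Col} : s ∈ OmegaT d k T ↔ s.IsColor d k ∧ s.size ≤ T := by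
  simp [OmegaT]

@[simp] theorem r_mem_OmegaT {d k T : ℕ} (x : Bool) : Col.r x ∈ OmegaT d k T := by
  simp [mem_OmegaT, Col.IsColor, Col.size]

@[simp] theorem b_mem_OmegaT {d k T : ℕ} (x : Bool) : Col.b x ∈ OmegaT d k T := by
  simp [mem_OmegaT, Col.IsColor, Col.size]

/-! ### Frozen configurations -/

/-- The bit that a frozen color carries. -/
def Col.value : Col → Option Bool
  | .r x => some x
  | .b x => some x
  | .f _ _ => none

/-- The edges at a compatible variable either carry one common bit or are all free, so a single edge
reveals the status of the variable. Clause conditions can then be phrased edge by edge. -/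
theorem frozen_eq_value {n d : ℕ} {σ : Config n d} {v : Fin n}
    (h : VarOK (atVar σ v)) (i : Fin d) : frozen σ v = (σ (v, i)).value := by
  rcases h with ⟨x, ⟨i0, h0⟩, hall⟩ | ⟨hf, -⟩
  · have h1 : (σ (v, i)).value = some x := by
      rcases hall i with h | h <;> simp only [atVar] at h <;> rw [h] <;> rfl
    have h2 : ∀ j y, σ (v, j) = .r y → y = x := by
      intro j y hy
      rcases hall j with h | h <;> simp only [atVar] at h <;> rw [hy] at h <;> simp_all
    rw [h1]
    unfold frozen
    cases x
    · rw [if_pos ⟨i0, h0⟩]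
    · rw [if_neg, if_pos ⟨i0, h0⟩]
      rintro ⟨j, hj⟩
      simpa using h2 j _ hj
  · have h1 : ∀ j x, σ (v, j) ≠ .r x := by
      intro j x hj
      obtain ⟨a, b, hab⟩ := hf j
      simp only [atVar] at hab
      rw [hj] at hab
      cases hab
    obtain ⟨a, b, hab⟩ := hf i
    simp only [atVar] at hab
    rw [hab]
    unfold frozen
    rw [if_neg (by rintro ⟨j, hj⟩; exact h1 _ _ hj), if_neg (by rintro ⟨j, hj⟩; exact h1 _ _ hj)]
    rfl

/-- The values of the variables, with `none` for a free variable, form a valid frozen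
configuration: every frozen variable is forced by some clause, and a clause whose other
variables all fail to satisfy it forces the last one. -/
structure FrozenValid {n m d k : ℕ} (G : Instance n m d k) (x : Fin n → Option Bool) : Prop where
  forced : ∀ v y, x v = some y → ∃ i : Fin d, ∀ e : Fin n × Fin d, e ≠ (v, i) →
    (G.1 e).1 = (G.1 (v, i)).1 → x e.1 = some (xor (xor (!y) (G.2 (v, i))) (G.2 e))
  forces : ∀ (e : Fin n × Fin d) (y : Bool),
    (∀ e' : Fin n × Fin d, e' ≠ e → (G.1 e').1 = (G.1 e).1 → x e'.1 = some (xor (!y) (G.2 e'))) →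
      x e.1 = some (xor y (G.2 e))

/-- If a clause forced two different edges, a third edge would need two opposite literal values.
This supplies the third edge and is the source of the condition `3 ≤ k`. -/
theorem exists_clause_edge_ne_ne {n m d k : ℕ} (hk : 3 ≤ k) (G : Instance n m d k)
    (e f : Fin n × Fin d) :
    ∃ e', e' ≠ e ∧ e' ≠ f ∧ (G.1 e').1 = (G.1 e).1 := by
  obtain ⟨j, hj⟩ : ∃ j : Fin k, j ∉ ({(G.1 e).2, (G.1 f).2} : Finset (Fin k)) := by
    by_contra hall
    push Not at hall
    have h1 := Finset.card_le_card fun j (_ : j ∈ Finset.univ) => hall j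
    have h2 := Finset.card_le_two (a := (G.1 e).2) (b := (G.1 f).2)
    simp at h1
    omega
  simp only [Finset.mem_insert, Finset.mem_singleton, not_or] at hj
  refine ⟨G.1.symm ((G.1 e).1, j), ?_, ?_, by simp⟩
  · intro h; exact hj.1 (by rw [← h]; simp)
  · intro h; exact hj.2 (by rw [← h]; simp)

theorem exists_clause_edge_ne {n m d k : ℕ} (hk : 2 ≤ k) (G : Instance n m d k)
    (e : Fin n × Fin d) : ∃ e', e' ≠ e ∧ (G.1 e').1 = (G.1 e).1 := by
  haveI : Nontrivial (Fin k) := Fin.nontrivial_iff_two_le.2 hk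
  obtain ⟨j, hj⟩ := exists_ne (G.1 e).2
  refine ⟨G.1.symm ((G.1 e).1, j), fun h => hj (by rw [← h]; simp), by simp⟩

section coloring
variable {n m d k T : ℕ} {G : Instance n m d k} {σ : Config n d}

theorem mem_colorings : σ ∈ colorings T G ↔ (∀ e, σ e ∈ OmegaT d k T) ∧
    (∀ v, VarOK (atVar σ v)) ∧ ∀ a, ClauseOK (atClauseLit G σ a) := by
  simp [colorings]

theorem colorings_value (h : σ ∈ colorings T G) (e : Fin n × Fin d) :
    frozen σ e.1 = (σ e).value :=
  frozen_eq_value ((mem_colorings.1 h).2.1 e.1) e.2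

theorem atClauseLit_apply (e : Fin n × Fin d) :
    atClauseLit G σ (G.1 e).1 (G.1 e).2 = (σ e).flip (G.2 e) := by
  simp [atClauseLit]

theorem flip_eq_r {s : Col} {l y : Bool} : s.flip l = .r y ↔ s = .r (xor y l) := by
  cases s <;> cases l <;> cases y <;> simp [Col.flip]

theorem flip_eq_b {s : Col} {l y : Bool} : s.flip l = .b y ↔ s = .b (xor y l) := by
  cases s <;> cases l <;> cases y <;> simp [Col.flip]

theorem isRed_flip {s : Col} {l : Bool} : (s.flip l).IsRed ↔ s.IsRed := by
  cases s <;> simp [Col.flip, Col.IsRed]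

theorem isFree_flip {s : Col} {l : Bool} : (s.flip l).IsFree ↔ s.IsFree := by
  cases s <;> simp [Col.flip, Col.IsFree]

theorem value_eq_none {s : Col} : s.value = none ↔ s.IsFree := by
  cases s <;> simp [Col.value, Col.IsFree]

theorem value_eq_some {s : Col} {x : Bool} : s.value = some x ↔ s = .r x ∨ s = .b x := by
  cases s <;> simp [Col.value]

/-- The clause condition at the clause of `e`, in terms of edges. -/
theorem clauseOK_edge (h : σ ∈ colorings T G) (e : Fin n × Fin d) :
    (∃ e0 y, (G.1 e0).1 = (G.1 e).1 ∧ σ e0 = .r (xor y (G.2 e0)) ∧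
      ∀ e', e' ≠ e0 → (G.1 e').1 = (G.1 e).1 → σ e' = .b (xor (!y) (G.2 e'))) ∨
    ((∀ e', (G.1 e').1 = (G.1 e).1 → ¬ (σ e').IsRed) ∧
      (∀ e0 y, (G.1 e0).1 = (G.1 e).1 →
        ¬ ∀ e', e' ≠ e0 → (G.1 e').1 = (G.1 e).1 → σ e' = .b (xor y (G.2 e')))) := by
  rcases (mem_colorings.1 h).2.2 (G.1 e).1 with ⟨i, x, h1, h2⟩ | ⟨h1, h2, -⟩
  · left
    refine ⟨G.1.symm ((G.1 e).1, i), x, by simp, flip_eq_r.1 h1, ?_⟩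
    intro e' hne hc
    have h3 := h2 (G.1 e').2 (by
      rintro rfl
      apply hne
      rw [← hc]; simp)
    rw [← hc, atClauseLit_apply] at h3
    exact flip_eq_b.1 h3
  · right
    refine ⟨fun e' hc hr => h1 (G.1 e').2 ?_, fun e0 y h0 hall => h2 ⟨(G.1 e0).2, y, ?_⟩⟩
    · rw [← hc, atClauseLit_apply, isRed_flip]; exact hr
    · intro j hj
      refine flip_eq_b.2 (hall _ ?_ (by simp))
      rintro rfl
      simp at hj

/-- All other edges of the clause of a red edge are blue with the opposite literal value. -/
theorem blue_of_red (h : σ ∈ colorings T G) {e e' : Fin n × Fin d} {y : Bool}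
    (he : σ e = .r y) (hne : e' ≠ e) (hc : (G.1 e').1 = (G.1 e).1) :
    σ e' = .b (xor (xor (!y) (G.2 e)) (G.2 e')) := by
  rcases clauseOK_edge h e with ⟨e0, z, hc0, h0, hall⟩ | ⟨h1, -⟩
  · by_cases hee : e = e0
    · subst hee
      rw [he] at h0
      have : y = xor z (G.2 e) := by simpa using h0
      rw [hall e' hne hc, this]
      cases z <;> cases G.2 e <;> rfl
    · have := hall e hee rfl
      rw [he] at this
      cases this
  · exact absurd ⟨y, he⟩ (h1 e rfl)

theorem frozenValid_of_coloring (hk : 2 ≤ k) (h : σ ∈ colorings T G) :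
    FrozenValid G (frozen σ) := by
  refine ⟨fun v y hv => ?_, fun e y hall => ?_⟩
  · have hred : ∃ i, σ (v, i) = .r y := by
      unfold frozen at hv
      split_ifs at hv with h1 h2
      · cases hv; exact h1
      · cases hv; exact h2
    obtain ⟨i, hi⟩ := hred
    refine ⟨i, fun e hne hc => ?_⟩
    rw [colorings_value h e, blue_of_red h hi hne hc]
    rfl
  · rcases clauseOK_edge h e with ⟨e0, z, hc0, h0, hall0⟩ | ⟨h1, h2⟩
    · by_cases hee : e = e0
      · subst hee
        rw [colorings_value h e, h0]
        obtain ⟨e', hne, hc⟩ := exists_clause_edge_ne hk G e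
        have h3 := hall e' hne hc
        rw [colorings_value h e', hall0 e' hne hc] at h3
        simp only [Col.value, Option.some.injEq] at h3 ⊢
        revert h3
        cases z <;> cases y <;> cases G.2 e' <;> simp
      -- The red edge is another edge `e0`. Its literal value is the one prescribed for the edges
      -- other than `e`, and the blue edge `e` has the opposite one, as required.
      · have h3 := hall e0 (Ne.symm hee) hc0
        rw [colorings_value h e0, h0] at h3
        have h4 := hall0 e hee rfl
        rw [colorings_value h e, h4]
        simp only [Col.value, Option.some.injEq] at h3 ⊢
        revert h3
        cases z <;> cases y <;> cases G.2 e0 <;> simp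
    · exfalso
      -- All edges but `e` would be blue with one literal value, which a non-forcing clause forbids.
      refine h2 e (!y) rfl fun e' hne hc => ?_
      have h3 := hall e' hne hc
      rw [colorings_value h e', value_eq_some] at h3
      rcases h3 with h3 | h3
      · exact absurd ⟨_, h3⟩ (h1 e' hc)
      · exact h3

end coloring

theorem Col.dotTree_flip (s : Col) (l : Bool) : (s.flip l).dotTree = s.dotTree.flip l := by
  cases s <;> simp [Col.flip, Col.dotTree, Tree.flip_bit]

theorem dotTree_of_value {s : Col} {x : Bool} (h : s.value = some x) : s.dotTree = Tree.bit x := by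
  rcases value_eq_some.1 h with h | h <;> rw [h] <;> rfl

theorem value_of_dotTree_flip {d k : ℕ} {s : Col} (hs : s.IsColor d k) {l x : Bool}
    (h : (s.flip l).dotTree = Tree.bit x) : s.value = some (xor x l) := by
  cases s with
  | r y =>
    have := Tree.bit_injective h
    subst this
    simp [Col.value]
  | b y =>
    have := Tree.bit_injective h
    subst this
    simp [Col.value]
  | f dt ht => exact absurd h (Tree.flip_ne_bit hs.1 l x)

section coloring
variable {n m d k T : ℕ} {G : Instance n m d k} {σ σ' : Config n d}

theorem isColor_of_coloring (h : σ ∈ colorings T G) (e : Fin n × Fin d) : (σ e).IsColor d k :=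
  (mem_OmegaT.1 ((mem_colorings.1 h).1 e)).1

theorem dotTree_eq_var (h : σ ∈ colorings T G) {v : Fin n} {i : Fin d} (hf : (σ (v, i)).IsFree) :
    (σ (v, i)).dotTree =
      Tree.var ((Finset.univ.erase i).val.map fun j => (σ (v, j)).hatTree) := by
  rcases (mem_colorings.1 h).2.1 v with ⟨x, -, hall⟩ | ⟨-, h2⟩
  · obtain ⟨a, b, hab⟩ := hf
    rcases hall i with h1 | h1 <;> simp only [atVar] at h1 <;> rw [hab] at h1 <;> cases h1
  · exact h2 i

/-- The multiset of messages that the clause of `e` receives from its other edges. -/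
noncomputable def clauseInput (G : Instance n m d k) (σ : Config n d) (e : Fin n × Fin d) :
    Multiset Tree :=
  (Finset.univ.erase (G.1 e).2).val.map fun j => (atClauseLit G σ (G.1 e).1 j).dotTree

theorem mem_clauseInput {e : Fin n × Fin d} {t : Tree} : t ∈ clauseInput G σ e ↔
    ∃ e', e' ≠ e ∧ (G.1 e').1 = (G.1 e).1 ∧ ((σ e').flip (G.2 e')).dotTree = t := by
  unfold clauseInput
  rw [Multiset.mem_map]
  constructor
  · rintro ⟨j, hj, rfl⟩
    refine ⟨G.1.symm ((G.1 e).1, j), ?_, by simp, by simp [atClauseLit]⟩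
    rintro h
    have : j = (G.1 e).2 := by rw [← h]; simp
    rw [Finset.mem_val] at hj
    exact Finset.ne_of_mem_erase hj this
  · rintro ⟨e', hne, hc, rfl⟩
    refine ⟨(G.1 e').2, ?_, ?_⟩
    · rw [Finset.mem_val, Finset.mem_erase]
      refine ⟨fun h => hne (G.1.injective (Prod.ext hc h)), Finset.mem_univ _⟩
    · rw [← hc, atClauseLit_apply]

theorem no_red_of_free (h : σ ∈ colorings T G) {e e' : Fin n × Fin d} (hf : (σ e).IsFree)
    (hc : (G.1 e').1 = (G.1 e).1) : ¬ (σ e').IsRed := by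
  rintro ⟨y, hy⟩
  obtain ⟨a, b, hab⟩ := hf
  have hne : e ≠ e' := by rintro rfl; rw [hab] at hy; cases hy
  have := blue_of_red h hy hne hc.symm
  rw [hab] at this
  cases this

theorem hatTree_eq_hatT (h : σ ∈ colorings T G) {e : Fin n × Fin d} (hf : (σ e).IsFree) :
    (σ e).hatTree.flip (G.2 e) = hatT (clauseInput G σ e) := by
  rcases (mem_colorings.1 h).2.2 (G.1 e).1 with ⟨i, x, h1, h2⟩ | ⟨-, -, h3⟩
  · exfalso
    have hfr : (atClauseLit G σ (G.1 e).1 (G.1 e).2).IsFree := by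
      rw [atClauseLit_apply, isFree_flip]; exact hf
    obtain ⟨a, b, hab⟩ := hfr
    by_cases hi : (G.1 e).2 = i
    · rw [hi, h1] at hab; cases hab
    · rw [h2 _ hi] at hab; cases hab
  · have := h3 (G.1 e).2 (by rw [atClauseLit_apply, isFree_flip]; exact hf)
    rw [atClauseLit_apply] at this
    obtain ⟨a, b, hab⟩ := hf
    rw [hab] at this ⊢
    exact this

theorem isHat_hatTree (h : σ ∈ colorings T G) {e : Fin n × Fin d} (hf : (σ e).IsFree) :
    (σ e).hatTree.IsHat d k := by
  have := isColor_of_coloring h e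
  obtain ⟨a, b, hab⟩ := hf
  rw [hab] at this ⊢
  exact this.2

theorem isDot_dotTree (h : σ ∈ colorings T G) {e : Fin n × Fin d} (hf : (σ e).IsFree) :
    (σ e).dotTree.IsDot d k := by
  have := isColor_of_coloring h e
  obtain ⟨a, b, hab⟩ := hf
  rw [hab] at this ⊢
  exact this.1

/-- The join at a variable adds one to the total size of its inputs. This strict decrease makes the
inductions along chains of free edges terminate. -/
theorem size_hatTree_lt (h : σ ∈ colorings T G) {e e' : Fin n × Fin d} (hf : (σ e').IsFree)
    (hne : e ≠ e') (hv : e.1 = e'.1) : (σ e).hatTree.size < (σ e').dotTree.size := by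
  obtain ⟨v, i⟩ := e'
  obtain ⟨w, j⟩ := e
  simp only at hv
  subst hv
  rw [dotTree_eq_var h hf, Tree.size_var]
  have hji : j ≠ i := by rintro rfl; exact hne rfl
  have hmem : (σ (w, j)).hatTree ∈ (Finset.univ.erase i).val.map fun j => (σ (w, j)).hatTree :=
    Multiset.mem_map_of_mem (fun j => (σ (w, j)).hatTree)
      (by rw [Finset.mem_val]; exact Finset.mem_erase.2 ⟨hji, Finset.mem_univ _⟩)
  have := Tree.size_le_sum hmem
  omega

/-- The output of a non-separating clause contains all its inputs as subtrees. A separating clause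
sends the box, whose size says nothing about the inputs; hence `hsep`. -/
theorem size_dotTree_le (h : σ ∈ colorings T G) {e e' : Fin n × Fin d} (hf : (σ e).IsFree)
    (hf' : (σ e').IsFree) (hne : e' ≠ e) (hc : (G.1 e').1 = (G.1 e).1)
    (hsep : ¬ (Tree.bit false ∈ clauseInput G σ e ∧ Tree.bit true ∈ clauseInput G σ e)) :
    (σ e').dotTree.size ≤ (σ e).hatTree.size := by
  rw [← Tree.size_flip (Or.inr (isHat_hatTree h hf)) (G.2 e), hatTree_eq_hatT h hf, hatT,
    if_neg hsep, Tree.size_cls, ← Tree.size_flip (Or.inl (isDot_dotTree h hf')) (G.2 e'),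
    ← Col.dotTree_flip]
  exact Tree.size_le_sum (mem_clauseInput.2 ⟨e', hne, hc, rfl⟩)

theorem bit_mem_clauseInput (h : σ ∈ colorings T G) {e : Fin n × Fin d} {x : Bool} :
    Tree.bit x ∈ clauseInput G σ e ↔
      ∃ e', e' ≠ e ∧ (G.1 e').1 = (G.1 e).1 ∧ frozen σ e'.1 = some (xor x (G.2 e')) := by
  rw [mem_clauseInput]
  refine exists_congr fun e' => and_congr_right fun _ => and_congr_right fun _ => ?_
  rw [colorings_value h e']
  refine ⟨fun h1 => value_of_dotTree_flip (isColor_of_coloring h e') h1, fun h1 => ?_⟩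
  rw [Col.dotTree_flip, dotTree_of_value h1, Tree.flip_bit]
  cases x <;> cases G.2 e' <;> rfl

/-- This recovers red and blue from the frozen configuration. If the edge were blue although all
other edges oppose it, then either the clause would force a different edge, which a third edge
refutes, or it would break the condition on non-forcing clauses. -/
theorem red_iff (hk : 3 ≤ k) (h : σ ∈ colorings T G) {e : Fin n × Fin d} {x : Bool}
    (hx : frozen σ e.1 = some x) :
    σ e = .r x ↔ ∀ e', e' ≠ e → (G.1 e').1 = (G.1 e).1 →
      frozen σ e'.1 = some (xor (xor (!x) (G.2 e)) (G.2 e')) := by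
  refine ⟨fun h1 e' hne hc => ?_, fun h1 => ?_⟩
  · rw [colorings_value h e', blue_of_red h h1 hne hc]; rfl
  · rw [colorings_value h e, value_eq_some] at hx
    refine hx.resolve_right fun hb => ?_
    rcases clauseOK_edge h e with ⟨e0, z, hc0, h0, hall0⟩ | ⟨h2, h3⟩
    · have hee : e ≠ e0 := by rintro rfl; rw [hb] at h0; cases h0
      obtain ⟨e3, h31, h32, h33⟩ := exists_clause_edge_ne_ne hk G e e0
      have h4 := h1 e3 h31 h33
      rw [colorings_value h e3, hall0 e3 h32 h33] at h4
      have h5 := hall0 e hee rfl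
      rw [hb] at h5
      simp only [Col.value, Option.some.injEq, Col.b.injEq] at h4 h5
      revert h4
      rw [h5]
      cases z <;> cases G.2 e <;> cases G.2 e3 <;> simp
    · refine h3 e (xor (!x) (G.2 e)) rfl fun e' hne hc => ?_
      have h4 := h1 e' hne hc
      rw [colorings_value h e', value_eq_some] at h4
      exact h4.resolve_left fun h5 => h2 e' hc ⟨_, h5⟩

/-- A coloring is determined by its frozen configuration. -/
theorem coloring_ext (hk : 3 ≤ k) (h : σ ∈ colorings T G) (h' : σ' ∈ colorings T G)
    (hx : frozen σ = frozen σ') : σ = σ' := by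
  have hfree : ∀ e, (σ e).IsFree → (σ' e).IsFree := by
    intro e he
    rw [← value_eq_none, ← colorings_value h' e, ← hx, colorings_value h e, value_eq_none]
    exact he
  have hfroz : ∀ e x, (σ e).value = some x → σ e = σ' e := by
    intro e x he
    have he1 : frozen σ e.1 = some x := by rw [colorings_value h e, he]
    have he' : frozen σ' e.1 = some x := by rw [← hx, he1]
    have h1 := red_iff hk h he1
    have h2 := red_iff hk h' he'
    rw [← hx, ← h1] at h2
    rw [colorings_value h' e, value_eq_some] at he'
    rcases value_eq_some.1 he with h3 | h3
    · rw [h3, h2.2 h3]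
    · rcases he' with h4 | h4
      · rw [h2.1 h4] at h3; cases h3
      · rw [h3, h4]
  -- The free messages are recovered by induction on their size. A `dotTree` is built from strictly
  -- smaller `hatTree`s, while a `hatTree` is built from `dotTree`s that need not be smaller; so at
  -- each level the statement for `dotTree` comes first.
  have hstep : ∀ N, (∀ e, (σ e).IsFree → (σ e).dotTree.size < N →
      (σ' e).dotTree = (σ e).dotTree) ∧ (∀ e, (σ e).IsFree → (σ e).hatTree.size < N →
      (σ' e).hatTree = (σ e).hatTree) := by
    intro N
    induction N with
    | zero => exact ⟨fun _ _ h => absurd h (Nat.not_lt_zero _), fun _ _ h => absurd h (Nat.not_lt_zero _)⟩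
    | succ N ih =>
      have hdot : ∀ e, (σ e).IsFree → (σ e).dotTree.size < N + 1 →
          (σ' e).dotTree = (σ e).dotTree := by
        rintro ⟨v, i⟩ he hs
        rw [dotTree_eq_var h he, dotTree_eq_var h' (hfree _ he)]
        congr 1
        refine Multiset.map_congr rfl fun j hj => ?_
        have hji : j ≠ i := Finset.ne_of_mem_erase (by rwa [Finset.mem_val] at hj)
        refine ih.2 (v, j) ?_ ?_
        · rw [← value_eq_none, ← colorings_value h (v, j)]
          rw [← value_eq_none, ← colorings_value h (v, i)] at he
          exact he
        · have := size_hatTree_lt h (e := (v, j)) he (by simpa using hji) rfl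
          omega
      refine ⟨hdot, fun e he hs => ?_⟩
      have key : hatT (clauseInput G σ' e) = hatT (clauseInput G σ e) := by
        -- Whether the clause separates depends only on the frozen values, which the two colorings
        -- share.
        by_cases hsep : Tree.bit false ∈ clauseInput G σ e ∧ Tree.bit true ∈ clauseInput G σ e
        · have hsep' : Tree.bit false ∈ clauseInput G σ' e ∧
              Tree.bit true ∈ clauseInput G σ' e := by
            rw [bit_mem_clauseInput h', bit_mem_clauseInput h', ← hx]
            rwa [bit_mem_clauseInput h, bit_mem_clauseInput h] at hsep
          rw [hatT, hatT, if_pos hsep, if_pos hsep']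
        · congr 1
          refine Multiset.map_congr rfl fun j hj => ?_
          have hji : j ≠ (G.1 e).2 := Finset.ne_of_mem_erase (by rwa [Finset.mem_val] at hj)
          simp only [atClauseLit]
          set e' := G.1.symm ((G.1 e).1, j) with he'
          have hc : (G.1 e').1 = (G.1 e).1 := by simp [he']
          have hne : e' ≠ e := by
            intro hee; apply hji
            rw [← hee, he']; simp
          rw [Col.dotTree_flip, Col.dotTree_flip]
          congr 1
          cases hv : (σ e').value with
          | none =>
            have hf := value_eq_none.1 hv
            refine hdot e' hf (lt_of_le_of_lt (size_dotTree_le h he hf hne hc hsep) hs)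
          | some x => rw [hfroz e' x hv]
      rw [← Tree.flip_flip (Or.inr (isHat_hatTree h he)) (G.2 e),
        ← Tree.flip_flip (Or.inr (isHat_hatTree h' (hfree e he))) (G.2 e),
        hatTree_eq_hatT h he, hatTree_eq_hatT h' (hfree e he), key]
  funext e
  cases hv : (σ e).value with
  | some x => exact hfroz e x hv
  | none =>
    have hf := value_eq_none.1 hv
    have h1 := (hstep _).1 e hf (Nat.lt_succ_self _)
    have h2 := (hstep _).2 e hf (Nat.lt_succ_self _)
    obtain ⟨a', b', hab'⟩ := hfree e hf
    obtain ⟨a, b, hab⟩ := hf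
    rw [hab, hab'] at h1 h2
    simp only [Col.dotTree, Col.hatTree] at h1 h2
    rw [hab, hab', h1, h2]

/-! ### Reconstruction of nearby frozen configurations -/

/-- The edge `e` forces its variable to `y` in the frozen configuration `x`. -/
def Forcing (G : Instance n m d k) (x : Fin n → Option Bool) (e : Fin n × Fin d) (y : Bool) :
    Prop :=
  ∀ e' : Fin n × Fin d, e' ≠ e → (G.1 e').1 = (G.1 e).1 →
    x e'.1 = some (xor (xor (!y) (G.2 e)) (G.2 e'))

/-- The variables frozen in `x` whose value changes in `x'`. -/
noncomputable def changedFrozen (x x' : Fin n → Option Bool) : Finset (Fin n) :=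
  Finset.univ.filter fun v => x v ≠ none ∧ x' v ≠ x v

/-- The variables free in `x` that are forced in `x'` by a clause at which the value of a
variable frozen in `x` changes. -/
noncomputable def triggered (G : Instance n m d k) (x x' : Fin n → Option Bool) :
    Finset (Fin n) :=
  Finset.univ.filter fun v => x v = none ∧ ∃ i y, x' v = some y ∧ Forcing G x' (v, i) y ∧
    ∃ e', (G.1 e').1 = (G.1 (v, i)).1 ∧ e'.1 ∈ changedFrozen x x'

/-- A clause forces at most one of its variables: a third edge would need two opposite values. -/
theorem Forcing.not_forcing {x : Fin n → Option Bool} (hk : 3 ≤ k) {e e' : Fin n × Fin d}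
    {y y' : Bool} (h : Forcing G x e y) (hne : e' ≠ e) (hc : (G.1 e').1 = (G.1 e).1)
    (hy : x e'.1 = some y') : ¬ Forcing G x e' y' := by
  intro h'
  obtain ⟨e3, h1, h2, h3⟩ := exists_clause_edge_ne_ne hk G e e'
  have a1 := h e' hne hc
  have a2 := h e3 h1 h3
  have a3 := h' e3 h2 (h3.trans hc.symm)
  rw [hy, Option.some.injEq] at a1
  rw [a2, Option.some.injEq] at a3
  revert a3
  rw [a1]
  cases y <;> cases G.2 e <;> cases G.2 e' <;> cases G.2 e3 <;> simp

/-- Trace the forcing in `x'` backwards from `e`. If no frozen variable of `σ` changes at the clause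
of `e`, this clause is not separating in `σ`. Each of its other variables is then either frozen in
`σ`, with a value shared by `x'` and `x''`, or free in `σ` and forced in `x'` through a different
edge. On that edge the incoming message of `σ` is strictly smaller, so induction on the size of
`hatTree` applies, with the triggered variables as given data. -/
theorem agree_of_agree_triggered (hk : 3 ≤ k) (h : σ ∈ colorings T G)
    {x' x'' : Fin n → Option Bool} (hx' : FrozenValid G x') (hx'' : FrozenValid G x'')
    (hS : changedFrozen (frozen σ) x' = changedFrozen (frozen σ) x'')
    (ht : ∀ v ∈ triggered G (frozen σ) x', x'' v = x' v) :
    ∀ (N : ℕ) (e : Fin n × Fin d) (y : Bool), (σ e).hatTree.size < N → frozen σ e.1 = none →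
      x' e.1 = some y → Forcing G x' e y → x'' e.1 = some y := by
  intro N
  induction N with
  | zero => intro e y h; exact absurd h (Nat.not_lt_zero _)
  | succ N ih =>
    intro e y hs hfr hxe hF
    by_cases htr : e.1 ∈ triggered G (frozen σ) x'
    · rw [ht _ htr, hxe]
    have hnot : ∀ e', (G.1 e').1 = (G.1 e).1 → e'.1 ∉ changedFrozen (frozen σ) x' := by
      intro e' hc hmem
      apply htr
      simp only [triggered, Finset.mem_filter, Finset.mem_univ, true_and]
      exact ⟨hfr, e.2, y, hxe, hF, e', hc, hmem⟩
    have hsame : ∀ e', (G.1 e').1 = (G.1 e).1 → frozen σ e'.1 ≠ none →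
        x' e'.1 = frozen σ e'.1 ∧ x'' e'.1 = frozen σ e'.1 := by
      intro e' hc hfz
      have h1 := hnot e' hc
      have h2 := hnot e' hc
      rw [hS] at h2
      simp only [changedFrozen, Finset.mem_filter, Finset.mem_univ, true_and, not_and,
        not_not] at h1 h2
      exact ⟨h1 hfz, h2 hfz⟩
    have hfree : (σ e).IsFree := by
      rw [← value_eq_none, ← colorings_value h e]; exact hfr
    -- Forcing asks for one common literal value on the other edges, while a separating clause has
    -- unchanged frozen inputs of both values.
    have hsep : ¬ (Tree.bit false ∈ clauseInput G σ e ∧ Tree.bit true ∈ clauseInput G σ e) := by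
      rw [bit_mem_clauseInput h, bit_mem_clauseInput h]
      rintro ⟨⟨e1, h1, h2, h3⟩, e2, h4, h5, h6⟩
      have a1 := hF e1 h1 h2
      have a2 := hF e2 h4 h5
      rw [(hsame e1 h2 (by rw [h3]; simp)).1, h3, Option.some.injEq] at a1
      rw [(hsame e2 h5 (by rw [h6]; simp)).1, h6, Option.some.injEq] at a2
      revert a1 a2
      cases y <;> cases G.2 e <;> cases G.2 e1 <;> cases G.2 e2 <;> simp
    have hforce := hx''.forces e (xor y (G.2 e)) (fun e' hne hc => ?_)
    · rw [hforce]; cases y <;> cases G.2 e <;> rfl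
    have h1 := hF e' hne hc
    have hgoal : (xor (xor (!y) (G.2 e)) (G.2 e')) = xor (!(xor y (G.2 e))) (G.2 e') := by
      cases y <;> cases G.2 e <;> cases G.2 e' <;> rfl
    rw [← hgoal]
    by_cases hfz : frozen σ e'.1 = none
    · obtain ⟨i2, hi2⟩ := hx'.forced e'.1 _ h1
      -- The variable of `e'` is not forced through `e'` itself, because that clause already forces
      -- `e`.
      have hne2 : (e'.1, i2) ≠ e' := by
        intro h2
        refine hF.not_forcing hk hne hc h1 ?_
        rw [h2] at hi2
        exact hi2
      have hfree' : (σ e').IsFree := by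
        rw [← value_eq_none, ← colorings_value h e']; exact hfz
      refine ih (e'.1, i2) _ ?_ hfz h1 hi2
      have h3 := size_hatTree_lt h hfree' hne2 rfl
      have h4 := size_dotTree_le h hfree hfree' hne hc hsep
      omega
    · rw [(hsame e' hc hfz).2, ← (hsame e' hc hfz).1, h1]

/-- A valid frozen configuration is determined by its values on the frozen variables that change
and on the triggered variables. -/
theorem frozenValid_ext (hk : 3 ≤ k) (h : σ ∈ colorings T G)
    {x' x'' : Fin n → Option Bool} (hx' : FrozenValid G x') (hx'' : FrozenValid G x'')
    (hS : changedFrozen (frozen σ) x' = changedFrozen (frozen σ) x'')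
    (ht : triggered G (frozen σ) x' = triggered G (frozen σ) x'')
    (hval : ∀ v ∈ changedFrozen (frozen σ) x' ∪ triggered G (frozen σ) x', x' v = x'' v) :
    x' = x'' := by
  funext v
  cases hv : frozen σ v with
  | some z =>
    by_cases hmem : v ∈ changedFrozen (frozen σ) x'
    · exact hval v (Finset.mem_union_left _ hmem)
    · have hmem' := hmem
      rw [hS] at hmem'
      simp only [changedFrozen, Finset.mem_filter, Finset.mem_univ, true_and, not_and, not_not,
        hv] at hmem hmem'
      rw [hmem (by simp), hmem' (by simp)]
  | none =>
    have h1 : ∀ y, x' v = some y → x'' v = some y := by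
      intro y hy
      obtain ⟨i, hi⟩ := hx'.forced v y hy
      exact agree_of_agree_triggered hk h hx' hx'' hS
        (fun w hw => (hval w (Finset.mem_union_right _ hw)).symm) _ (v, i) y
        (Nat.lt_succ_self _) hv hy hi
    have h2 : ∀ y, x'' v = some y → x' v = some y := by
      intro y hy
      obtain ⟨i, hi⟩ := hx''.forced v y hy
      exact agree_of_agree_triggered hk h hx'' hx' hS.symm
        (fun w hw => hval w (Finset.mem_union_right _ (ht ▸ hw))) _ (v, i) y
        (Nat.lt_succ_self _) hv hy hi
    cases hy : x' v with
    | some y => exact (h1 y hy).symm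
    | none =>
      cases hy' : x'' v with
      | none => rfl
      | some y => rw [h2 y hy'] at hy; cases hy

end coloring

-- Encoding the frozen configurations near a given coloring.

section nearby
variable {n m d k T : ℕ} {G : Instance n m d k} {σ : Config n d}

/-- The red edges at a set of variables. -/
noncomputable def redEdges (σ : Config n d) (S : Finset (Fin n)) : Finset (Fin n × Fin d) :=
  Finset.univ.filter fun e => e.1 ∈ S ∧ (σ e).IsRed

/-- The free edges. -/
noncomputable def freeEdges (σ : Config n d) : Finset (Fin n × Fin d) :=
  Finset.univ.filter fun e => (σ e).IsFree

/-- The variables that are not free. -/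
noncomputable def frozenVars (σ : Config n d) : Finset (Fin n) :=
  Finset.univ.filter fun v => frozen σ v ≠ none

/-- The variables that are free in `x` but not in `x'`. -/
noncomputable def newlyFrozen (x x' : Fin n → Option Bool) : Finset (Fin n) :=
  Finset.univ.filter fun v => x v = none ∧ x' v ≠ none

/-- The edges of `t` are in distinct clauses, each of which has a blue edge at a variable of
`S`. -/
def Linked (G : Instance n m d k) (σ : Config n d) (S : Finset (Fin n))
    (t : Finset (Fin n × Fin d)) : Prop :=
  Set.InjOn (fun e => (G.1 e).1) (t : Set (Fin n × Fin d)) ∧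
    ∀ e ∈ t, ∃ e', (∃ y, σ e' = .b y) ∧ e'.1 ∈ S ∧ (G.1 e').1 = (G.1 e).1

/-- Sets of frozen variables and of free edges that describe nearby frozen configurations. -/
noncomputable def linkedPairs (G : Instance n m d k) (σ : Config n d) (j : ℕ) :
    Finset (Finset (Fin n) × Finset (Fin n × Fin d)) :=
  ((frozenVars σ).powersetCard j ×ˢ ((freeEdges σ).powerset.filter fun t => t.card ≤ j)).filter
    fun p => Linked G σ p.1 (redEdges σ p.1 ∪ p.2)

/-- The valid frozen configurations in which `j` frozen variables of `x` are changed and at most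
`j` free variables of `x` are frozen. -/
noncomputable def nearbyFrozen (G : Instance n m d k) (x : Fin n → Option Bool) (j : ℕ) :
    Finset (Fin n → Option Bool) :=
  Finset.univ.filter fun x' => FrozenValid G x' ∧ (changedFrozen x x').card = j ∧
    (newlyFrozen x x').card ≤ j

/-- The other edges of the clause of a red edge are blue. If none of their variables changed, they
would still force the red edge, and its variable would keep its value. -/
theorem exists_blue_changed_of_red (h : σ ∈ colorings T G)
    {x' : Fin n → Option Bool} (hx' : FrozenValid G x') {e : Fin n × Fin d}
    (hr : (σ e).IsRed) (hmem : e.1 ∈ changedFrozen (frozen σ) x') :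
    ∃ e', (∃ y, σ e' = .b y) ∧ e'.1 ∈ changedFrozen (frozen σ) x' ∧ (G.1 e').1 = (G.1 e).1 := by
  obtain ⟨y, hy⟩ := hr
  by_contra hno
  push Not at hno
  have hxe : frozen σ e.1 = some y := by rw [colorings_value h e, hy]; rfl
  have h1 := hx'.forces e (xor y (G.2 e)) (fun e' hne hc => ?_)
  · simp only [changedFrozen, Finset.mem_filter, Finset.mem_univ, true_and] at hmem
    apply hmem.2
    rw [h1, hxe]
    cases y <;> cases G.2 e <;> rfl
  · have hb := blue_of_red h hy hne hc
    have hn : e'.1 ∉ changedFrozen (frozen σ) x' := fun h2 => hno e' ⟨_, hb⟩ h2 hc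
    have hv : frozen σ e'.1 = some (xor (xor (!y) (G.2 e)) (G.2 e')) := by
      rw [colorings_value h e', hb]; rfl
    simp only [changedFrozen, Finset.mem_filter, Finset.mem_univ, true_and, not_and, not_not] at hn
    rw [hn (by rw [hv]; simp), hv]
    cases y <;> cases G.2 e <;> cases G.2 e' <;> rfl

/-- The code of `x'` consists of the changed frozen variables and of one forcing edge for each
triggered variable. These edges and the red edges at changed variables lie in distinct clauses, as a
clause forces at most one edge, and each of these clauses has a blue edge at a changed variable. By
`frozenValid_ext` the code and the values on the at most `2 j` recorded variables determine `x'`,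
which gives `3 ^ (2 * j) = 9 ^ j` preimages. -/
theorem card_nearbyFrozen_le (hk : 3 ≤ k) (hd : 0 < d) (h : σ ∈ colorings T G) (j : ℕ) :
    (nearbyFrozen G (frozen σ) j).card ≤ 9 ^ j * (linkedPairs G σ j).card := by
  set x := frozen σ with hx
  -- For variables that are not triggered the index is a dummy, available because `0 < d`.
  have hidx : ∀ (x' : Fin n → Option Bool) (v : Fin n), ∃ i : Fin d, v ∈ triggered G x x' →
      ∃ y, x' v = some y ∧ Forcing G x' (v, i) y ∧
        ∃ e', (G.1 e').1 = (G.1 (v, i)).1 ∧ e'.1 ∈ changedFrozen x x' := by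
    intro x' v
    by_cases hv : v ∈ triggered G x x'
    · have hv' := hv
      simp only [triggered, Finset.mem_filter, Finset.mem_univ, true_and] at hv'
      obtain ⟨-, i, hi⟩ := hv'
      exact ⟨i, fun _ => hi⟩
    · exact ⟨⟨0, hd⟩, fun h => absurd h hv⟩
  choose idx hidx using hidx
  let code : (Fin n → Option Bool) → Finset (Fin n) × Finset (Fin n × Fin d) := fun x' =>
    (changedFrozen x x', (triggered G x x').image fun v => (v, idx x' v))
  have himg : ∀ x', ((triggered G x x').image fun v => (v, idx x' v)).image Prod.fst =
      triggered G x x' := by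
    intro x'
    rw [Finset.image_image]
    exact Finset.image_id
  have hsub : ∀ x', triggered G x x' ⊆ newlyFrozen x x' := by
    intro x' v hv
    obtain ⟨y, hy, -⟩ := hidx x' v hv
    simp only [triggered, Finset.mem_filter, Finset.mem_univ, true_and] at hv
    simp only [newlyFrozen, Finset.mem_filter, Finset.mem_univ, true_and]
    exact ⟨hv.1, by rw [hy]; simp⟩
  refine Finset.card_le_mul_card_image_of_maps_to (f := code) ?_ _ ?_
  · intro x' hx'
    simp only [nearbyFrozen, Finset.mem_filter, Finset.mem_univ, true_and] at hx'
    obtain ⟨hval, hcard, hnew⟩ := hx'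
    have hfreeE : ∀ v ∈ triggered G x x', (σ (v, idx x' v)).IsFree := by
      intro v hv
      simp only [triggered, Finset.mem_filter, Finset.mem_univ, true_and] at hv
      rw [← value_eq_none, ← colorings_value h]
      exact hv.1
    simp only [linkedPairs, Finset.mem_filter, Finset.mem_product, Finset.mem_powersetCard,
      Finset.mem_powerset, code]
    refine ⟨⟨⟨?_, hcard⟩, ?_, ?_⟩, ?_, ?_⟩
    · intro v hv
      simp only [changedFrozen, Finset.mem_filter, Finset.mem_univ, true_and] at hv
      simp only [frozenVars, Finset.mem_filter, Finset.mem_univ, true_and]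
      exact hv.1
    · intro e he
      obtain ⟨v, hv, rfl⟩ := Finset.mem_image.1 he
      simp only [freeEdges, Finset.mem_filter, Finset.mem_univ, true_and]
      exact hfreeE v hv
    · exact Finset.card_image_le.trans ((Finset.card_le_card (hsub x')).trans hnew)
    · intro e he e' he' hc
      simp only at hc
      rw [Finset.mem_coe, Finset.mem_union] at he he'
      by_contra hne
      rcases he with he | he
      · simp only [redEdges, Finset.mem_filter, Finset.mem_univ, true_and] at he
        obtain ⟨y, hy⟩ := he.2
        have hb := blue_of_red h hy (Ne.symm hne) hc.symm
        rcases he' with he' | he'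
        · simp only [redEdges, Finset.mem_filter, Finset.mem_univ, true_and] at he'
          obtain ⟨z, hz⟩ := he'.2
          rw [hb] at hz; cases hz
        · obtain ⟨v, hv, rfl⟩ := Finset.mem_image.1 he'
          obtain ⟨a, b, hab⟩ := hfreeE v hv
          rw [hb] at hab; cases hab
      · obtain ⟨v, hv, rfl⟩ := Finset.mem_image.1 he
        rcases he' with he' | he'
        · simp only [redEdges, Finset.mem_filter, Finset.mem_univ, true_and] at he'
          exact no_red_of_free h (hfreeE v hv) hc.symm he'.2
        · obtain ⟨w, hw, rfl⟩ := Finset.mem_image.1 he'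
          obtain ⟨y, hy, hF, -⟩ := hidx x' v hv
          obtain ⟨z, hz, hF', -⟩ := hidx x' w hw
          exact hF.not_forcing hk (Ne.symm hne) hc.symm hz hF'
    · intro e he
      rw [Finset.mem_union] at he
      rcases he with he | he
      · simp only [redEdges, Finset.mem_filter, Finset.mem_univ, true_and] at he
        exact exists_blue_changed_of_red h hval he.2 he.1
      · obtain ⟨v, hv, rfl⟩ := Finset.mem_image.1 he
        obtain ⟨y, hy, hF, e', hc, hmem⟩ := hidx x' v hv
        refine ⟨e', ?_, hmem, hc⟩
        have hnr := no_red_of_free h (hfreeE v hv) hc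
        simp only [changedFrozen, Finset.mem_filter, Finset.mem_univ, true_and] at hmem
        have hz := hmem.1
        rw [hx, colorings_value h e'] at hz
        obtain ⟨z, hz⟩ := Option.ne_none_iff_exists'.1 hz
        exact ⟨z, (value_eq_some.1 hz).resolve_left fun hr => hnr ⟨z, hr⟩⟩
  · intro b hb
    set W := b.1 ∪ b.2.image Prod.fst with hW
    have hWcard : W.card ≤ 2 * j := by
      simp only [linkedPairs, Finset.mem_filter, Finset.mem_product, Finset.mem_powersetCard] at hb
      have h1 : W.card ≤ b.1.card + (b.2.image Prod.fst).card := Finset.card_union_le _ _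
      have h2 : (b.2.image Prod.fst).card ≤ b.2.card := Finset.card_image_le
      have h3 := hb.1.2.2
      have h4 := hb.1.1.2
      omega
    have hcardW : (Finset.univ : Finset (W → Option Bool)).card ≤ 9 ^ j := by
      rw [Finset.card_univ, Fintype.card_fun]
      have h3 : Fintype.card (Option Bool) = 3 := rfl
      rw [h3, Fintype.card_coe]
      calc 3 ^ W.card ≤ 3 ^ (2 * j) := Nat.pow_le_pow_right (by norm_num) hWcard
        _ = 9 ^ j := by rw [pow_mul]; norm_num
    refine le_trans (Finset.card_le_card_of_injOn (fun x' (w : W) => x' w)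
      (fun _ _ => Finset.mem_univ _) ?_) hcardW
    intro x' hx' x'' hx'' heq
    simp only [Finset.coe_filter, Set.mem_ofPred_eq, nearbyFrozen, Finset.mem_filter,
      Finset.mem_univ, true_and] at hx' hx''
    obtain ⟨⟨hval, -, -⟩, hc⟩ := hx'
    obtain ⟨⟨hval', -, -⟩, hc'⟩ := hx''
    have e1 : changedFrozen x x' = b.1 := congrArg Prod.fst hc
    have e1' : changedFrozen x x'' = b.1 := congrArg Prod.fst hc'
    have e2 : triggered G x x' = b.2.image Prod.fst := by
      rw [← himg x']; exact congrArg (Finset.image Prod.fst) (congrArg Prod.snd hc)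
    have e2' : triggered G x x'' = b.2.image Prod.fst := by
      rw [← himg x'']; exact congrArg (Finset.image Prod.fst) (congrArg Prod.snd hc')
    refine frozenValid_ext hk h hval hval' (e1.trans e1'.symm) (e2.trans e2'.symm) ?_
    intro v hv
    rw [← hx, e1, e2] at hv
    exact congrFun heq ⟨v, hv⟩

/-- Discard the variables that are free in both configurations: those free in `x'` alone are changed
frozen variables of `x`. This is how the order on colorings by number of free variables enters. -/
theorem card_newlyFrozen_le {x x' : Fin n → Option Bool}
    (h : (Finset.univ.filter fun v => x v = none).card ≤
      (Finset.univ.filter fun v => x' v = none).card) :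
    (newlyFrozen x x').card ≤ (changedFrozen x x').card := by
  have h1 : (Finset.univ.filter fun v => x v = none) =
      newlyFrozen x x' ∪ Finset.univ.filter fun v => x v = none ∧ x' v = none := by
    ext v; simp only [newlyFrozen, Finset.mem_filter, Finset.mem_univ, true_and, Finset.mem_union]
    tauto
  have h2 : (Finset.univ.filter fun v => x' v = none) ⊆
      changedFrozen x x' ∪ Finset.univ.filter fun v => x v = none ∧ x' v = none := by
    intro v
    simp only [changedFrozen, Finset.mem_filter, Finset.mem_univ, true_and, Finset.mem_union]
    intro hv
    by_cases hx : x v = none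
    · exact Or.inr ⟨hx, hv⟩
    · exact Or.inl ⟨hx, by rw [hv]; exact Ne.symm hx⟩
  have h3 : Disjoint (newlyFrozen x x') (Finset.univ.filter fun v => x v = none ∧ x' v = none) := by
    rw [Finset.disjoint_left]
    intro v
    simp only [newlyFrozen, Finset.mem_filter, Finset.mem_univ, true_and]
    tauto
  have h4 := Finset.card_le_card h2
  have h5 := Finset.card_union_le (changedFrozen x x')
    (Finset.univ.filter fun v => x v = none ∧ x' v = none)
  rw [h1, Finset.card_union_of_disjoint h3] at h
  omega

/-- Negation of a frozen configuration. -/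
def negFrozen (x : Fin n → Option Bool) : Fin n → Option Bool := fun v => (x v).map not

theorem negFrozen_negFrozen (x : Fin n → Option Bool) : negFrozen (negFrozen x) = x := by
  funext v
  simp only [negFrozen, Option.map_map]
  cases x v <;> simp

theorem negFrozen_eq_some {x : Fin n → Option Bool} {v : Fin n} {y : Bool} :
    negFrozen x v = some y ↔ x v = some (!y) := by
  unfold negFrozen
  cases h : x v with
  | none => simp
  | some z => cases z <;> cases y <;> simp

/-- Not-all-equal constraints do not see a global negation. Configurations close to the negation of
`x` can thus be counted as configurations close to `x`. -/
theorem FrozenValid.negFrozen {x : Fin n → Option Bool} (h : FrozenValid G x) :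
    FrozenValid G (negFrozen x) := by
  refine ⟨fun v y hy => ?_, fun e y hall => ?_⟩
  · obtain ⟨i, hi⟩ := h.forced v _ (negFrozen_eq_some.1 hy)
    refine ⟨i, fun e hne hc => negFrozen_eq_some.2 ?_⟩
    rw [hi e hne hc]
    cases y <;> cases G.2 (v, i) <;> cases G.2 e <;> rfl
  · refine negFrozen_eq_some.2 ?_
    rw [h.forces e (!y)]
    · cases y <;> cases G.2 e <;> rfl
    · intro e' hne hc
      rw [negFrozen_eq_some.1 (hall e' hne hc)]
      cases y <;> cases G.2 e' <;> rfl

end nearby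

-- The mode of the binomial distribution.

theorem choose_term_step {N D i : ℕ} (hi : i < N) :
    (N - i) * D * (N.choose i * D ^ i * (N - D) ^ (N - i)) =
      (i + 1) * (N - D) * (N.choose (i + 1) * D ^ (i + 1) * (N - D) ^ (N - (i + 1))) := by
  have h1 := Nat.choose_succ_right_eq N i
  have h2 : N - i = N - (i + 1) + 1 := by omega
  rw [h2] at h1 ⊢
  rw [pow_succ D i, pow_succ (N - D)]
  calc _ = (N.choose i * (N - (i + 1) + 1)) * D * D ^ i * (N - D) ^ (N - (i + 1)) * (N - D) := by
        ring
    _ = _ := by rw [← h1]; ring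

/-- By `choose_term_step`, consecutive terms in the expansion of `(D + (N - D)) ^ N` increase as
long as `i < D` and do not increase from `i = D` on. -/
theorem choose_term_le {N D : ℕ} (hD : D ≤ N) {i : ℕ} (hi : i ≤ N) :
    N.choose i * D ^ i * (N - D) ^ (N - i) ≤ N.choose D * D ^ D * (N - D) ^ (N - D) := by
  rcases Nat.eq_zero_or_pos D with rfl | hpos
  · rcases Nat.eq_zero_or_pos i with rfl | hi0
    · exact le_rfl
    · rw [zero_pow hi0.ne']; simp
  rcases hD.eq_or_lt with rfl | hlt
  · rcases hi.eq_or_lt with rfl | hi'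
    · exact le_rfl
    · have : 0 < D - i := by omega
      rw [Nat.sub_self, zero_pow this.ne']; simp
  have hup : ∀ i, i < D → N.choose i * D ^ i * (N - D) ^ (N - i) ≤
      N.choose (i + 1) * D ^ (i + 1) * (N - D) ^ (N - (i + 1)) := by
    intro i hiD
    have h1 := choose_term_step (D := D) (show i < N by omega)
    have h2 : (i + 1) * (N - D) ≤ (N - i) * D := by
      obtain ⟨a, rfl⟩ := Nat.exists_eq_add_of_lt hiD
      obtain ⟨b, rfl⟩ := Nat.exists_eq_add_of_lt hlt
      have e1 : i + a + 1 + b + 1 - (i + a + 1) = b + 1 := by omega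
      have e2 : i + a + 1 + b + 1 - i = a + 1 + b + 1 := by omega
      rw [e1, e2]
      nlinarith [Nat.zero_le (a * b), Nat.zero_le (a * a), Nat.zero_le (i*a)]
    have h3 : 0 < (N - i) * D := Nat.mul_pos (by omega) hpos
    refine Nat.le_of_mul_le_mul_left ?_ h3
    rw [h1]
    exact Nat.mul_le_mul_right _ h2
  have hdown : ∀ i, D ≤ i → i < N → N.choose (i + 1) * D ^ (i + 1) * (N - D) ^ (N - (i + 1)) ≤
      N.choose i * D ^ i * (N - D) ^ (N - i) := by
    intro i hDi hiN
    have h1 := choose_term_step (D := D) hiN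
    have h2 : (N - i) * D ≤ (i + 1) * (N - D) := by
      obtain ⟨a, rfl⟩ := Nat.exists_eq_add_of_le hDi
      obtain ⟨b, rfl⟩ := Nat.exists_eq_add_of_lt hiN
      have e1 : D + a + b + 1 - (D + a) = b + 1 := by omega
      have e2 : D + a + b + 1 - D = a + b + 1 := by omega
      rw [e1, e2]
      nlinarith [Nat.zero_le (a * b), Nat.zero_le (a * a), Nat.zero_le (D*a)]
    have h3 : 0 < (i + 1) * (N - D) := Nat.mul_pos (by omega) (by omega)
    refine Nat.le_of_mul_le_mul_left ?_ h3
    rw [← h1]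
    exact Nat.mul_le_mul_right _ h2
  rcases le_total i D with hiD | hiD
  · obtain ⟨a, rfl⟩ := Nat.exists_eq_add_of_le hiD
    have : ∀ b, b ≤ a → N.choose i * (i + a) ^ i * (N - (i + a)) ^ (N - i) ≤
        N.choose (i + b) * (i + a) ^ (i + b) * (N - (i + a)) ^ (N - (i + b)) := by
      intro b
      induction b with
      | zero => intro _; exact le_rfl
      | succ b ih => intro hb; exact (ih (by omega)).trans (hup (i + b) (by omega))
    exact this a le_rfl
  · induction i, hiD using Nat.le_induction with
    | base => exact le_rfl
    | succ i hDi ih => exact (hdown i hDi (by omega)).trans (ih (by omega))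

/-- The mode of the binomial distribution has probability at least `1 / (N + 1)`. -/
theorem one_le_binomial_mode {N D : ℕ} (hD : D ≤ N) :
    (1 : ℝ) ≤ (N + 1) * (N.choose D * ((D / N : ℝ) ^ D * (1 - D / N : ℝ) ^ (N - D))) := by
  rcases Nat.eq_zero_or_pos N with rfl | hN
  · have : D = 0 := by omega
    subst this
    simp
  -- Expand `N ^ N = (D + (N - D)) ^ N` into `N + 1` terms, each at most the one with index `D`.
  have h1 : N ^ N ≤ (N + 1) * (N.choose D * D ^ D * (N - D) ^ (N - D)) := by
    have h2 := add_pow D (N - D) N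
    rw [Nat.add_sub_cancel' hD] at h2
    conv_lhs => rw [h2]
    calc ∑ i ∈ Finset.range (N + 1), D ^ i * (N - D) ^ (N - i) * N.choose i
        ≤ ∑ i ∈ Finset.range (N + 1), N.choose D * D ^ D * (N - D) ^ (N - D) := by
          refine Finset.sum_le_sum fun i hi => ?_
          have := choose_term_le hD (Nat.lt_succ_iff.1 (Finset.mem_range.1 hi))
          calc _ = N.choose i * D ^ i * (N - D) ^ (N - i) := by ring
            _ ≤ _ := this
      _ = _ := by simp
  have hNr : (0 : ℝ) < N := by exact_mod_cast hN
  have h3 : (1 - D / N : ℝ) = ((N - D : ℕ) : ℝ) / N := by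
    rw [Nat.cast_sub hD]; field_simp
  rw [h3, div_pow, div_pow]
  have h4 : ((N : ℝ) ^ D) * N ^ (N - D) = N ^ N := by rw [← pow_add, Nat.add_sub_cancel' hD]
  have h5 : (((D : ℝ) ^ D / (N : ℝ) ^ D) * ((((N - D : ℕ) : ℝ) ^ (N - D)) / (N : ℝ) ^ (N - D))) =
      (D : ℝ) ^ D * ((N - D : ℕ) : ℝ) ^ (N - D) / (N : ℝ) ^ N := by
    rw [div_mul_div_comm, h4]
  rw [h5, ← mul_div_assoc, ← mul_div_assoc, le_div_iff₀ (by positivity), one_mul]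
  calc (N : ℝ) ^ N = ((N ^ N : ℕ) : ℝ) := by push_cast; rfl
    _ ≤ (((N + 1) * (N.choose D * D ^ D * (N - D) ^ (N - D)) : ℕ) : ℝ) := by exact_mod_cast h1
    _ = _ := by push_cast; ring

/-! ### Permutations that preserve a coloring -/

section perm
variable {E : Type} [Fintype E] [DecidableEq E]

/-- The permutations that preserve the two classes `κ = inl x` and fix all other points. -/
noncomputable def colorPerms (κ : E → Bool ⊕ E) : Finset (Equiv.Perm E) :=
  Finset.univ.filter fun ρ => ∀ e, κ (ρ e) = κ e

/-- The class `κ = inl x`. -/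
noncomputable def colorClass (κ : E → Bool ⊕ E) (x : Bool) : Finset E :=
  Finset.univ.filter fun e => κ e = .inl x

/-- The subsets with prescribed numbers of points in the two classes. -/
noncomputable def typeClass (κ : E → Bool ⊕ E) (D : Finset E) : Finset (Finset E) :=
  Finset.univ.filter fun U => U ⊆ colorClass κ false ∪ colorClass κ true ∧
    ∀ x, (colorClass κ x ∩ U).card = (colorClass κ x ∩ D).card

variable {κ : E → Bool ⊕ E} {D : Finset E}

theorem mem_colorPerms {ρ : Equiv.Perm E} : ρ ∈ colorPerms κ ↔ ∀ e, κ (ρ e) = κ e := by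
  simp [colorPerms]

theorem colorPerms_nonempty : (colorPerms κ).Nonempty := ⟨1, mem_colorPerms.2 fun _ => rfl⟩

theorem image_mem_typeClass (hD : D ⊆ colorClass κ false ∪ colorClass κ true)
    {ρ : Equiv.Perm E} (hρ : ρ ∈ colorPerms κ) : D.image ρ ∈ typeClass κ D := by
  rw [mem_colorPerms] at hρ
  simp only [typeClass, Finset.mem_filter, Finset.mem_univ, true_and]
  refine ⟨fun e he => ?_, fun x => ?_⟩
  · obtain ⟨e', he', rfl⟩ := Finset.mem_image.1 he
    have := hD he'
    simp only [colorClass, Finset.mem_union, Finset.mem_filter, Finset.mem_univ, true_and] at this ⊢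
    rwa [hρ]
  · have : colorClass κ x ∩ D.image ρ = (colorClass κ x ∩ D).image ρ := by
      ext e
      simp only [colorClass, Finset.mem_inter, Finset.mem_filter, Finset.mem_univ, true_and,
        Finset.mem_image]
      constructor
      · rintro ⟨h1, e', he', rfl⟩
        exact ⟨e', ⟨by rwa [hρ] at h1, he'⟩, rfl⟩
      · rintro ⟨e', ⟨h1, he'⟩, rfl⟩
        exact ⟨by rwa [hρ], e', he', rfl⟩
    rw [this, Finset.card_image_of_injective _ ρ.injective]

/-- The maps `e ↦ (κ e, e ∈ D)` and `e ↦ (κ e, e ∈ U)` have fibres of equal cardinality, so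
bijections between corresponding fibres glue to a permutation. -/
theorem exists_colorPerm (hD : D ⊆ colorClass κ false ∪ colorClass κ true)
    {U : Finset E} (hU : U ∈ typeClass κ D) :
    ∃ ρ ∈ colorPerms κ, D.image ρ = U := by
  simp only [typeClass, Finset.mem_filter, Finset.mem_univ, true_and] at hU
  have hsingle : ∀ V : Finset E, V ⊆ colorClass κ false ∪ colorClass κ true →
      ∀ e e', κ e = .inr e' → e ∉ V := by
    intro V hV e e' he hmem
    have := hV hmem
    simp [colorClass, he] at this
  have key : ∀ V : Finset E, V ⊆ colorClass κ false ∪ colorClass κ true → ∀ c : (Bool ⊕ E) × Prop,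
      Fintype.card {e // (κ e, e ∈ V) = c} = match c with
        | (.inl x, p) => if p then (colorClass κ x ∩ V).card
            else (colorClass κ x).card - (colorClass κ x ∩ V).card
        | (.inr e', p) => if p then 0 else (Finset.univ.filter fun e => κ e = .inr e').card := by
    rintro V hV ⟨x | e', p⟩
    · by_cases hp : p
      · simp only [hp, if_true]
        rw [Fintype.card_subtype]
        congr 1
        ext e
        simp [colorClass]
      · simp only [hp, if_false]
        rw [Fintype.card_subtype, ← Finset.card_sdiff_of_subset Finset.inter_subset_left]
        congr 1
        ext e
        simp [colorClass]
    · by_cases hp : p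
      · simp only [hp, if_true]
        rw [Fintype.card_subtype, Finset.card_eq_zero, Finset.filter_eq_empty_iff]
        rintro e - he
        simp only [Prod.mk.injEq, eq_iff_iff, iff_true] at he
        exact hsingle V hV e e' he.1 he.2
      · simp only [hp, if_false]
        rw [Fintype.card_subtype]
        congr 1
        ext e
        simp only [Prod.mk.injEq, eq_iff_iff, iff_false, Finset.mem_filter, Finset.mem_univ,
          true_and, and_iff_left_iff_imp]
        exact hsingle V hV e e'
  have hcard : ∀ c : (Bool ⊕ E) × Prop,
      Fintype.card {e // (κ e, e ∈ D) = c} = Fintype.card {e // (κ e, e ∈ U) = c} := by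
    intro c
    rw [key D hD c, key U hU.1 c]
    rcases c with ⟨x | e', p⟩
    · simp only [hU.2 x]
    · rfl
  let ρ : Equiv.Perm E := Equiv.ofFiberEquiv (f := fun e => (κ e, e ∈ D))
    (g := fun e => (κ e, e ∈ U)) fun c => Fintype.equivOfCardEq (hcard c)
  have hρ : ∀ e, (κ (ρ e), ρ e ∈ U) = (κ e, e ∈ D) := fun e =>
    Equiv.ofFiberEquiv_map (f := fun e => (κ e, e ∈ D)) (g := fun e => (κ e, e ∈ U)) _ e
  refine ⟨ρ, mem_colorPerms.2 fun e => congrArg Prod.fst (hρ e), ?_⟩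
  ext e
  rw [Finset.mem_image]
  constructor
  · rintro ⟨e', he', rfl⟩
    have := congrArg Prod.snd (hρ e')
    simp only [eq_iff_iff] at this
    exact this.2 he'
  · intro he
    refine ⟨ρ.symm e, ?_, by simp⟩
    have := congrArg Prod.snd (hρ (ρ.symm e))
    simp only [eq_iff_iff, Equiv.apply_symm_apply] at this
    exact this.1 he

/-- Composition with a permutation that carries `D` to `U` matches the two fibres. In other words,
the image of `D` under a random element of `colorPerms κ` is uniform on `typeClass κ D`. -/
theorem card_fiber_eq (hD : D ⊆ colorClass κ false ∪ colorClass κ true)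
    {U : Finset E} (hU : U ∈ typeClass κ D) :
    ((colorPerms κ).filter fun ρ : Equiv.Perm E => D.image ρ = U).card =
      ((colorPerms κ).filter fun ρ : Equiv.Perm E => D.image ρ = D).card := by
  obtain ⟨ρ₁, h₁, hU₁⟩ := exists_colorPerm hD hU
  rw [mem_colorPerms] at h₁
  symm
  refine Finset.card_bij (fun ρ _ => ρ₁ * ρ) ?_ ?_ ?_
  · intro ρ hρ
    rw [Finset.mem_filter, mem_colorPerms] at hρ ⊢
    refine ⟨fun e => by rw [Equiv.Perm.mul_apply, h₁, hρ.1], ?_⟩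
    rw [Equiv.Perm.coe_mul, ← Finset.image_image, hρ.2, hU₁]
  · intro a _ b _ hab
    exact mul_left_cancel hab
  · intro ρ hρ
    rw [Finset.mem_filter, mem_colorPerms] at hρ
    refine ⟨ρ₁⁻¹ * ρ, ?_, by simp⟩
    rw [Finset.mem_filter, mem_colorPerms]
    have hinv : ∀ e, κ (ρ₁⁻¹ e) = κ e := by
      intro e
      have := h₁ (ρ₁⁻¹ e)
      rw [← Equiv.Perm.mul_apply, mul_inv_cancel] at this
      exact this.symm
    refine ⟨fun e => by rw [Equiv.Perm.mul_apply, hinv, hρ.1], ?_⟩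
    rw [Equiv.Perm.coe_mul, ← Finset.image_image, hρ.2, ← hU₁, Finset.image_image,
      ← Equiv.Perm.coe_mul, inv_mul_cancel]
    simp

theorem card_typeClass_mul_sum (hD : D ⊆ colorClass κ false ∪ colorClass κ true)
    (F : Finset E → ℝ) :
    ((typeClass κ D).card : ℝ) * ∑ ρ ∈ colorPerms κ, F (D.image ρ) =
      (colorPerms κ).card * ∑ U ∈ typeClass κ D, F U := by
  set N := ((colorPerms κ).filter fun ρ : Equiv.Perm E => D.image ρ = D).card with hN
  have h1 : ∀ F : Finset E → ℝ, ∑ ρ ∈ colorPerms κ, F (D.image ρ) =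
      N * ∑ U ∈ typeClass κ D, F U := by
    intro F
    rw [← Finset.sum_fiberwise_of_maps_to (s := colorPerms κ) (t := typeClass κ D)
      (g := fun ρ => D.image ρ) (fun ρ hρ => image_mem_typeClass hD hρ), Finset.mul_sum]
    refine Finset.sum_congr rfl fun U hU => ?_
    rw [Finset.sum_congr rfl (g := fun _ => F U)
      (fun ρ hρ => by rw [(Finset.mem_filter.1 hρ).2]), Finset.sum_const, nsmul_eq_mul,
      card_fiber_eq hD hU]
  have h2 := h1 fun _ => 1
  simp only [Finset.sum_const, nsmul_eq_mul, mul_one] at h2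
  rw [h1 F, h2]
  ring

/-- The density of a set in the two classes; zero off the classes. -/
noncomputable def density (κ : E → Bool ⊕ E) (D : Finset E) (e : E) : ℝ :=
  match κ e with
  | .inl x => (colorClass κ x ∩ D).card / (colorClass κ x).card
  | .inr _ => 0

theorem density_mem (e : E) : density κ D e ∈ Set.Icc (0 : ℝ) 1 := by
  unfold density
  split
  · refine ⟨by positivity, div_le_one_of_le₀ ?_ (by positivity)⟩
    exact_mod_cast Finset.card_le_card Finset.inter_subset_left
  · simp

theorem density_of_mem {x : Bool} {e : E} (he : e ∈ colorClass κ x) :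
    density κ D e = (colorClass κ x ∩ D).card / (colorClass κ x).card := by
  have : κ e = .inl x := by simpa [colorClass] using he
  simp only [density, this]

/-- The weight of a set under independent sampling of points. -/
noncomputable def bernoulliWeight (p : E → ℝ) (U : Finset E) : ℝ :=
  ∏ e, if e ∈ U then p e else 1 - p e

theorem bernoulliWeight_nonneg {p : E → ℝ} (hp : ∀ e, p e ∈ Set.Icc (0 : ℝ) 1) (U : Finset E) :
    0 ≤ bernoulliWeight p U :=
  Finset.prod_nonneg fun e _ => by split_ifs; exacts [(hp e).1, sub_nonneg.2 (hp e).2]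

/-- The weight depends on `U` only through its counts in the two classes, so it is constant on
`typeClass κ D`. Points off the classes have density zero and contribute a factor one. -/
theorem bernoulliWeight_of_mem {U : Finset E} (hU : U ∈ typeClass κ D) :
    bernoulliWeight (density κ D) U = ∏ x : Bool,
      (((colorClass κ x ∩ D).card / (colorClass κ x).card : ℝ) ^ (colorClass κ x ∩ D).card *
      (1 - (colorClass κ x ∩ D).card / (colorClass κ x).card : ℝ) ^
        ((colorClass κ x).card - (colorClass κ x ∩ D).card)) := by
  simp only [typeClass, Finset.mem_filter, Finset.mem_univ, true_and] at hU
  have hcls : ∀ x, ∏ e ∈ colorClass κ x, (if e ∈ U then density κ D e else 1 - density κ D e) =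
      ((colorClass κ x ∩ D).card / (colorClass κ x).card : ℝ) ^ (colorClass κ x ∩ D).card *
      (1 - (colorClass κ x ∩ D).card / (colorClass κ x).card : ℝ) ^
        ((colorClass κ x).card - (colorClass κ x ∩ D).card) := by
    intro x
    rw [Finset.prod_ite]
    have e1 : ((colorClass κ x).filter fun e => e ∈ U) = colorClass κ x ∩ U := by
      ext; simp
    have e2 : ((colorClass κ x).filter fun e => e ∉ U) = colorClass κ x \ (colorClass κ x ∩ U) := by
      ext; simp
    rw [e1, e2]
    rw [Finset.prod_congr rfl (g := fun _ => ((colorClass κ x ∩ D).card /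
        (colorClass κ x).card : ℝ)) (fun e he => density_of_mem (Finset.mem_inter.1 he).1),
      Finset.prod_congr (s₁ := colorClass κ x \ (colorClass κ x ∩ U)) rfl
        (g := fun _ => (1 - (colorClass κ x ∩ D).card / (colorClass κ x).card : ℝ))
        (fun e he => by rw [density_of_mem (Finset.mem_sdiff.1 he).1]),
      Finset.prod_const, Finset.prod_const,
      Finset.card_sdiff_of_subset Finset.inter_subset_left, hU.2 x]
  have hdisj : Disjoint (colorClass κ true) (colorClass κ false) := by
    rw [Finset.disjoint_left]
    intro e h1 h2
    simp only [colorClass, Finset.mem_filter, Finset.mem_univ, true_and] at h1 h2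
    rw [h1] at h2
    cases h2
  rw [Fintype.prod_bool, ← hcls, ← hcls, ← Finset.prod_union hdisj]
  unfold bernoulliWeight
  symm
  refine Finset.prod_subset (Finset.subset_univ _) fun e _ he => ?_
  rw [Finset.union_comm] at he
  rw [if_neg fun h => he (hU.1 h)]
  have : density κ D e = 0 := by
    unfold density
    split
    · rename_i x hx
      exfalso; apply he
      cases x <;> simp [colorClass, hx]
    · rfl
  rw [this, sub_zero]

/-- The counts of `D` in the classes are modes of two independent binomial variables, so independent
sampling lands in `typeClass κ D` with at least inverse polynomial probability. -/
theorem one_le_card_typeClass_mul :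
    (1 : ℝ) ≤ (∏ x : Bool, ((colorClass κ x).card + 1 : ℝ)) *
      ((typeClass κ D).card * ∏ x : Bool,
      (((colorClass κ x ∩ D).card / (colorClass κ x).card : ℝ) ^ (colorClass κ x ∩ D).card *
      (1 - (colorClass κ x ∩ D).card / (colorClass κ x).card : ℝ) ^
        ((colorClass κ x).card - (colorClass κ x ∩ D).card))) := by
  have hdis : ∀ e, e ∈ colorClass κ false → e ∈ colorClass κ true → False := by
    intro e h1 h2
    simp only [colorClass, Finset.mem_filter, Finset.mem_univ, true_and] at h1 h2
    rw [h1] at h2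
    cases h2
  have hcard : (colorClass κ true).card.choose (colorClass κ true ∩ D).card *
      (colorClass κ false).card.choose (colorClass κ false ∩ D).card ≤ (typeClass κ D).card := by
    rw [← Finset.card_powersetCard, ← Finset.card_powersetCard, ← Finset.card_product]
    have hi : ∀ V₁ V₂ : Finset E, V₁ ⊆ colorClass κ true → V₂ ⊆ colorClass κ false →
        colorClass κ true ∩ (V₁ ∪ V₂) = V₁ ∧ colorClass κ false ∩ (V₁ ∪ V₂) = V₂ := by
      intro V₁ V₂ h1 h2
      constructor
      · ext e
        simp only [Finset.mem_inter, Finset.mem_union]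
        exact ⟨fun h => h.2.resolve_right fun h3 => hdis e (h2 h3) h.1, fun h => ⟨h1 h, Or.inl h⟩⟩
      · ext e
        simp only [Finset.mem_inter, Finset.mem_union]
        exact ⟨fun h => h.2.resolve_left fun h3 => hdis e h.1 (h1 h3), fun h => ⟨h2 h, Or.inr h⟩⟩
    refine Finset.card_le_card_of_injOn (fun p => p.1 ∪ p.2) ?_ ?_
    · rintro ⟨V₁, V₂⟩ hp
      simp only [Finset.coe_product, Set.mem_prod, Finset.mem_coe, Finset.mem_powersetCard] at hp
      obtain ⟨⟨h1, c1⟩, h2, c2⟩ := hp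
      obtain ⟨i1, i2⟩ := hi V₁ V₂ h1 h2
      simp only [typeClass, Finset.coe_filter, Finset.mem_univ, true_and, Set.mem_ofPred_eq]
      refine ⟨Finset.union_subset (h1.trans Finset.subset_union_right)
        (h2.trans Finset.subset_union_left), fun x => ?_⟩
      cases x
      · rw [i2, c2]
      · rw [i1, c1]
    · rintro ⟨V₁, V₂⟩ hp ⟨W₁, W₂⟩ hq heq
      simp only [Finset.coe_product, Set.mem_prod, Finset.mem_coe, Finset.mem_powersetCard] at hp hq
      obtain ⟨i1, i2⟩ := hi V₁ V₂ hp.1.1 hp.2.1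
      obtain ⟨j1, j2⟩ := hi W₁ W₂ hq.1.1 hq.2.1
      simp only at heq
      rw [heq] at i1 i2
      rw [← i1, ← i2, j1, j2]
  have hb : ∀ x, (1 : ℝ) ≤ _ := fun x =>
    one_le_binomial_mode (N := (colorClass κ x).card) (D := (colorClass κ x ∩ D).card)
      (Finset.card_le_card Finset.inter_subset_left)
  have h3 := one_le_mul_of_one_le_of_one_le (hb true) (hb false)
  refine h3.trans ?_
  rw [Fintype.prod_bool, Fintype.prod_bool]
  have hx : ∀ x, (0 : ℝ) ≤
      (((colorClass κ x ∩ D).card / (colorClass κ x).card : ℝ) ^ (colorClass κ x ∩ D).card *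
      (1 - (colorClass κ x ∩ D).card / (colorClass κ x).card : ℝ) ^
        ((colorClass κ x).card - (colorClass κ x ∩ D).card)) := by
    intro x
    refine mul_nonneg (by positivity) (pow_nonneg (sub_nonneg.2 ?_) _)
    refine div_le_one_of_le₀ ?_ (by positivity)
    exact_mod_cast Finset.card_le_card Finset.inter_subset_left
  have hcard' : ((colorClass κ true).card.choose (colorClass κ true ∩ D).card : ℝ) *
      (colorClass κ false).card.choose (colorClass κ false ∩ D).card ≤ (typeClass κ D).card := by
    exact_mod_cast hcard
  have h4 := mul_le_mul_of_nonneg_right hcard' (mul_nonneg (hx true) (hx false))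
  have h5 := mul_le_mul_of_nonneg_left h4
    (show (0 : ℝ) ≤ ((colorClass κ true).card + 1) * ((colorClass κ false).card + 1) by positivity)
  refine le_trans (le_of_eq ?_) h5
  ring

/-- The image of a set under a random permutation preserving the classes is compared with
independent sampling. -/
theorem sum_colorPerms_le (hD : D ⊆ colorClass κ false ∪ colorClass κ true)
    (F : Finset E → ℝ) (hF : ∀ U, 0 ≤ F U) :
    ∑ ρ ∈ colorPerms κ, F (D.image ρ) ≤ (colorPerms κ).card *
      ((∏ x : Bool, ((colorClass κ x).card + 1 : ℝ)) *
        ∑ U : Finset E, bernoulliWeight (density κ D) U * F U) := by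
  set w : ℝ := ∏ x : Bool,
      (((colorClass κ x ∩ D).card / (colorClass κ x).card : ℝ) ^ (colorClass κ x ∩ D).card *
      (1 - (colorClass κ x ∩ D).card / (colorClass κ x).card : ℝ) ^
        ((colorClass κ x).card - (colorClass κ x ∩ D).card)) with hw
  set K : ℝ := ∏ x : Bool, ((colorClass κ x).card + 1 : ℝ) with hK
  have h1 := card_typeClass_mul_sum hD F
  have h2 : 1 ≤ K * ((typeClass κ D).card * w) := one_le_card_typeClass_mul
  have h3 : ∑ U ∈ typeClass κ D, w * F U ≤ ∑ U : Finset E, bernoulliWeight (density κ D) U * F U := by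
    rw [Finset.sum_congr rfl (g := fun U => bernoulliWeight (density κ D) U * F U)
      (fun U hU => by rw [bernoulliWeight_of_mem hU])]
    exact Finset.sum_le_sum_of_subset_of_nonneg (Finset.subset_univ _)
      fun U _ _ => mul_nonneg (bernoulliWeight_nonneg (fun e => density_mem e) U) (hF U)
  have h4 : 0 ≤ ∑ ρ ∈ colorPerms κ, F (D.image ρ) := Finset.sum_nonneg fun _ _ => hF _
  have hK0 : 0 ≤ K := Finset.prod_nonneg fun _ _ => by positivity
  -- Conditioned on `typeClass κ D`, independent sampling is uniform; the event has probability at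
  -- least `1 / K`, and the other sets only add nonnegative terms.
  calc ∑ ρ ∈ colorPerms κ, F (D.image ρ)
      ≤ (K * ((typeClass κ D).card * w)) * ∑ ρ ∈ colorPerms κ, F (D.image ρ) :=
        le_mul_of_one_le_left h4 h2
    _ = (K * w) * ((typeClass κ D).card * ∑ ρ ∈ colorPerms κ, F (D.image ρ)) := by ring
    _ = (colorPerms κ).card * (K * ∑ U ∈ typeClass κ D, w * F U) := by
        rw [h1, ← Finset.mul_sum]; ring
    _ ≤ _ := mul_le_mul_of_nonneg_left (mul_le_mul_of_nonneg_left h3 hK0) (Nat.cast_nonneg _)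

end perm

/-- Independent sampling of half-edges makes the clauses independent. -/
theorem sum_bernoulli_prod {E : Type} [Fintype E] [DecidableEq E] {m k : ℕ} (π : E ≃ Fin m × Fin k) (p : E → ℝ)
    (g : Fin m → (Fin k → Bool) → ℝ) :
    ∑ U : Finset E, bernoulliWeight p U * ∏ a, g a (fun j => decide (π.symm (a, j) ∈ U)) =
      ∏ a, ∑ u : Fin k → Bool,
        (∏ j, if u j then p (π.symm (a, j)) else 1 - p (π.symm (a, j))) * g a u := by
  rw [Finset.prod_univ_sum, Fintype.piFinset_univ]
  refine Finset.sum_bij' (fun U _ a j => decide (π.symm (a, j) ∈ U))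
    (fun u _ => Finset.univ.filter fun e => u (π e).1 (π e).2 = true) ?_ ?_ ?_ ?_ ?_
  · intro _ _; exact Finset.mem_univ _
  · intro _ _; exact Finset.mem_univ _
  · intro U _; ext e; simp
  · intro u _; funext a j; simp
  · intro U _
    rw [Finset.prod_mul_distrib]
    congr 1
    unfold bernoulliWeight
    rw [← Equiv.prod_comp π.symm, Fintype.prod_prod_type]
    simp

/-! ### Symmetrization over the blue edges -/

section permute
variable {n m d k T : ℕ}

/-- The class of a blue edge is its value; other edges are on their own. -/
def blueClass (σ : Config n d) (e : Fin n × Fin d) : Bool ⊕ (Fin n × Fin d) :=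
  match σ e with
  | .b x => .inl x
  | _ => .inr e

theorem blueClass_eq_inl {σ : Config n d} {e : Fin n × Fin d} {x : Bool} :
    blueClass σ e = .inl x ↔ σ e = .b x := by
  unfold blueClass
  cases h : σ e <;> simp

theorem blueClass_eq_inr {σ : Config n d} {e e' : Fin n × Fin d} :
    blueClass σ e = .inr e' ↔ (∀ x, σ e ≠ .b x) ∧ e = e' := by
  unfold blueClass
  cases h : σ e <;> simp

/-- The edges of color `b x`. -/
theorem mem_colorClass {σ : Config n d} {e : Fin n × Fin d} {x : Bool} :
    e ∈ colorClass (blueClass σ) x ↔ σ e = .b x := by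
  simp [colorClass, blueClass_eq_inl]

theorem color_perm {σ : Config n d} {ρ : Equiv.Perm (Fin n × Fin d)}
    (hρ : ρ ∈ colorPerms (blueClass σ)) (e : Fin n × Fin d) : σ (ρ e) = σ e := by
  have h := mem_colorPerms.1 hρ e
  cases hc : blueClass σ e with
  | inl x =>
    rw [hc] at h
    rw [blueClass_eq_inl.1 h, blueClass_eq_inl.1 hc]
  | inr e' =>
    rw [hc] at h
    rw [(blueClass_eq_inr.1 h).2, (blueClass_eq_inr.1 hc).2]

theorem perm_fix {σ : Config n d} {ρ : Equiv.Perm (Fin n × Fin d)}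
    (hρ : ρ ∈ colorPerms (blueClass σ)) {e : Fin n × Fin d} (he : ∀ x, σ e ≠ .b x) : ρ e = e := by
  have h := mem_colorPerms.1 hρ e
  have h2 : blueClass σ e = .inr e := blueClass_eq_inr.2 ⟨he, rfl⟩
  rw [h2] at h
  exact (blueClass_eq_inr.1 h).2

/-- The instance in which the half-edges are permuted, the literals staying with the clauses. -/
def permute (G : Instance n m d k) (ρ : Equiv.Perm (Fin n × Fin d)) : Instance n m d k :=
  (ρ.trans G.1, fun e => G.2 (ρ e))

theorem permute_bijective (ρ : Equiv.Perm (Fin n × Fin d)) :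
    Function.Bijective fun G : Instance n m d k => permute G ρ := by
  rw [← Finite.injective_iff_bijective]
  rintro ⟨π, L⟩ ⟨π', L'⟩ h
  simp only [permute, Prod.mk.injEq] at h
  refine Prod.ext (Equiv.ext fun e => ?_) (funext fun e => ?_)
  · have := congrArg (fun f => f (ρ.symm e)) h.1
    simpa using this
  · have := congrFun h.2 (ρ.symm e)
    simpa using this

variable {G : Instance n m d k} {σ : Config n d} {ρ : Equiv.Perm (Fin n × Fin d)}

theorem color_perm_symm (hρ : ρ ∈ colorPerms (blueClass σ)) (e : Fin n × Fin d) :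
    σ (ρ.symm e) = σ e := by
  rw [← color_perm hρ (ρ.symm e), Equiv.apply_symm_apply]

theorem atClauseLit_permute (hρ : ρ ∈ colorPerms (blueClass σ)) (a : Fin m) :
    atClauseLit (permute G ρ) σ a = atClauseLit G σ a := by
  funext j
  simp [atClauseLit, permute, color_perm_symm hρ]

theorem atClause_permute (hρ : ρ ∈ colorPerms (blueClass σ)) (a : Fin m) :
    atClause (permute G ρ) σ a = atClause G σ a := by
  funext j
  simp [atClause, permute, color_perm_symm hρ]

theorem mem_colorings_permute (hρ : ρ ∈ colorPerms (blueClass σ)) :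
    σ ∈ colorings T (permute G ρ) ↔ σ ∈ colorings T G := by
  simp only [mem_colorings, atClauseLit_permute hρ]

/-- The contribution of `σ` to the partition function. -/
noncomputable def contribution (lam : ℝ) (T : ℕ) (H : Profile d k) (σ : Config n d)
    (G : Instance n m d k) : ℝ :=
  if σ ∈ near T H G then weight G σ ^ lam else 0

theorem contribution_permute {lam : ℝ} {H : Profile d k} (hρ : ρ ∈ colorPerms (blueClass σ)) :
    contribution lam T H σ (permute G ρ) = contribution lam T H σ G := by
  have h1 : empirical (permute G ρ) σ = empirical G σ := by
    simp only [empirical, atClause_permute hρ]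
  have h2 : weight (permute G ρ) σ = weight G σ := by
    simp only [weight, atClauseLit_permute hρ]
  have h3 : σ ∈ near T H (permute G ρ) ↔ σ ∈ near T H G := by
    simp only [near, Finset.mem_filter, mem_colorings_permute hρ, h1]
  simp only [contribution, h2, h3]

theorem weight_nonneg (hk : 0 < k) (G : Instance n m d k) (σ : Config n d) : 0 ≤ weight G σ :=
  mul_nonneg (mul_nonneg (Finset.prod_nonneg fun _ _ => varWeight_nonneg _)
    (Finset.prod_nonneg fun _ _ => clauseWeight_nonneg hk _))
    (Finset.prod_nonneg fun _ _ => edgeWeight_nonneg _)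

theorem contribution_nonneg (hk : 0 < k) {lam : ℝ} {H : Profile d k} :
    0 ≤ contribution lam T H σ G := by
  unfold contribution
  split_ifs
  · exact Real.rpow_nonneg (weight_nonneg hk G σ) _
  · exact le_rfl

/-- Averages with the weight of a fixed coloring may be symmetrized over the permutations of its
blue edges. -/
theorem sum_contribution_mul_le (hk : 0 < k) {lam b : ℝ} {H : Profile d k}
    (Y : Instance n m d k → ℝ)
    (hY : ∀ G, σ ∈ near T H G →
      ∑ ρ ∈ colorPerms (blueClass σ), Y (permute G ρ) ≤ (colorPerms (blueClass σ)).card * b) :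
    ∑ G, contribution lam T H σ G * Y G ≤
      b * ∑ G : Instance n m d k, contribution lam T H σ G := by
  have hpos : (0 : ℝ) < (colorPerms (blueClass σ)).card := by
    exact_mod_cast Finset.card_pos.2 colorPerms_nonempty
  -- Change of variables `G ↦ permute G ρ`, a bijection of instances that preserves the contribution
  -- of `σ`.
  have h1 : ∀ ρ ∈ colorPerms (blueClass σ), ∑ G, contribution lam T H σ G * Y (permute G ρ) =
      ∑ G : Instance n m d k, contribution lam T H σ G * Y G := by
    intro ρ hρ
    rw [← (permute_bijective ρ).sum_comp
      (fun G : Instance n m d k => contribution lam T H σ G * Y G)]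
    exact Finset.sum_congr rfl fun G _ => by rw [contribution_permute hρ]
  have h2 : ((colorPerms (blueClass σ)).card : ℝ) * ∑ G, contribution lam T H σ G * Y G =
      ∑ G, contribution lam T H σ G * ∑ ρ ∈ colorPerms (blueClass σ), Y (permute G ρ) := by
    simp_rw [Finset.mul_sum (colorPerms (blueClass σ))]
    rw [Finset.sum_comm, Finset.sum_congr rfl h1, Finset.sum_const, nsmul_eq_mul]
  refine le_of_mul_le_mul_left ?_ hpos
  rw [h2, ← mul_assoc, Finset.mul_sum]
  refine Finset.sum_le_sum fun G _ => ?_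
  by_cases hG : σ ∈ near T H G
  · rw [mul_comm]
    exact mul_le_mul_of_nonneg_right (hY G hG) (contribution_nonneg hk)
  · simp [contribution, hG]

end permute

/-! ### Independent bits -/

theorem sum_bool_prod {N : ℕ} (h : Fin N → Bool → ℝ) :
    ∑ u : Fin N → Bool, ∏ j, h j (u j) = ∏ j, (h j true + h j false) := by
  have := Finset.prod_univ_sum (fun _ : Fin N => (Finset.univ : Finset Bool)) h
  rw [Fintype.piFinset_univ] at this
  rw [← this]
  simp

theorem sum_bernoulli_one {N : ℕ} (p : Fin N → ℝ) :
    ∑ u : Fin N → Bool, (∏ j, if u j then p j else 1 - p j) = 1 := by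
  rw [sum_bool_prod fun j b => if b then p j else 1 - p j]
  simp

theorem sum_bernoulli_coord {N : ℕ} (p : Fin N → ℝ) (i : Fin N) :
    ∑ u : Fin N → Bool, (∏ j, if u j then p j else 1 - p j) * (if u i then 1 else 0) = p i := by
  have h1 : ∀ u : Fin N → Bool, (∏ j, if u j then p j else 1 - p j) * (if u i then 1 else 0) =
      ∏ j, ((if u j then p j else 1 - p j) * if j = i then (if u j then 1 else 0) else 1) := by
    intro u
    rw [Finset.prod_mul_distrib]
    congr 1
    rw [Finset.prod_ite_eq' Finset.univ i fun j => if u j then (1 : ℝ) else 0]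
    simp
  simp_rw [h1]
  rw [sum_bool_prod fun j b => (if b then p j else 1 - p j) *
    if j = i then (if b then 1 else 0) else 1]
  rw [Finset.prod_eq_single i]
  · simp
  · intro j _ hj; simp [hj]
  · simp

theorem sum_bernoulli_exists_le {N : ℕ} {p : Fin N → ℝ} (hp : ∀ j, p j ∈ Set.Icc (0 : ℝ) 1) :
    ∑ u : Fin N → Bool, (∏ j, if u j then p j else 1 - p j) *
      (if ∃ j, u j = true then 1 else 0) ≤ ∑ j, p j := by
  have h0 : ∀ u : Fin N → Bool, 0 ≤ ∏ j, if u j then p j else 1 - p j := fun u =>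
    Finset.prod_nonneg fun j _ => by split_ifs; exacts [(hp j).1, sub_nonneg.2 (hp j).2]
  calc _ ≤ ∑ u : Fin N → Bool, ∑ i, (∏ j, if u j then p j else 1 - p j) *
        (if u i then 1 else 0) := by
        refine Finset.sum_le_sum fun u _ => ?_
        rw [← Finset.mul_sum]
        refine mul_le_mul_of_nonneg_left ?_ (h0 u)
        have hs : ∀ j ∈ Finset.univ, (0 : ℝ) ≤ if u j = true then 1 else 0 := fun j _ => by
          split_ifs <;> norm_num
        split_ifs with h
        · obtain ⟨j, hj⟩ := h
          have := Finset.single_le_sum hs (Finset.mem_univ j)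
          simpa [hj] using this
        · exact Finset.sum_nonneg hs
    _ = _ := by
        rw [Finset.sum_comm]
        exact Finset.sum_congr rfl fun i _ => sum_bernoulli_coord p i

/-- Bound the elementary symmetric polynomial by the full product: with weights `a u / B` the
product of `1 + a u / B` is at most `exp j`, and undoing the scaling costs `B ^ j`. -/
theorem sum_powersetCard_prod_le {α : Type} (A : Finset α) (a : α → ℝ) (ha : ∀ u, 0 ≤ a u)
    {B : ℝ} (hB : 0 < B) {j : ℕ} (h : ∑ u ∈ A, a u ≤ B * j) :
    ∑ S ∈ A.powersetCard j, ∏ u ∈ S, a u ≤ (Real.exp 1 * B) ^ j := by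
  have h1 : ∑ S ∈ A.powersetCard j, ∏ u ∈ S, a u / B ≤ ∏ u ∈ A, (1 + a u / B) := by
    rw [Finset.prod_one_add]
    refine Finset.sum_le_sum_of_subset_of_nonneg ?_ fun S _ _ =>
      Finset.prod_nonneg fun u _ => div_nonneg (ha u) hB.le
    intro S hS
    exact Finset.mem_powerset.2 (Finset.mem_powersetCard.1 hS).1
  have h2 : ∏ u ∈ A, (1 + a u / B) ≤ Real.exp (∑ u ∈ A, a u / B) :=
    Real.prod_one_add_le_exp_sum A fun u => div_nonneg (ha u) hB.le
  have h3 : ∑ u ∈ A, a u / B ≤ j := by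
    rw [← Finset.sum_div, div_le_iff₀ hB]; linarith
  have h4 : ∑ S ∈ A.powersetCard j, ∏ u ∈ S, a u / B =
      (∑ S ∈ A.powersetCard j, ∏ u ∈ S, a u) / B ^ j := by
    rw [Finset.sum_div]
    refine Finset.sum_congr rfl fun S hS => ?_
    rw [Finset.prod_div_distrib, Finset.prod_const, (Finset.mem_powersetCard.1 hS).2]
  have h5 := (h1.trans h2).trans (Real.exp_le_exp.2 h3)
  rw [h4, div_le_iff₀ (by positivity)] at h5
  rw [mul_pow, ← Real.exp_nat_mul, mul_one]
  exact h5

/-- For at most `j` elements and `1 ≤ c` one has `P ^ t.card ≤ c ^ j * (P / c) ^ t.card`; the sum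
over all subsets is then a product bounded by `exp j`. -/
theorem sum_powerset_pow_le {α : Type} (A : Finset α) {P c : ℝ} (hP : 0 ≤ P) (hc : 1 ≤ c) {j : ℕ}
    (h : A.card * P ≤ c * j) :
    ∑ t ∈ A.powerset.filter (fun t => t.card ≤ j), P ^ t.card ≤ (Real.exp 1 * c) ^ j := by
  have hc0 : 0 < c := by linarith
  have h1 : ∑ t ∈ A.powerset.filter (fun t => t.card ≤ j), P ^ t.card ≤
      c ^ j * ∑ t ∈ A.powerset, ∏ u ∈ t, P / c := by
    rw [Finset.mul_sum]
    refine le_trans (Finset.sum_le_sum (g := fun t => c ^ j * ∏ u ∈ t, P / c) fun t ht => ?_)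
      (Finset.sum_le_sum_of_subset_of_nonneg (Finset.filter_subset _ _) fun t _ _ =>
        mul_nonneg (by positivity) (Finset.prod_nonneg fun _ _ => by positivity))
    have htj := (Finset.mem_filter.1 ht).2
    rw [Finset.prod_const, div_pow, ← mul_div_assoc, le_div_iff₀ (by positivity), mul_comm]
    exact mul_le_mul_of_nonneg_right (pow_le_pow_right₀ hc htj) (by positivity)
  have h2 : ∑ t ∈ A.powerset, ∏ u ∈ t, P / c ≤ Real.exp j := by
    rw [← Finset.prod_one_add]
    refine (Real.prod_one_add_le_exp_sum A fun u => by positivity).trans (Real.exp_le_exp.2 ?_)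
    rw [Finset.sum_const, nsmul_eq_mul, ← mul_div_assoc, div_le_iff₀ hc0]
    linarith
  rw [mul_pow, ← Real.exp_nat_mul, mul_one, mul_comm (Real.exp _)]
  exact h1.trans (mul_le_mul_of_nonneg_left h2 (by positivity))

/-! ### The expected number of linked pairs -/

section linked
variable {n m d k T : ℕ} {G : Instance n m d k} {σ : Config n d}

/-- The factor that compares permutations with independent sampling. -/
noncomputable def samplingFactor (σ : Config n d) : ℝ :=
  ∏ x : Bool, ((colorClass (blueClass σ) x).card + 1 : ℝ)

theorem samplingFactor_nonneg : 0 ≤ samplingFactor σ := Finset.prod_nonneg fun _ _ => by positivity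

theorem samplingFactor_le : samplingFactor σ ≤ ((n : ℝ) * d + 1) ^ 2 := by
  have h : ∀ x : Bool, ((colorClass (blueClass σ) x).card + 1 : ℝ) ≤ n * d + 1 := by
    intro x
    have h1 := Finset.card_le_univ (colorClass (blueClass σ) x)
    rw [Fintype.card_prod, Fintype.card_fin, Fintype.card_fin] at h1
    have h2 : ((colorClass (blueClass σ) x).card : ℝ) ≤ n * d := by exact_mod_cast h1
    linarith
  unfold samplingFactor
  rw [Fintype.prod_bool, sq]
  exact mul_le_mul (h true) (h false) (by positivity) (by positivity)

/-- The blue edges at a set of variables. -/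
noncomputable def blueEdges (σ : Config n d) (S : Finset (Fin n)) : Finset (Fin n × Fin d) :=
  Finset.univ.filter fun e => e.1 ∈ S ∧ ∃ y, σ e = .b y

theorem blueEdges_subset (S : Finset (Fin n)) :
    blueEdges σ S ⊆ colorClass (blueClass σ) false ∪ colorClass (blueClass σ) true := by
  intro e he
  simp only [blueEdges, Finset.mem_filter, Finset.mem_univ, true_and] at he
  obtain ⟨-, y, hy⟩ := he
  rw [Finset.mem_union, mem_colorClass, mem_colorClass]
  cases y
  · exact Or.inl hy
  · exact Or.inr hy

theorem density_blueEdges_le {S : Finset (Fin n)} {p : ℝ} (hp : 0 ≤ p)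
    (h : ∀ x, (S.card * d : ℝ) ≤ p * (colorClass (blueClass σ) x).card) (e : Fin n × Fin d) :
    density (blueClass σ) (blueEdges σ S) e ≤ p := by
  unfold density
  split
  · rename_i x hx
    refine div_le_of_le_mul₀ (by positivity) hp ((Nat.cast_le.2 ?_).trans
      (show (((S.card * d : ℕ)) : ℝ) ≤ _ from by push_cast; exact h x))
    calc (colorClass (blueClass σ) x ∩ blueEdges σ S).card
        ≤ (S ×ˢ (Finset.univ : Finset (Fin d))).card := by
          refine Finset.card_le_card fun e he => ?_
          have := (Finset.mem_inter.1 he).2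
          simp only [blueEdges, Finset.mem_filter, Finset.mem_univ, true_and] at this
          simp [this.1]
      _ = S.card * d := by simp
  · exact hp

/-- The edges of `t` are not blue, so the permutations leave their clauses in place, and only the
positions of the blue edges at `S` are random. Under independent sampling of density at most `p`,
the distinct clauses of `t` each receive such an edge with probability at most `k * p`,
independently. If the clauses of `t` are not distinct, the event is empty. -/
theorem sum_linked_le {S : Finset (Fin n)} {t : Finset (Fin n × Fin d)} {p : ℝ}
    (ht : ∀ e ∈ t, ∀ x, σ e ≠ .b x) (hp : 0 ≤ p)
    (h : ∀ x, (S.card * d : ℝ) ≤ p * (colorClass (blueClass σ) x).card) :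
    ∑ ρ ∈ colorPerms (blueClass σ), (if Linked (permute G ρ) σ S t then (1 : ℝ) else 0) ≤
      (colorPerms (blueClass σ)).card * (samplingFactor σ * (k * p) ^ t.card) := by
  by_cases hinj : Set.InjOn (fun e => (G.1 e).1) (t : Set (Fin n × Fin d))
  swap
  · have h0 : ∀ ρ ∈ colorPerms (blueClass σ),
        (if Linked (permute G ρ) σ S t then (1 : ℝ) else 0) = 0 := by
      intro ρ hρ
      refine if_neg fun hL => hinj fun e he e' he' heq => hL.1 he he' ?_
      simp only [permute, Equiv.trans_apply]
      rw [perm_fix hρ (ht e he), perm_fix hρ (ht e' he')]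
      exact heq
    rw [Finset.sum_eq_zero h0]
    exact mul_nonneg (Nat.cast_nonneg _) (mul_nonneg samplingFactor_nonneg (by positivity))
  let g : Fin m → (Fin k → Bool) → ℝ := fun a u =>
    if a ∈ t.image (fun e => (G.1 e).1) then (if ∃ j, u j = true then 1 else 0) else 1
  have hg0 : ∀ a u, 0 ≤ g a u := by
    intro a u
    simp only [g]
    split_ifs <;> norm_num
  let F : Finset (Fin n × Fin d) → ℝ := fun U =>
    ∏ a, g a (fun j => decide (G.1.symm (a, j) ∈ U))
  have h1 := sum_colorPerms_le (κ := blueClass σ) (blueEdges_subset S) F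
    (fun U => Finset.prod_nonneg fun a _ => hg0 a _)
  refine le_trans (Finset.sum_le_sum fun ρ hρ => ?_) (h1.trans ?_)
  · split_ifs with hL
    · refine le_of_eq (Finset.prod_eq_one fun a _ => ?_).symm
      simp only [g]
      split_ifs with ha hj
      · rfl
      · exfalso
        apply hj
        obtain ⟨e, he, rfl⟩ := Finset.mem_image.1 ha
        obtain ⟨e', hb, hS, hc⟩ := hL.2 e he
        simp only [permute, Equiv.trans_apply, perm_fix hρ (ht e he)] at hc
        refine ⟨(G.1 (ρ e')).2, ?_⟩
        rw [← hc, decide_eq_true_iff]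
        simp only [Prod.mk.eta, Equiv.symm_apply_apply]
        exact Finset.mem_image_of_mem _ (Finset.mem_filter.2 ⟨Finset.mem_univ _, hS, hb⟩)
      · rfl
    · exact Finset.prod_nonneg fun a _ => hg0 a _
  · refine mul_le_mul_of_nonneg_left (mul_le_mul_of_nonneg_left ?_ samplingFactor_nonneg)
      (Nat.cast_nonneg _)
    simp only [F]
    rw [sum_bernoulli_prod G.1 (density (blueClass σ) (blueEdges σ S)) g]
    have h2 : ∀ a, (∑ u : Fin k → Bool, (∏ j, if u j then
        density (blueClass σ) (blueEdges σ S) (G.1.symm (a, j)) else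
        1 - density (blueClass σ) (blueEdges σ S) (G.1.symm (a, j))) * g a u) ≤
        if a ∈ t.image (fun e => (G.1 e).1) then k * p else 1 := by
      intro a
      simp only [g]
      split_ifs with ha
      · refine (sum_bernoulli_exists_le fun j => density_mem _).trans ?_
        calc _ ≤ ∑ j : Fin k, p := Finset.sum_le_sum fun j _ => density_blueEdges_le hp h _
          _ = k * p := by simp
      · simp only [mul_one]
        exact (sum_bernoulli_one _).le
    refine (Finset.prod_le_prod (fun a _ => Finset.sum_nonneg fun u _ =>
      mul_nonneg (Finset.prod_nonneg fun j _ => ?_) (hg0 a u)) fun a _ => h2 a).trans ?_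
    · split_ifs
      · exact (density_mem _).1
      · exact sub_nonneg.2 (density_mem _).2
    · rw [Finset.prod_ite, Finset.prod_const, Finset.prod_const_one, mul_one]
      have : (Finset.univ.filter fun a => a ∈ t.image (fun e => (G.1 e).1)) =
          t.image (fun e => (G.1 e).1) := by ext; simp
      rw [this, Finset.card_image_of_injOn hinj]

/-- The number of red edges at a variable. -/
noncomputable def redDegree (σ : Config n d) (v : Fin n) : ℕ :=
  (Finset.univ.filter fun i => (σ (v, i)).IsRed).card

theorem card_redEdges (S : Finset (Fin n)) : (redEdges σ S).card = ∑ v ∈ S, redDegree σ v := by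
  have : redEdges σ S = (S.sigma (fun v => Finset.univ.filter fun i => (σ (v, i)).IsRed)).map
      (Equiv.sigmaEquivProd (Fin n) (Fin d)).toEmbedding := by
    ext ⟨v, i⟩
    simp only [redEdges, Finset.mem_filter, Finset.mem_univ, true_and, Finset.mem_map,
      Finset.mem_sigma, Equiv.coe_toEmbedding, Sigma.exists, Equiv.sigmaEquivProd_apply,
      Prod.mk.injEq]
    constructor
    · rintro ⟨h1, h2⟩; exact ⟨v, i, ⟨h1, h2⟩, rfl, rfl⟩
    · rintro ⟨v', i', ⟨h1, h2⟩, rfl, rfl⟩; exact ⟨h1, h2⟩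
  rw [this, Finset.card_map, Finset.card_sigma]
  rfl

/-- Sum the bound of `sum_linked_le` over all pairs. Red edges at `S` and edges of `t` are disjoint,
so the bound factors into a product over `S` of powers with exponent `redDegree` and a power with
exponent `t.card`; each sum is handled by its own subset estimate. -/
theorem sum_card_linkedPairs_le {j : ℕ} {p B c : ℝ} (hp : 0 ≤ p)
    (hN : ∀ x, (j * d : ℝ) ≤ p * (colorClass (blueClass σ) x).card)
    (hB : 0 < B) (hc : 1 ≤ c) (h1 : ∑ v ∈ frozenVars σ, (k * p) ^ redDegree σ v ≤ B * j)
    (h2 : (freeEdges σ).card * (k * p) ≤ c * j) :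
    ∑ ρ ∈ colorPerms (blueClass σ), ((linkedPairs (permute G ρ) σ j).card : ℝ) ≤
      (colorPerms (blueClass σ)).card *
        (samplingFactor σ * ((Real.exp 1 * B) ^ j * (Real.exp 1 * c) ^ j)) := by
  have hP : 0 ≤ k * p := by positivity
  set A := (frozenVars σ).powersetCard j with hA
  set A' := (freeEdges σ).powerset.filter fun t => t.card ≤ j with hA'
  have e1 : ∀ ρ, ((linkedPairs (permute G ρ) σ j).card : ℝ) =
      ∑ q ∈ A ×ˢ A', if Linked (permute G ρ) σ q.1 (redEdges σ q.1 ∪ q.2) then (1 : ℝ) else 0 := by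
    intro ρ
    rw [linkedPairs, Finset.card_filter]
    push_cast
    rfl
  simp_rw [e1]
  rw [Finset.sum_comm]
  have e2 : ∀ q ∈ A ×ˢ A', ∑ ρ ∈ colorPerms (blueClass σ),
      (if Linked (permute G ρ) σ q.1 (redEdges σ q.1 ∪ q.2) then (1 : ℝ) else 0) ≤
      (colorPerms (blueClass σ)).card * (samplingFactor σ *
        ((∏ v ∈ q.1, (k * p) ^ redDegree σ v) * (k * p) ^ q.2.card)) := by
    rintro ⟨S, t⟩ hq
    rw [Finset.mem_product, hA, hA', Finset.mem_powersetCard, Finset.mem_filter,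
      Finset.mem_powerset] at hq
    obtain ⟨⟨hS, hSj⟩, htf, htj⟩ := hq
    simp only at hS hSj htf htj ⊢
    have hdisj : Disjoint (redEdges σ S) t := by
      rw [Finset.disjoint_left]
      intro e he he'
      have h3 := htf he'
      simp only [redEdges, freeEdges, Finset.mem_filter, Finset.mem_univ, true_and] at he h3
      obtain ⟨-, y, hy⟩ := he
      obtain ⟨a, b, hab⟩ := h3
      rw [hy] at hab; cases hab
    have h3 := sum_linked_le (G := G) (σ := σ) (S := S) (t := redEdges σ S ∪ t) (p := p) ?_ hp
      (by rw [hSj]; exact hN)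
    · rwa [Finset.card_union_of_disjoint hdisj, pow_add, card_redEdges, ← Finset.prod_pow_eq_pow_sum]
        at h3
    · intro e he x hx
      rcases Finset.mem_union.1 he with he | he
      · simp only [redEdges, Finset.mem_filter, Finset.mem_univ, true_and] at he
        obtain ⟨-, y, hy⟩ := he
        rw [hy] at hx; cases hx
      · have h3 := htf he
        simp only [freeEdges, Finset.mem_filter, Finset.mem_univ, true_and] at h3
        obtain ⟨a, b, hab⟩ := h3
        rw [hab] at hx; cases hx
  refine (Finset.sum_le_sum e2).trans ?_
  rw [← Finset.mul_sum, ← Finset.mul_sum, Finset.sum_product]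
  refine mul_le_mul_of_nonneg_left (mul_le_mul_of_nonneg_left ?_ samplingFactor_nonneg)
    (Nat.cast_nonneg _)
  simp only
  rw [← Finset.sum_mul_sum]
  exact mul_le_mul (sum_powersetCard_prod_le _ _ (fun v => pow_nonneg hP _) hB h1)
    (sum_powerset_pow_le _ hP hc h2) (Finset.sum_nonneg fun _ _ => pow_nonneg hP _)
    (by positivity)

end linked

-- Typical colorings and the count at small distance.

section typical
variable {n m d k T : ℕ} {G : Instance n m d k} {σ : Config n d} {η α : ℝ}

/-- A coloring with almost the expected number of clauses of each blue pattern, and few variables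
with few red edges. -/
structure Typical (T : ℕ) (η α : ℝ) (G : Instance n m d k) (σ : Config n d) : Prop where
  coloring : σ ∈ colorings T G
  blue : ∀ y : Fin k → Bool, (m : ℝ) / 2 ^ k * (1 - η) ≤
    (Finset.univ.filter fun a => atClause G σ a = fun j => .b (y j)).card
  red : ∑ v ∈ frozenVars σ, (1 / 2 : ℝ) ^ redDegree σ v ≤ α * n

/-- The bits at a clause whose edges are all blue. -/
def pattern (G : Instance n m d k) (σ : Config n d) (a : Fin m) : Fin k → Bool :=
  fun j => (atClause G σ a j).value.getD false

/-- All edges of the clause are blue. -/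
def BlueClause (G : Instance n m d k) (σ : Config n d) (a : Fin m) : Prop :=
  ∀ j, ∃ y, atClause G σ a j = .b y

theorem BlueClause.atClause_eq {a : Fin m} (h : BlueClause G σ a) (j : Fin k) :
    atClause G σ a j = .b (pattern G σ a j) := by
  obtain ⟨y, hy⟩ := h j
  rw [pattern, hy]
  rfl

theorem blueClause_of_eq {a : Fin m} {y : Fin k → Bool} (h : atClause G σ a = fun j => .b (y j)) :
    BlueClause G σ a ∧ pattern G σ a = y := by
  refine ⟨fun j => ⟨y j, by rw [h]⟩, funext fun j => ?_⟩
  rw [pattern, h]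
  rfl

/-- Lower bounds on the frequency of each blue pattern transfer to every nonnegative function of the
pattern. The counts of blue edges and the energy estimate at intermediate distance are all obtained
this way. -/
theorem Typical.sum_le (h : Typical T η α G σ) (Φ : (Fin k → Bool) → ℝ) (hΦ : ∀ y, 0 ≤ Φ y) :
    (m : ℝ) / 2 ^ k * (1 - η) * ∑ y, Φ y ≤
      ∑ a, if BlueClause G σ a then Φ (pattern G σ a) else 0 := by
  have h1 : ∀ a, (if BlueClause G σ a then Φ (pattern G σ a) else 0) =
      ∑ y, if atClause G σ a = (fun j => .b (y j)) then Φ y else 0 := by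
    intro a
    split_ifs with hb
    · rw [Finset.sum_eq_single (pattern G σ a)]
      · rw [if_pos (funext hb.atClause_eq)]
      · intro y _ hy
        exact if_neg fun h2 => hy (blueClause_of_eq h2).2.symm
      · simp
    · symm
      exact Finset.sum_eq_zero fun y _ => if_neg fun h2 => hb (blueClause_of_eq h2).1
  simp_rw [h1]
  rw [Finset.sum_comm, Finset.mul_sum]
  refine Finset.sum_le_sum fun y _ => ?_
  rw [← Finset.sum_filter, Finset.sum_const, nsmul_eq_mul]
  exact mul_le_mul_of_nonneg_right (h.blue y) (hΦ y)

theorem Typical.card_blueClause (h : Typical T η α G σ) :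
    (m : ℝ) * (1 - η) ≤ (Finset.univ.filter fun a => BlueClause G σ a).card := by
  have h1 := h.sum_le (fun _ => 1) fun _ => zero_le_one
  rw [← Finset.sum_filter] at h1
  simp only [Finset.sum_const, Finset.card_univ, Fintype.card_fun, Fintype.card_bool,
    Fintype.card_fin, nsmul_eq_mul, mul_one, Nat.cast_pow, Nat.cast_ofNat] at h1
  refine le_trans (le_of_eq ?_) h1
  field_simp

theorem card_edges (G : Instance n m d k) : n * d = m * k := by
  have := Fintype.card_congr G.1
  simpa using this

/-- Edges that are not blue lie in the clauses that are not entirely blue, of which there are at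
most `η * m`. -/
theorem Typical.card_nonblue (h : Typical T η α G σ) :
    ((Finset.univ.filter fun e => ∀ y, σ e ≠ .b y).card : ℝ) ≤ η * (n * d) := by
  have h1 : (Finset.univ.filter fun e => ∀ y, σ e ≠ .b y).card ≤
      ((Finset.univ.filter fun a => ¬ BlueClause G σ a) ×ˢ (Finset.univ : Finset (Fin k))).card := by
    refine Finset.card_le_card_of_injOn (fun e => G.1 e) ?_ G.1.injective.injOn
    intro e he
    simp only [Finset.coe_filter, Finset.mem_univ, true_and, Set.mem_ofPred_eq] at he
    simp only [Finset.coe_product, Set.mem_prod, Finset.coe_filter, Finset.mem_univ, true_and,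
      Set.mem_ofPred_eq, Finset.coe_univ, Set.mem_univ, and_true]
    intro hb
    obtain ⟨y, hy⟩ := hb (G.1 e).2
    simp only [atClause, Prod.mk.eta, Equiv.symm_apply_apply] at hy
    exact he y hy
  have h2 := h.card_blueClause
  have h3 : (Finset.univ.filter fun a => BlueClause G σ a).card +
      (Finset.univ.filter fun a => ¬ BlueClause G σ a).card = m := by
    rw [Finset.card_filter_add_card_filter_not]; simp
  have h3' : ((Finset.univ.filter fun a => BlueClause G σ a).card : ℝ) +
      (Finset.univ.filter fun a => ¬ BlueClause G σ a).card = m := by exact_mod_cast h3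
  rw [Finset.card_product, Finset.card_univ, Fintype.card_fin] at h1
  have h4 : (n * d : ℝ) = m * k := by exact_mod_cast card_edges G
  have h1' : ((Finset.univ.filter fun e => ∀ y, σ e ≠ .b y).card : ℝ) ≤
      (Finset.univ.filter fun a => ¬ BlueClause G σ a).card * k := by exact_mod_cast h1
  have h5 : ((Finset.univ.filter fun a => ¬ BlueClause G σ a).card : ℝ) ≤ η * m := by linarith
  rw [h4]
  nlinarith [Nat.cast_nonneg (α := ℝ) k]

theorem Typical.card_freeEdges (h : Typical T η α G σ) :
    ((freeEdges σ).card : ℝ) ≤ η * (n * d) := by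
  refine le_trans ?_ h.card_nonblue
  refine Nat.cast_le.2 (Finset.card_le_card fun e he => ?_)
  simp only [freeEdges, Finset.mem_filter, Finset.mem_univ, true_and] at he ⊢
  obtain ⟨a, b, hab⟩ := he
  intro y hy
  rw [hab] at hy; cases hy

theorem Typical.numFree_le (hd : 0 < d) (h : Typical T η α G σ) : (numFree σ : ℝ) ≤ η * n := by
  have h1 : numFree σ * d ≤ (freeEdges σ).card := by
    have : ((Finset.univ.filter fun v => frozen σ v = none) ×ˢ
        (Finset.univ : Finset (Fin d))).card ≤ (freeEdges σ).card := by
      refine Finset.card_le_card fun e he => ?_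
      simp only [Finset.mem_product, Finset.mem_filter, Finset.mem_univ, true_and, and_true] at he
      simp only [freeEdges, Finset.mem_filter, Finset.mem_univ, true_and]
      rw [← value_eq_none, ← colorings_value h.coloring]
      exact he
    simpa [numFree] using this
  have h2 := h.card_freeEdges
  have h3 : (numFree σ : ℝ) * d ≤ (freeEdges σ).card := by exact_mod_cast h1
  have hd' : (0 : ℝ) < d := by exact_mod_cast hd
  refine le_of_mul_le_mul_right ?_ hd'
  linarith

theorem sum_count_eq (k : ℕ) (x : Bool) :
    ∑ y : Fin k → Bool, ((Finset.univ.filter fun j => y j = x).card : ℝ) = 2 ^ k * (k / 2) := by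
  have h1 : ∀ y : Fin k → Bool, ((Finset.univ.filter fun j => y j = x).card : ℝ) =
      ∑ j, if y j = x then (1 : ℝ) else 0 := by
    intro y; rw [Finset.card_filter]; push_cast; rfl
  simp_rw [h1]
  rw [Finset.sum_comm]
  have h2 : ∀ j : Fin k, ∑ y : Fin k → Bool, (if y j = x then (1 : ℝ) else 0) = 2 ^ k / 2 := by
    intro j
    have h3 : ∑ y : Fin k → Bool, (if y j = x then (1 : ℝ) else 0) =
        ∑ y : Fin k → Bool, (if y j = x then 0 else (1 : ℝ)) := by
      refine Finset.sum_bij' (fun y _ i => !(y i)) (fun y _ i => !(y i)) (by simp) (by simp)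
        (by simp) (by simp) ?_
      intro y _
      cases hy : y j <;> cases x <;> simp [hy]
    have h4 : ∑ y : Fin k → Bool, (if y j = x then (1 : ℝ) else 0) +
        ∑ y : Fin k → Bool, (if y j = x then 0 else (1 : ℝ)) = 2 ^ k := by
      rw [← Finset.sum_add_distrib, Finset.sum_congr rfl (g := fun _ => (1 : ℝ))]
      · simp
      · intro y _; split_ifs <;> norm_num
    linarith
  rw [Finset.sum_congr rfl fun j _ => h2 j]
  simp
  ring

/-- In a uniform pattern half of the positions carry `x`, and the all-blue clauses alone supply the
bound. -/
theorem Typical.card_colorClass (h : Typical T η α G σ) (x : Bool) :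
    (n * d : ℝ) / 2 * (1 - η) ≤ (colorClass (blueClass σ) x).card := by
  have h1 := h.sum_le (fun y => ((Finset.univ.filter fun j => y j = x).card : ℝ))
    fun _ => Nat.cast_nonneg _
  rw [sum_count_eq] at h1
  have h2 : ((∑ a, if BlueClause G σ a then
      ((Finset.univ.filter fun j => pattern G σ a j = x).card : ℝ) else 0)) ≤
      (colorClass (blueClass σ) x).card := by
    have h3 : (colorClass (blueClass σ) x).card =
        ∑ a, (Finset.univ.filter fun j => σ (G.1.symm (a, j)) = .b x).card := by
      simp_rw [Finset.card_filter]
      rw [← Fintype.sum_prod_type' (f := fun a j => if σ (G.1.symm (a, j)) = .b x then 1 else 0),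
        ← Finset.card_filter]
      refine Finset.card_bij (fun e _ => G.1 e) ?_ ?_ ?_
      · intro e he
        simpa [mem_colorClass] using he
      · intro e _ e' _ he; exact G.1.injective he
      · intro s hs
        exact ⟨G.1.symm s, by simpa [mem_colorClass] using hs, by simp⟩
    rw [h3]
    push_cast
    refine Finset.sum_le_sum fun a _ => ?_
    split_ifs with hb
    · refine Nat.cast_le.2 (Finset.card_le_card fun j hj => ?_)
      simp only [Finset.mem_filter, Finset.mem_univ, true_and] at hj ⊢
      have := hb.atClause_eq j
      rw [hj] at this
      exact this
    · positivity
  refine le_trans (le_of_eq ?_) (h1.trans h2)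
  have h4 : (n * d : ℝ) = m * k := by exact_mod_cast card_edges G
  rw [h4]
  field_simp

theorem one_le_redDegree {v : Fin n} (hv : v ∈ frozenVars σ) : 1 ≤ redDegree σ v := by
  simp only [frozenVars, Finset.mem_filter, Finset.mem_univ, true_and] at hv
  unfold frozen at hv
  rw [redDegree, Nat.one_le_iff_ne_zero, Finset.card_ne_zero]
  split_ifs at hv with h1 h2
  · obtain ⟨i, hi⟩ := h1
    exact ⟨i, Finset.mem_filter.2 ⟨Finset.mem_univ _, _, hi⟩⟩
  · obtain ⟨i, hi⟩ := h2
    exact ⟨i, Finset.mem_filter.2 ⟨Finset.mem_univ _, _, hi⟩⟩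
  · exact absurd rfl hv

theorem Typical.permute (h : Typical T η α G σ) {ρ : Equiv.Perm (Fin n × Fin d)}
    (hρ : ρ ∈ colorPerms (blueClass σ)) : Typical T η α (permute G ρ) σ := by
  refine ⟨(mem_colorings_permute hρ).2 h.coloring, ?_, h.red⟩
  simp only [atClause_permute hρ]
  exact h.blue

/-- The expected number of valid frozen configurations at a given small distance. -/
theorem Typical.sum_card_nearbyFrozen_le (h : Typical T η α G σ) (hk : 3 ≤ k) (hd : 0 < d)
    (hη : η ≤ 1 / 2) (hα : 0 < α) {c : ℝ} (hc : 1 ≤ c) (hcη : 4 * k * η * d ≤ c) {j : ℕ}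
    (hj : 1 ≤ j) (hjn : 8 * k * j ≤ n) :
    ∑ ρ ∈ colorPerms (blueClass σ), ((nearbyFrozen (NAESat.permute G ρ) (frozen σ) j).card : ℝ) ≤
      (colorPerms (blueClass σ)).card *
        (samplingFactor σ * (72 * Real.exp 1 ^ 2 * (k * α * c)) ^ j) := by
  have hn : 0 < n := lt_of_lt_of_le (by positivity) hjn
  have hn' : (0 : ℝ) < n := by exact_mod_cast hn
  have hk' : (0 : ℝ) < k := by exact_mod_cast (show 0 < k by omega)
  have hd' : (0 : ℝ) < d := by exact_mod_cast hd
  have hj' : (0 : ℝ) < j := by exact_mod_cast hj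
  have hjn' : (8 * k * j : ℝ) ≤ n := by exact_mod_cast hjn
  have hp2 : (k : ℝ) * (4 * j / n) ≤ 1 / 2 := by
    rw [← mul_div_assoc, div_le_iff₀ hn']; linarith
  have hp0 : 0 ≤ (k : ℝ) * (4 * j / n) := by positivity
  -- The `j` changed variables have `j * d` edges, and each blue class has at least `n * d / 4`
  -- edges since `η ≤ 1 / 2`; this dictates `p = 4 * j / n`.
  have h1 := sum_card_linkedPairs_le (G := G) (σ := σ) (j := j) (p := 4 * j / n)
    (B := 8 * k * α) (c := c) (by positivity) ?_ (by positivity) hc ?_ ?_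
  · calc _ ≤ ∑ ρ ∈ colorPerms (blueClass σ),
          (9 ^ j * ((linkedPairs (NAESat.permute G ρ) σ j).card : ℝ)) := by
          refine Finset.sum_le_sum fun ρ hρ => ?_
          have := card_nearbyFrozen_le hk hd (h.permute hρ).coloring j
          exact_mod_cast this
      _ ≤ 9 ^ j * ((colorPerms (blueClass σ)).card *
          (samplingFactor σ * ((Real.exp 1 * (8 * k * α)) ^ j * (Real.exp 1 * c) ^ j))) := by
          rw [← Finset.mul_sum]
          exact mul_le_mul_of_nonneg_left h1 (by positivity)
      _ = _ := by
          have : (72 * Real.exp 1 ^ 2 * (k * α * c)) ^ j =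
              9 ^ j * ((Real.exp 1 * (8 * k * α)) ^ j * (Real.exp 1 * c) ^ j) := by
            rw [← mul_pow, ← mul_pow]; congr 1; ring
          rw [this]; ring
  · intro x
    have h2 := h.card_colorClass x
    have h3 : (n * d : ℝ) / 4 ≤ (colorClass (blueClass σ) x).card := by
      have : (0 : ℝ) ≤ n * d := by positivity
      nlinarith
    calc (j * d : ℝ) = 4 * j / n * (n * d / 4) := by field_simp
      _ ≤ _ := mul_le_mul_of_nonneg_left h3 (by positivity)
  -- As `k * p ≤ 1 / 2` and a frozen variable has a red edge, one factor `k * p` is kept and the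
  -- remaining ones are replaced by `1 / 2`. The kept factor gains the `j / n` that turns `α * n`
  -- into `B * j`.
  · have h2 : ∀ v ∈ frozenVars σ, ((k : ℝ) * (4 * j / n)) ^ redDegree σ v ≤
        2 * (k * (4 * j / n)) * (1 / 2) ^ redDegree σ v := by
      intro v hv
      obtain ⟨r, hr⟩ := Nat.exists_eq_add_of_le (one_le_redDegree hv)
      rw [hr, add_comm, pow_succ, pow_succ]
      have := pow_le_pow_left₀ hp0 hp2 r
      nlinarith
    refine (Finset.sum_le_sum h2).trans ?_
    rw [← Finset.mul_sum]
    refine (mul_le_mul_of_nonneg_left h.red (by positivity)).trans (le_of_eq ?_)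
    field_simp
    ring
  · calc ((freeEdges σ).card : ℝ) * (k * (4 * j / n)) ≤ η * (n * d) * (k * (4 * j / n)) :=
        mul_le_mul_of_nonneg_right h.card_freeEdges hp0
      _ = 4 * k * η * d * j := by field_simp
      _ ≤ c * j := mul_le_mul_of_nonneg_right hcη hj'.le

end typical

/-! ### Averaging over the literals -/

section literals
variable {n m d k T : ℕ}

theorem sum_literals_prod (π : (Fin n × Fin d) ≃ (Fin m × Fin k))
    (h : Fin m → (Fin k → Bool) → ℝ) :
    ∑ L : Fin n × Fin d → Bool, ∏ a, h a (fun j => L (π.symm (a, j))) =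
      ∏ a, ∑ u : Fin k → Bool, h a u := by
  rw [Finset.prod_univ_sum, Fintype.piFinset_univ]
  refine Finset.sum_bij' (fun L _ a j => L (π.symm (a, j)))
    (fun u _ e => u (π e).1 (π e).2) ?_ ?_ ?_ ?_ ?_
  · intro _ _; exact Finset.mem_univ _
  · intro _ _; exact Finset.mem_univ _
  · intro L _; funext e; simp
  · intro u _; funext a j; simp
  · intro U _; rfl

/-- The factor of a clause with given literals, zero if the clause is violated. -/
noncomputable def litFactor (lam : ℝ) (ξ : Fin k → Col) (u : Fin k → Bool) : ℝ :=
  if ClauseOK (fun j => (ξ j).flip (u j)) then clauseWeight (fun j => (ξ j).flip (u j)) ^ lam else 0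

theorem litFactor_nonneg (hk : 0 < k) {lam : ℝ} (ξ : Fin k → Col) (u : Fin k → Bool) :
    0 ≤ litFactor lam ξ u := by
  unfold litFactor
  split_ifs
  · exact Real.rpow_nonneg (clauseWeight_nonneg hk _) _
  · exact le_rfl

/-- For a fixed matching, variable factors, edge factors and the empirical measure do not see the
literals. The average over independent literals therefore becomes a product over clauses. -/
theorem exists_contribution_eq (hk : 0 < k) (lam : ℝ) (H : Profile d k) (σ : Config n d)
    (π : (Fin n × Fin d) ≃ (Fin m × Fin k)) :
    ∃ c : ℝ, 0 ≤ c ∧ ∀ L, contribution lam T H σ (π, L) =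
      c * ∏ a, litFactor lam (fun j => σ (π.symm (a, j))) (fun j => L (π.symm (a, j))) := by
  let G₀ : Instance n m d k := (π, fun _ => false)
  refine ⟨if ((∀ e, σ e ∈ OmegaT d k T) ∧ (∀ v, VarOK (atVar σ v))) ∧
      profileDist T (empirical G₀ σ) H ≤ (n : ℝ) ^ (-(1 / 3) : ℝ) then
      (∏ v, varWeight (atVar σ v)) ^ lam * (∏ e, edgeWeight (σ e)) ^ lam else 0, ?_, fun L => ?_⟩
  · split_ifs
    · exact mul_nonneg (Real.rpow_nonneg (Finset.prod_nonneg fun _ _ => varWeight_nonneg _) _)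
        (Real.rpow_nonneg (Finset.prod_nonneg fun _ _ => edgeWeight_nonneg _) _)
    · exact le_rfl
  · have hemp : empirical ((π, L) : Instance n m d k) σ = empirical G₀ σ := rfl
    have hlit : ∀ a, atClauseLit ((π, L) : Instance n m d k) σ a =
        fun j => (σ (π.symm (a, j))).flip (L (π.symm (a, j))) := fun a => rfl
    unfold contribution
    simp only [near, Finset.mem_filter, mem_colorings, hemp, weight, hlit]
    by_cases h1 : ((∀ e, σ e ∈ OmegaT d k T) ∧ (∀ v, VarOK (atVar σ v))) ∧
      profileDist T (empirical G₀ σ) H ≤ (n : ℝ) ^ (-(1 / 3) : ℝ)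
    · rw [if_pos h1]
      by_cases h2 : ∀ a, ClauseOK (fun j => (σ (π.symm (a, j))).flip (L (π.symm (a, j))))
      · rw [if_pos ⟨⟨h1.1.1, h1.1.2, h2⟩, h1.2⟩]
        have h3 : ∏ a, litFactor lam (fun j => σ (π.symm (a, j))) (fun j => L (π.symm (a, j))) =
            (∏ a, clauseWeight (fun j => (σ (π.symm (a, j))).flip (L (π.symm (a, j))))) ^ lam := by
          rw [← Real.finsetProd_rpow _ _ fun a _ => clauseWeight_nonneg hk _]
          exact Finset.prod_congr rfl fun a _ => if_pos (h2 a)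
        rw [h3, Real.mul_rpow (mul_nonneg (Finset.prod_nonneg fun _ _ => varWeight_nonneg _)
          (Finset.prod_nonneg fun _ _ => clauseWeight_nonneg hk _))
          (Finset.prod_nonneg fun _ _ => edgeWeight_nonneg _),
          Real.mul_rpow (Finset.prod_nonneg fun _ _ => varWeight_nonneg _)
          (Finset.prod_nonneg fun _ _ => clauseWeight_nonneg hk _)]
        ring
      · rw [if_neg fun h => h2 h.1.2.2]
        push Not at h2
        obtain ⟨a, ha⟩ := h2
        rw [Finset.prod_eq_zero (Finset.mem_univ a) (if_neg ha), mul_zero]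
    · rw [if_neg h1, if_neg fun h => h1 ⟨⟨h.1.1, h.1.2.1⟩, h.2⟩, zero_mul]

variable {σ : Config n d} {x' : Fin n → Option Bool}

/-- A clause with only blue edges at which `x'` has no free variable and both agrees and
disagrees at least twice with the coloring. -/
def GoodClause (π : (Fin n × Fin d) ≃ (Fin m × Fin k)) (σ : Config n d)
    (x' : Fin n → Option Bool) (a : Fin m) : Prop :=
  (∀ j, ∃ y, σ (π.symm (a, j)) = .b y) ∧ (∀ j, x' (π.symm (a, j)).1 ≠ none) ∧
    2 ≤ (Finset.univ.filter fun j => x' (π.symm (a, j)).1 = (σ (π.symm (a, j))).value).card ∧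
    2 ≤ (Finset.univ.filter fun j => x' (π.symm (a, j)).1 ≠ (σ (π.symm (a, j))).value).card

/-- A compatible clause with only blue edges contains both blue colors, so its weight is one
whatever `lam` is. -/
theorem litFactor_blue (hk : 0 < k) {lam : ℝ} {z : Fin k → Bool} {u : Fin k → Bool} :
    litFactor lam (fun j => Col.b (z j)) u =
      if ClauseOK (fun j => (Col.b (z j)).flip (u j)) then 1 else 0 := by
  unfold litFactor
  split_ifs with h
  · have hred : ¬ ∃ i, ((Col.b (z i)).flip (u i)).IsRed := by
      rintro ⟨i, hi⟩
      rw [isRed_flip] at hi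
      obtain ⟨x, hx⟩ := hi
      cases hx
    have hboth : (∃ i, (Col.b (z i)).flip (u i) = .b false) ∧
        ∃ i, (Col.b (z i)).flip (u i) = .b true := by
      rcases h with ⟨i, x, h1, -⟩ | ⟨-, h2, -⟩
      · exact absurd ⟨i, x, h1⟩ hred
      · constructor
        · by_contra hno
          push Not at hno
          refine h2 ⟨⟨0, hk⟩, true, fun j _ => ?_⟩
          have := hno j
          simp only [Col.flip] at this ⊢
          cases hb : xor (z j) (u j) <;> simp_all
        · by_contra hno
          push Not at hno
          refine h2 ⟨⟨0, hk⟩, false, fun j _ => ?_⟩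
          have := hno j
          simp only [Col.flip] at this ⊢
          cases hb : xor (z j) (u j) <;> simp_all
    rw [clauseWeight, if_neg (not_not.2 h), if_neg hred, if_pos hboth, Real.one_rpow]
  · rfl

theorem clauseOK_of_counts {z : Fin k → Bool}
    (h : ∀ y, 2 ≤ (Finset.univ.filter fun j => z j = y).card) :
    ClauseOK (fun j => Col.b (z j)) := by
  refine Or.inr ⟨?_, ?_, ?_⟩
  · rintro i ⟨x, hx⟩; cases hx
  · rintro ⟨i, x, hall⟩
    obtain ⟨j, hj, hne⟩ := Finset.exists_mem_ne (h (!x)) i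
    have h1 := hall j hne
    simp only [Finset.mem_filter, Finset.mem_univ, true_and] at hj
    simp [hj] at h1
  · rintro i ⟨a, b, hab⟩; cases hab

/-- Let `w` be the values of `x'` at the clause. The literal patterns `w` and its negation make all
literals of `x'` equal. Both are compatible with `σ`, because `x'` agrees and disagrees with it at
least twice; and at most `2 ^ k` patterns are compatible, so removing two of them gains the stated
factor. -/
theorem sum_litFactor_le (hk : 0 < k) {lam : ℝ} {π : (Fin n × Fin d) ≃ (Fin m × Fin k)}
    {a : Fin m} (h : GoodClause π σ x' a) :
    ∑ u : Fin k → Bool, litFactor lam (fun j => σ (π.symm (a, j))) u *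
      (if ∃ y, ∀ j, x' (π.symm (a, j)).1 = some (xor y (u j)) then 0 else 1) ≤
    (1 - 2 / 2 ^ k) * ∑ u : Fin k → Bool, litFactor lam (fun j => σ (π.symm (a, j))) u := by
  obtain ⟨hb, hx, h1, h2⟩ := h
  choose z hz using hb
  have hx' : ∀ j, ∃ w, x' (π.symm (a, j)).1 = some w := fun j => Option.ne_none_iff_exists'.1 (hx j)
  choose w hw using hx'
  have hzw : (fun j => σ (π.symm (a, j))) = fun j => Col.b (z j) := funext hz
  simp only [hz, hw, Col.value, Option.some.injEq] at h1 h2 ⊢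
  simp only [litFactor_blue hk]
  set A := (Finset.univ : Finset (Fin k → Bool)).filter
    fun u => ClauseOK (fun j => (Col.b (z j)).flip (u j)) with hA
  set B := (Finset.univ : Finset (Fin k → Bool)).filter
    fun u => ∃ y, ∀ j, w j = xor y (u j) with hB
  have e1 : ∑ u : Fin k → Bool, (if ClauseOK (fun j => (Col.b (z j)).flip (u j)) then (1 : ℝ) else 0) =
      A.card := by
    rw [hA, Finset.card_filter]; push_cast; rfl
  have e2 : ∑ u : Fin k → Bool, (if ClauseOK (fun j => (Col.b (z j)).flip (u j)) then (1 : ℝ) else 0) *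
      (if ∃ y, ∀ j, w j = xor y (u j) then 0 else 1) = (A \ B).card := by
    have : A \ B = Finset.univ.filter fun u : Fin k → Bool =>
        ClauseOK (fun j => (Col.b (z j)).flip (u j)) ∧ ¬ ∃ y, ∀ j, w j = xor y (u j) := by
      ext u; simp [hA, hB]
    rw [this, Finset.card_filter]; push_cast
    refine Finset.sum_congr rfl fun u _ => ?_
    split_ifs <;> simp_all
  rw [e1, e2]
  have hmem : ∀ y : Bool, (fun j => xor y (w j)) ∈ A ∩ B := by
    intro y
    rw [Finset.mem_inter, hA, hB, Finset.mem_filter, Finset.mem_filter]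
    refine ⟨⟨Finset.mem_univ _, ?_⟩, Finset.mem_univ _, y, fun j => ?_⟩
    · simp only [Col.flip]
      refine clauseOK_of_counts fun y' => ?_
      by_cases hy : y' = y
      · refine h1.trans (Finset.card_le_card fun j hj => ?_)
        simp only [Finset.mem_filter, Finset.mem_univ, true_and] at hj ⊢
        rw [hj, hy]
        cases y <;> cases z j <;> rfl
      · refine h2.trans (Finset.card_le_card fun j hj => ?_)
        simp only [Finset.mem_filter, Finset.mem_univ, true_and] at hj ⊢
        cases y <;> cases y' <;> cases hz' : z j <;> cases hw' : w j <;> simp_all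
    · simp
  have hAB : 2 ≤ (A ∩ B).card := by
    have hne : (fun j => xor false (w j)) ≠ (fun j => xor true (w j)) := by
      intro h
      have := congrFun h ⟨0, hk⟩
      cases hw' : w ⟨0, hk⟩ <;> simp [hw'] at this
    rw [← Finset.card_pair hne]
    refine Finset.card_le_card fun u hu => ?_
    rcases Finset.mem_insert.1 hu with rfl | hu
    · exact hmem false
    · rw [Finset.mem_singleton.1 hu]; exact hmem true
  have h3 : (A \ B).card + (A ∩ B).card = A.card := Finset.card_sdiff_add_card_inter A B
  have h4 : A.card ≤ 2 ^ k := by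
    have := Finset.card_le_univ A
    simpa using this
  have h3' : ((A \ B).card : ℝ) + (A ∩ B).card = A.card := by exact_mod_cast h3
  have h4' : (A.card : ℝ) ≤ 2 ^ k := by exact_mod_cast h4
  have h5 : (2 : ℝ) ≤ (A ∩ B).card := by exact_mod_cast hAB
  have h6 : (2 : ℝ) / 2 ^ k * A.card ≤ 2 := by
    rw [div_mul_eq_mul_div, div_le_iff₀ (by positivity)]
    linarith
  linarith

/-- If all literals at a clause evaluated alike under `x'`, all but one of them would force the last
one to the opposite value, against `FrozenValid`. Keeping only this consequence, and only at good
clauses, makes the average over literals factor over the clauses. -/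
theorem sum_contribution_frozenValid_le (hk : 1 ≤ k) (lam : ℝ) (H : Profile d k)
    (σ : Config n d) (x' : Fin n → Option Bool) :
    ∑ G : Instance n m d k, contribution lam T H σ G * (if FrozenValid G x' then 1 else 0) ≤
      ∑ G : Instance n m d k, contribution lam T H σ G *
        ∏ a, (if GoodClause G.1 σ x' a then 1 - 2 / 2 ^ k else 1 : ℝ) := by
  rw [Fintype.sum_prod_type, Fintype.sum_prod_type]
  refine Finset.sum_le_sum fun π _ => ?_
  obtain ⟨c, hc, hcon⟩ := exists_contribution_eq (T := T) hk lam H σ π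
  simp only [hcon]
  let bad : Fin m → (Fin k → Bool) → Prop := fun a u =>
    GoodClause π σ x' a ∧ ∃ y, ∀ j, x' (π.symm (a, j)).1 = some (xor y (u j))
  have h1 : ∀ L : Fin n × Fin d → Bool, (if FrozenValid ((π, L) : Instance n m d k) x' then (1 : ℝ)
      else 0) ≤ ∏ a, if bad a (fun j => L (π.symm (a, j))) then 0 else 1 := by
    intro L
    split_ifs with hF
    · refine le_of_eq (Finset.prod_eq_one fun a _ => if_neg ?_).symm
      rintro ⟨-, y, hy⟩
      have hall : ∀ e : Fin n × Fin d, (π e).1 = a → x' e.1 = some (xor y (L e)) := by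
        intro e he
        have := hy (π e).2
        simpa [← he] using this
      have h2 := hF.forces (π.symm (a, ⟨0, hk⟩)) (!y) (fun e' _ hc' => by
        rw [hall e' (by simpa using hc')]; simp)
      rw [hall _ (by simp)] at h2
      simp only [Option.some.injEq] at h2
      cases y <;> cases hL : L (π.symm (a, ⟨0, hk⟩)) <;> simp [hL] at h2
    · exact Finset.prod_nonneg fun a _ => by split_ifs <;> norm_num
  have h0 : ∀ L : Fin n × Fin d → Bool, 0 ≤
      ∏ a, litFactor lam (fun j => σ (π.symm (a, j))) (fun j => L (π.symm (a, j))) :=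
    fun L => Finset.prod_nonneg fun a _ => litFactor_nonneg hk _ _
  refine (Finset.sum_le_sum fun L _ => mul_le_mul_of_nonneg_left (h1 L)
    (mul_nonneg hc (h0 L))).trans ?_
  simp only [mul_assoc, ← Finset.prod_mul_distrib]
  rw [← Finset.mul_sum, ← Finset.mul_sum]
  refine mul_le_mul_of_nonneg_left ?_ hc
  rw [sum_literals_prod π fun a u => litFactor lam (fun j => σ (π.symm (a, j))) u *
    if bad a u then 0 else 1]
  rw [sum_literals_prod π fun a u => litFactor lam (fun j => σ (π.symm (a, j))) u *
    if GoodClause π σ x' a then 1 - 2 / 2 ^ k else 1]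
  refine Finset.prod_le_prod (fun a _ => Finset.sum_nonneg fun u _ =>
    mul_nonneg (litFactor_nonneg hk _ _) (by split_ifs <;> norm_num)) fun a _ => ?_
  by_cases hg : GoodClause π σ x' a
  · simp only [bad, hg, true_and, if_true]
    rw [← Finset.sum_mul, mul_comm _ (1 - (2 : ℝ) / 2 ^ k)]
    exact sum_litFactor_le hk hg
  · simp only [bad, hg, false_and, if_false]
    exact le_rfl

end literals

/-! ### Averaging over the matching -/

/-- The probability that all but at most one of `k` independent bits agree. -/
noncomputable def extremeProb (k : ℕ) (s : ℝ) : ℝ :=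
  ((1 - s) ^ k + k * (s * (1 - s) ^ (k - 1))) + (s ^ k + k * ((1 - s) * s ^ (k - 1)))

/-- Both values occur at least twice. -/
def Mixed {k : ℕ} (u : Fin k → Bool) : Prop :=
  2 ≤ (Finset.univ.filter fun j => u j = false).card ∧
    2 ≤ (Finset.univ.filter fun j => u j = true).card

theorem prod_single {k : ℕ} (i : Fin k) (a b : ℝ) :
    ∏ j : Fin k, (if j = i then a else b) = a * b ^ (k - 1) := by
  rw [← Finset.mul_prod_erase _ _ (Finset.mem_univ i), if_pos rfl]
  congr 1
  rw [Finset.prod_congr rfl (g := fun _ => b) fun j hj => if_neg (Finset.ne_of_mem_erase hj),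
    Finset.prod_const, Finset.card_erase_of_mem (Finset.mem_univ i), Finset.card_univ,
    Fintype.card_fin]

theorem eq_single_of_card_le_one {k : ℕ} {u : Fin k → Bool} {b : Bool}
    (h : (Finset.univ.filter fun j => u j = b).card ≤ 1) :
    u = (fun _ => !b) ∨ ∃ i, u = fun j => if j = i then b else !b := by
  rcases Nat.le_one_iff_eq_zero_or_eq_one.1 h with h | h
  · left
    funext j
    rw [Finset.card_eq_zero, Finset.filter_eq_empty_iff] at h
    have := h (Finset.mem_univ j)
    cases b <;> simpa using this
  · right
    obtain ⟨i, hi⟩ := Finset.card_eq_one.1 h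
    refine ⟨i, funext fun j => ?_⟩
    have h1 : u j = b ↔ j = i := by
      have := Finset.ext_iff.1 hi j
      simpa using this
    by_cases hj : j = i
    · rw [if_pos hj, h1.2 hj]
    · rw [if_neg hj]
      have := mt h1.1 hj
      cases b <;> simpa using this

/-- Union bound over the patterns that are not mixed: the two constant ones and those with a single
deviating bit, one for each position and value. -/
theorem one_sub_extremeProb_le {k : ℕ} {s : ℝ} (hs : s ∈ Set.Icc (0 : ℝ) 1) :
    1 - extremeProb k s ≤ ∑ u : Fin k → Bool, (∏ j, if u j then s else 1 - s) *
      (if Mixed u then 1 else 0) := by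
  have hw : ∀ u : Fin k → Bool, 0 ≤ ∏ j, if u j then s else 1 - s := fun u =>
    Finset.prod_nonneg fun j _ => by split_ifs; exacts [hs.1, sub_nonneg.2 hs.2]
  have h1 := sum_bernoulli_one (fun _ : Fin k => s)
  have hpt : ∀ v : Fin k → Bool, ∑ u : Fin k → Bool, (∏ j, if u j then s else 1 - s) *
      (if u = v then 1 else 0) = ∏ j, if v j then s else 1 - s := by
    intro v
    simp
  have hsingle : ∀ (b : Bool), ∑ i : Fin k, ∏ j : Fin k, (if (if j = i then b else !b) then s
      else 1 - s) = k * ((if b then s else 1 - s) * (if b then 1 - s else s) ^ (k - 1)) := by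
    intro b
    have : ∀ i : Fin k, ∏ j : Fin k, (if (if j = i then b else !b) then s else 1 - s) =
        (if b then s else 1 - s) * (if b then 1 - s else s) ^ (k - 1) := by
      intro i
      rw [← prod_single i]
      refine Finset.prod_congr rfl fun j _ => ?_
      by_cases hj : j = i <;> cases b <;> simp [hj]
    rw [Finset.sum_congr rfl fun i _ => this i, Finset.sum_const, Finset.card_univ,
      Fintype.card_fin, nsmul_eq_mul]
  have h2 : ∑ u : Fin k → Bool, (∏ j, if u j then s else 1 - s) *
      ((∑ b : Bool, ((if u = (fun _ => !b) then (1 : ℝ) else 0) +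
        ∑ i, if u = (fun j => if j = i then b else !b) then 1 else 0))) = extremeProb k s := by
    simp_rw [Finset.mul_sum, mul_add, Finset.mul_sum]
    rw [Finset.sum_comm]
    simp_rw [Finset.sum_add_distrib]
    rw [Fintype.sum_bool, Fintype.sum_bool]
    simp_rw [hpt]
    rw [Finset.sum_comm]
    simp_rw [hpt]
    rw [hsingle]
    rw [Finset.sum_comm]
    simp_rw [hpt]
    rw [hsingle]
    simp [extremeProb]
    ring
  have h3 : 1 - extremeProb k s = (∑ u : Fin k → Bool, ∏ j, if u j then s else 1 - s) -
      ∑ u : Fin k → Bool, (∏ j, if u j then s else 1 - s) *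
      ((∑ b : Bool, ((if u = (fun _ => !b) then (1 : ℝ) else 0) +
        ∑ i, if u = (fun j => if j = i then b else !b) then 1 else 0))) := by rw [h1, h2]
  rw [h3, ← Finset.sum_sub_distrib]
  refine Finset.sum_le_sum fun u _ => ?_
  rw [← mul_one_sub]
  refine mul_le_mul_of_nonneg_left ?_ (hw u)
  have hnn : ∀ b ∈ (Finset.univ : Finset Bool), (0 : ℝ) ≤
      (if u = (fun _ => !b) then (1 : ℝ) else 0) +
        ∑ i, if u = (fun j => if j = i then b else !b) then 1 else 0 := fun b _ =>
    add_nonneg (by split_ifs <;> norm_num) (Finset.sum_nonneg fun i _ => by split_ifs <;> norm_num)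
  split_ifs with hm
  · have := Finset.sum_nonneg hnn
    linarith
  · have : ∃ b, (Finset.univ.filter fun j => u j = b).card ≤ 1 := by
      by_contra hno
      push Not at hno
      exact hm ⟨hno false, hno true⟩
    obtain ⟨b, hb⟩ := this
    have hge : (1 : ℝ) ≤ (if u = (fun _ => !b) then (1 : ℝ) else 0) +
        ∑ i, if u = (fun j => if j = i then b else !b) then 1 else 0 := by
      rcases eq_single_of_card_le_one hb with h | ⟨i, h⟩
      · rw [if_pos h]
        have : (0 : ℝ) ≤ ∑ i, if u = (fun j => if j = i then b else !b) then 1 else 0 :=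
          Finset.sum_nonneg fun i _ => by split_ifs <;> norm_num
        linarith
      · have h3 : (1 : ℝ) ≤ ∑ i, if u = (fun j => if j = i then b else !b) then 1 else 0 := by
          refine le_trans ?_ (Finset.single_le_sum (fun i _ => ?_) (Finset.mem_univ i))
          · rw [if_pos h]
          · split_ifs <;> norm_num
        have : (0 : ℝ) ≤ if u = (fun _ => !b) then (1 : ℝ) else 0 := by split_ifs <;> norm_num
        linarith
    have := hge.trans (Finset.single_le_sum hnn (Finset.mem_univ b))
    linarith

/-- Given the pattern `y` the bits have parameters `q (y j)`; averaging over uniform `y` first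
leaves independent bits with the mean parameter. Hence only the mean of the two blue densities
matters. -/
theorem sum_sum_bernoulli {k : ℕ} (q : Bool → ℝ) (Φ : (Fin k → Bool) → ℝ) :
    ∑ y : Fin k → Bool, ∑ u : Fin k → Bool, (∏ j, if u j then q (y j) else 1 - q (y j)) * Φ u =
      2 ^ k * ∑ u : Fin k → Bool,
        (∏ j, if u j then (q true + q false) / 2 else 1 - (q true + q false) / 2) * Φ u := by
  rw [Finset.sum_comm, Finset.mul_sum]
  refine Finset.sum_congr rfl fun u _ => ?_
  rw [← Finset.sum_mul, sum_bool_prod fun j b => if u j then q b else 1 - q b, ← mul_assoc]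
  congr 1
  have : (2 : ℝ) ^ k = ∏ _j : Fin k, 2 := by simp
  rw [this, ← Finset.prod_mul_distrib]
  refine Finset.prod_congr rfl fun j _ => ?_
  split_ifs <;> ring

section mid
variable {n m d k T : ℕ} {G : Instance n m d k} {σ : Config n d} {η α : ℝ}
  {x' : Fin n → Option Bool}

/-- The variables frozen in `x` and in `x'`, to different values. -/
noncomputable def flippedVars (x x' : Fin n → Option Bool) : Finset (Fin n) :=
  Finset.univ.filter fun v => x v ≠ none ∧ x' v ≠ none ∧ x' v ≠ x v

/-- The density of the edges at `S` among the edges of color `b x`. -/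
noncomputable def blueDensity (σ : Config n d) (S : Finset (Fin n)) (x : Bool) : ℝ :=
  (colorClass (blueClass σ) x ∩ blueEdges σ S).card / (colorClass (blueClass σ) x).card

theorem blueDensity_mem (σ : Config n d) (S : Finset (Fin n)) (x : Bool) :
    blueDensity σ S x ∈ Set.Icc (0 : ℝ) 1 := by
  refine ⟨by unfold blueDensity; positivity, div_le_one_of_le₀ ?_ (by positivity)⟩
  exact_mod_cast Finset.card_le_card Finset.inter_subset_left

/-- A blue clause is good unless it contains a free variable of `x'` or its set of flipped edges is
not mixed. At most `b` clauses contain a free variable, and forgoing the gain there costs at most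
`exp (2 * θ)` each. Mixedness is estimated under independent sampling, where the sum over blue
patterns yields at least `m * (1 - η) * (1 - extremeProb k s)`. -/
theorem Typical.sum_goodClause_le (h : Typical T η α G σ) {θ : ℝ} (hθ0 : 0 ≤ θ) (hθ : θ ≤ 1 / 2)
    {b : ℕ} (hb : (Finset.univ.filter fun e : Fin n × Fin d => x' e.1 = none).card ≤ b) (hη : η ≤ 1)
    {s : ℝ} (hs : s = (blueDensity σ (flippedVars (frozen σ) x') true +
      blueDensity σ (flippedVars (frozen σ) x') false) / 2) :
    ∑ ρ ∈ colorPerms (blueClass σ),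
      ∏ a, (if GoodClause (NAESat.permute G ρ).1 σ x' a then 1 - θ else 1 : ℝ) ≤
      (colorPerms (blueClass σ)).card * (samplingFactor σ * Real.exp (2 * θ * b -
        θ * m * (1 - η) * (1 - extremeProb k s))) := by
  set S := flippedVars (frozen σ) x' with hS
  set D := blueEdges σ S with hD
  let g : Fin m → (Fin k → Bool) → ℝ := fun a u =>
    if BlueClause G σ a ∧ Mixed u then 1 - θ else 1
  have hg0 : ∀ a u, 0 ≤ g a u := by
    intro a u; simp only [g]; split_ifs <;> linarith
  have hg1 : ∀ a u, 1 - θ ≤ g a u := by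
    intro a u; simp only [g]; split_ifs <;> linarith
  let F : Finset (Fin n × Fin d) → ℝ := fun U =>
    ∏ a, g a (fun j => decide (G.1.symm (a, j) ∈ U))
  have hF0 : ∀ U, 0 ≤ F U := fun U => Finset.prod_nonneg fun a _ => hg0 a _
  have hinv : (1 : ℝ) ≤ (1 - θ)⁻¹ := (one_le_inv₀ (by linarith)).2 (by linarith)
  have hmem : ∀ (ρ : Equiv.Perm (Fin n × Fin d)) (e : Fin n × Fin d),
      e ∈ D.image ρ ↔ ρ.symm e ∈ D := by
    intro ρ e
    rw [Finset.mem_image]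
    exact ⟨by rintro ⟨e', he', rfl⟩; simpa using he', fun he => ⟨_, he, by simp⟩⟩
  have hterm : ∀ ρ ∈ colorPerms (blueClass σ),
      ∏ a, (if GoodClause (NAESat.permute G ρ).1 σ x' a then 1 - θ else 1 : ℝ) ≤
        Real.exp (2 * θ * b) * F (D.image ρ) := by
    intro ρ hρ
    let π' := (NAESat.permute G ρ).1
    have hπ' : ∀ s, π'.symm s = ρ.symm (G.1.symm s) := fun s => rfl
    let hh : Fin m → ℝ := fun a => if ∃ j, x' (π'.symm (a, j)).1 = none then (1 - θ)⁻¹ else 1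
    have hh1 : ∀ a, 1 ≤ hh a := by
      intro a; simp only [hh]; split_ifs
      · exact hinv
      · exact le_rfl
    have hpt : ∀ a, (if GoodClause π' σ x' a then 1 - θ else 1 : ℝ) ≤
        hh a * g a (fun j => decide (G.1.symm (a, j) ∈ D.image ρ)) := by
      intro a
      split_ifs with hgood
      · exact (hg1 a _).trans (le_mul_of_one_le_left (hg0 a _) (hh1 a))
      by_cases hbm : BlueClause G σ a ∧ Mixed (fun j => decide (G.1.symm (a, j) ∈ D.image ρ))
      swap
      · have : g a (fun j => decide (G.1.symm (a, j) ∈ D.image ρ)) = 1 := if_neg hbm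
        rw [this, mul_one]; exact hh1 a
      have hg2 : g a (fun j => decide (G.1.symm (a, j) ∈ D.image ρ)) = 1 - θ := if_pos hbm
      rw [hg2]
      by_cases hfree : ∃ j, x' (π'.symm (a, j)).1 = none
      · have : hh a = (1 - θ)⁻¹ := if_pos hfree
        rw [this, inv_mul_cancel₀ (by linarith)]
      exfalso
      apply hgood
      push Not at hfree
      have hblue : ∀ j, ∃ y, σ (π'.symm (a, j)) = .b y := by
        intro j
        obtain ⟨y, hy⟩ := hbm.1 j
        refine ⟨y, ?_⟩
        rw [hπ', color_perm_symm hρ]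
        exact hy
      have hiff : ∀ j, G.1.symm (a, j) ∈ D.image ρ ↔
          x' (π'.symm (a, j)).1 ≠ (σ (π'.symm (a, j))).value := by
        intro j
        rw [hmem, ← hπ', hD, blueEdges, Finset.mem_filter, hS, flippedVars, Finset.mem_filter,
          colorings_value h.coloring]
        obtain ⟨y, hy⟩ := hblue j
        simp only [Finset.mem_univ, true_and, hy, Col.value]
        have := hfree j
        simp [this]
      refine ⟨hblue, hfree, hbm.2.1.trans (Finset.card_le_card fun j hj => ?_),
        hbm.2.2.trans (Finset.card_le_card fun j hj => ?_)⟩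
      · simp only [Finset.mem_filter, Finset.mem_univ, true_and, decide_eq_false_iff_not] at hj ⊢
        rw [hiff] at hj
        exact not_not.1 hj
      · simp only [Finset.mem_filter, Finset.mem_univ, true_and, decide_eq_true_eq] at hj ⊢
        exact (hiff j).1 hj
    refine (Finset.prod_le_prod (fun a _ => by split_ifs <;> linarith) fun a _ => hpt a).trans ?_
    rw [Finset.prod_mul_distrib]
    refine mul_le_mul_of_nonneg_right ?_ (hF0 _)
    have hcard : (Finset.univ.filter fun a => ∃ j, x' (π'.symm (a, j)).1 = none).card ≤ b := by
      refine le_trans ?_ hb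
      have : (Finset.univ.filter fun a => ∃ j, x' (π'.symm (a, j)).1 = none) ⊆
          (Finset.univ.filter fun e : Fin n × Fin d => x' e.1 = none).image fun e => (π' e).1 := by
        intro a ha
        simp only [Finset.mem_filter, Finset.mem_univ, true_and] at ha
        obtain ⟨j, hj⟩ := ha
        exact Finset.mem_image.2 ⟨π'.symm (a, j), by simpa using hj, by simp⟩
      exact (Finset.card_le_card this).trans Finset.card_image_le
    simp only [hh]
    rw [Finset.prod_ite, Finset.prod_const, Finset.prod_const_one, mul_one]
    have hle : (1 - θ)⁻¹ ≤ Real.exp (2 * θ) := by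
      refine le_trans ?_ (Real.add_one_le_exp _)
      rw [inv_le_iff_one_le_mul₀ (by linarith)]
      nlinarith
    calc _ ≤ (1 - θ)⁻¹ ^ b := pow_le_pow_right₀ hinv hcard
      _ ≤ Real.exp (2 * θ) ^ b := pow_le_pow_left₀ (by linarith) hle b
      _ = _ := by rw [← Real.exp_nat_mul]; ring_nf
  have h1 := sum_colorPerms_le (κ := blueClass σ) (blueEdges_subset S) F hF0
  let q : Bool → ℝ := blueDensity σ S
  let p : (Fin k → Bool) → ℝ := fun y =>
    ∑ u : Fin k → Bool, (∏ j, if u j then q (y j) else 1 - q (y j)) * (if Mixed u then 1 else 0)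
  have hp0 : ∀ y, 0 ≤ p y := fun y => Finset.sum_nonneg fun u _ =>
    mul_nonneg (Finset.prod_nonneg fun j _ => by
      split_ifs; exacts [(blueDensity_mem _ _ _).1, sub_nonneg.2 (blueDensity_mem _ _ _).2])
      (by split_ifs <;> norm_num)
  have h2 : ∑ U : Finset (Fin n × Fin d), bernoulliWeight (density (blueClass σ) D) U * F U ≤
      Real.exp (-(θ * m * (1 - η) * (1 - extremeProb k s))) := by
    simp only [F]
    rw [sum_bernoulli_prod G.1 (density (blueClass σ) D) g]
    have h3 : ∀ a, (∑ u : Fin k → Bool, (∏ j, if u j then density (blueClass σ) D (G.1.symm (a, j))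
        else 1 - density (blueClass σ) D (G.1.symm (a, j))) * g a u) ≤
        Real.exp (-θ * if BlueClause G σ a then p (pattern G σ a) else 0) := by
      intro a
      by_cases hb' : BlueClause G σ a
      · rw [if_pos hb']
        have hd : ∀ j, density (blueClass σ) D (G.1.symm (a, j)) = q (pattern G σ a j) := by
          intro j
          have h4 : G.1.symm (a, j) ∈ colorClass (blueClass σ) (pattern G σ a j) :=
            mem_colorClass.2 (hb'.atClause_eq j)
          rw [density_of_mem h4]
          rfl
        simp only [hd]
        have h5 : ∀ u, g a u = 1 - θ * (if Mixed u then 1 else 0) := by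
          intro u
          simp only [g, hb', true_and]
          split_ifs <;> ring
        simp only [h5]
        have h6 := sum_bernoulli_one fun j => q (pattern G σ a j)
        have h7 : ∑ u : Fin k → Bool, (∏ j, if u j then q (pattern G σ a j) else
            1 - q (pattern G σ a j)) * (1 - θ * (if Mixed u then 1 else 0)) =
            1 - θ * p (pattern G σ a) := by
          simp only [p]
          simp only [mul_one_sub, Finset.sum_sub_distrib, h6, Finset.mul_sum]
          congr 1
          exact Finset.sum_congr rfl fun u _ => by ring
        rw [h7]
        have := Real.add_one_le_exp (-θ * p (pattern G σ a))
        linarith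
      · rw [if_neg hb', mul_zero, Real.exp_zero]
        have h5 : ∀ u, g a u = 1 := fun u => if_neg fun h => hb' h.1
        simp only [h5, mul_one]
        exact (sum_bernoulli_one _).le
    refine (Finset.prod_le_prod (fun a _ => Finset.sum_nonneg fun u _ => mul_nonneg
      (Finset.prod_nonneg fun j _ => ?_) (hg0 a u)) fun a _ => h3 a).trans ?_
    · split_ifs
      · exact (density_mem _).1
      · exact sub_nonneg.2 (density_mem _).2
    rw [← Real.exp_sum, ← Finset.mul_sum, Real.exp_le_exp]
    have h4 := h.sum_le p hp0
    have h5 : ∑ y, p y = 2 ^ k * ∑ u : Fin k → Bool,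
        (∏ j, if u j then s else 1 - s) * (if Mixed u then 1 else 0) := by
      rw [hs]
      exact sum_sum_bernoulli q fun u => if Mixed u then 1 else 0
    have hsI : s ∈ Set.Icc (0 : ℝ) 1 := by
      have e1 := blueDensity_mem σ S true
      have e2 := blueDensity_mem σ S false
      rw [hs]
      constructor
      · linarith [e1.1, e2.1]
      · linarith [e1.2, e2.2]
    have h6 := one_sub_extremeProb_le (k := k) hsI
    rw [h5] at h4
    have h7 : (m : ℝ) * (1 - η) * (1 - extremeProb k s) ≤
        ∑ a, if BlueClause G σ a then p (pattern G σ a) else 0 := by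
      refine le_trans ?_ h4
      have : (m : ℝ) / 2 ^ k * (1 - η) * (2 ^ k * ∑ u : Fin k → Bool,
          (∏ j, if u j then s else 1 - s) * (if Mixed u then 1 else 0)) =
          m * (1 - η) * ∑ u : Fin k → Bool,
          (∏ j, if u j then s else 1 - s) * (if Mixed u then 1 else 0) := by
        field_simp
      rw [this]
      exact mul_le_mul_of_nonneg_left h6 (mul_nonneg (Nat.cast_nonneg _) (by linarith))
    nlinarith
  calc _ ≤ ∑ ρ ∈ colorPerms (blueClass σ), Real.exp (2 * θ * b) * F (D.image ρ) :=
        Finset.sum_le_sum hterm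
    _ = Real.exp (2 * θ * b) * ∑ ρ ∈ colorPerms (blueClass σ), F (D.image ρ) := by
        rw [Finset.mul_sum]
    _ ≤ Real.exp (2 * θ * b) * ((colorPerms (blueClass σ)).card * (samplingFactor σ *
        Real.exp (-(θ * m * (1 - η) * (1 - extremeProb k s))))) := by
        refine mul_le_mul_of_nonneg_left (h1.trans ?_) (Real.exp_nonneg _)
        exact mul_le_mul_of_nonneg_left (mul_le_mul_of_nonneg_left h2 samplingFactor_nonneg)
          (Nat.cast_nonneg _)
    _ = _ := by
        have : ∀ A B : ℝ, Real.exp (A - B) = Real.exp A * Real.exp (-B) := fun A B => by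
          rw [← Real.exp_add, sub_eq_add_neg]
        rw [this]; ring

/-- If the two blue classes had equal size and contained all edges, the mean of their densities
would be exactly `S.card / n`. Each class has between `1 - η` and `1 + η` times `n * d / 2` edges,
and at most `η * n * d` edges are not blue. -/
theorem Typical.blueDensity_close (h : Typical T η α G σ) (hn : 0 < n) (hd : 0 < d)
    (hη0 : 0 ≤ η) (hη : η ≤ 1 / 2) (S : Finset (Fin n)) :
    |(blueDensity σ S true + blueDensity σ S false) / 2 - S.card / n| ≤ 2 * η := by
  have hn' : (0 : ℝ) < n := by exact_mod_cast hn
  have hd' : (0 : ℝ) < d := by exact_mod_cast hd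
  have hnd : (0 : ℝ) < n * d := by positivity
  set N := fun x => (colorClass (blueClass σ) x).card with hN
  set M := fun x => (colorClass (blueClass σ) x ∩ blueEdges σ S).card with hM
  have hdis : Disjoint (colorClass (blueClass σ) true) (colorClass (blueClass σ) false) := by
    rw [Finset.disjoint_left]
    intro e h1 h2
    rw [mem_colorClass] at h1 h2
    rw [h1] at h2; cases h2
  have hNle : N true + N false ≤ n * d := by
    have := Finset.card_le_univ (colorClass (blueClass σ) true ∪ colorClass (blueClass σ) false)
    rw [Finset.card_union_of_disjoint hdis] at this
    simpa [hN] using this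
  have hMsum : M true + M false = (blueEdges σ S).card := by
    rw [hM]
    simp only
    rw [← Finset.card_union_of_disjoint (hdis.mono Finset.inter_subset_left
      Finset.inter_subset_left), ← Finset.union_inter_distrib_right, Finset.union_comm,
      Finset.inter_eq_right.2 (blueEdges_subset S)]
  have hMle : (blueEdges σ S).card ≤ S.card * d := by
    have : (blueEdges σ S).card ≤ (S ×ˢ (Finset.univ : Finset (Fin d))).card := by
      refine Finset.card_le_card fun e he => ?_
      simp only [blueEdges, Finset.mem_filter, Finset.mem_univ, true_and] at he
      simp [he.1]
    simpa using this
  have hMge : S.card * d ≤ (blueEdges σ S).card +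
      (Finset.univ.filter fun e => ∀ y, σ e ≠ .b y).card := by
    have : (S ×ˢ (Finset.univ : Finset (Fin d))).card ≤ (blueEdges σ S ∪
        Finset.univ.filter fun e => ∀ y, σ e ≠ .b y).card := by
      refine Finset.card_le_card fun e he => ?_
      rw [Finset.mem_union]
      by_cases hb : ∃ y, σ e = .b y
      · left
        simp only [Finset.mem_product, Finset.mem_univ, and_true] at he
        exact Finset.mem_filter.2 ⟨Finset.mem_univ _, he, hb⟩
      · right
        push Not at hb
        exact Finset.mem_filter.2 ⟨Finset.mem_univ _, hb⟩
    have h2 := this.trans (Finset.card_union_le _ _)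
    rwa [Finset.card_product, Finset.card_univ, Fintype.card_fin] at h2
  have hnb := h.card_nonblue
  have hNt : (n * d : ℝ) / 2 * (1 - η) ≤ N true := h.card_colorClass true
  have hNf : (n * d : ℝ) / 2 * (1 - η) ≤ N false := h.card_colorClass false
  have hNle' : (N true : ℝ) + N false ≤ n * d := by exact_mod_cast hNle
  have hMsum' : (M true : ℝ) + M false = (blueEdges σ S).card := by exact_mod_cast hMsum
  have hMle' : ((blueEdges σ S).card : ℝ) ≤ S.card * d := by exact_mod_cast hMle
  have hMge' : (S.card * d : ℝ) ≤ (blueEdges σ S).card +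
      (Finset.univ.filter fun e => ∀ y, σ e ≠ .b y).card := by exact_mod_cast hMge
  have hlow : 0 < (n * d : ℝ) / 2 * (1 - η) := by
    have : (0 : ℝ) < 1 - η := by linarith
    positivity
  set t : ℝ := S.card / n with ht
  have htS : (S.card : ℝ) = t * n := by rw [ht]; field_simp
  have ht1 : t ≤ 1 := by
    rw [ht]
    refine div_le_one_of_le₀ ?_ hn'.le
    exact_mod_cast (Finset.card_le_univ S).trans (by simp)
  have ht0 : 0 ≤ t := div_nonneg (Nat.cast_nonneg _) (Nat.cast_nonneg _)
  have hup : ∀ x, blueDensity σ S x ≤ M x / ((n * d : ℝ) / 2 * (1 - η)) := by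
    intro x
    refine div_le_div_of_nonneg_left (Nat.cast_nonneg _) hlow ?_
    cases x
    · exact hNf
    · exact hNt
  have hdn : ∀ x, M x / ((n * d : ℝ) / 2 * (1 + η)) ≤ blueDensity σ S x := by
    intro x
    refine div_le_div_of_nonneg_left (Nat.cast_nonneg _) ?_ ?_
    · cases x
      · exact lt_of_lt_of_le hlow hNf
      · exact lt_of_lt_of_le hlow hNt
    · cases x
      · change (N false : ℝ) ≤ _
        linarith
      · change (N true : ℝ) ≤ _
        linarith
  rw [abs_le]
  constructor
  · have e1 : (M true : ℝ) / ((n * d : ℝ) / 2 * (1 + η)) + M false / ((n * d : ℝ) / 2 * (1 + η)) ≥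
        2 * ((t - η) / (1 + η)) := by
      rw [← add_div, hMsum', ge_iff_le, ← mul_div_assoc, div_le_div_iff₀ (by positivity)
        (by positivity)]
      have e2 : (n * d) * (t - η) ≤ ((blueEdges σ S).card : ℝ) := by
        rw [htS] at hMge'; nlinarith
      nlinarith [show (0:ℝ) ≤ 1 + η by linarith]
    have e3 : t - 2 * η ≤ (t - η) / (1 + η) := by
      rw [le_div_iff₀ (by linarith)]; nlinarith
    linarith [hdn true, hdn false]
  · have e1 : (M true : ℝ) / ((n * d : ℝ) / 2 * (1 - η)) + M false / ((n * d : ℝ) / 2 * (1 - η)) ≤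
        2 * (t / (1 - η)) := by
      rw [← add_div, hMsum', ← mul_div_assoc, div_le_div_iff₀ hlow (by linarith)]
      have e2 : ((blueEdges σ S).card : ℝ) ≤ (n * d) * t := by
        rw [htS] at hMle'; nlinarith
      nlinarith [show (0:ℝ) ≤ 1 - η by linarith]
    have e3 : t / (1 - η) ≤ t + 2 * η := by
      rw [div_le_iff₀ (by linarith)]; nlinarith
    linarith [hup true, hup false]

end mid

/-! ### The typical empirical measure -/

theorem Tree.isDot_isHat_neg {d k : ℕ} (t : Tree) :
    (IsDot d k t → IsDot d k t.neg) ∧ (IsHat d k t → IsHat d k t.neg) := by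
  have key : (∀ t, IsDot d k t → IsDot d k t.neg) ∧ (∀ t, IsHat d k t → IsHat d k t.neg) := by
    refine ⟨fun t ht => ?_, fun t ht => ?_⟩
    · refine IsDot.rec (motive_1 := fun t _ => IsDot d k t.neg)
        (motive_2 := fun t _ => IsHat d k t.neg) ?_ ?_ ?_ ht
      · intro ms hc h ih
        rw [neg_var]
        refine IsDot.join _ (by simpa using hc) fun t ht => ?_
        obtain ⟨s, hs, rfl⟩ := Multiset.mem_map.1 ht
        exact ih s hs
      · exact IsHat.box
      · intro x ms hc h hne ih
        rw [neg_cls]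
        refine IsHat.join (!x) _ (by simpa using hc) ?_ ?_
        · intro t ht hb
          obtain ⟨s, hs, rfl⟩ := Multiset.mem_map.1 ht
          exact ih s hs fun h => hb (by rw [h, neg_bit])
        · obtain ⟨s, hs, hsx⟩ := hne
          refine ⟨s.neg, Multiset.mem_map_of_mem _ hs, fun he => ?_⟩
          exact flip_ne_bit (h s hs hsx) true _ he
    · refine IsHat.rec (motive_1 := fun t _ => IsDot d k t.neg)
        (motive_2 := fun t _ => IsHat d k t.neg) ?_ ?_ ?_ ht
      · intro ms hc h ih
        rw [neg_var]
        refine IsDot.join _ (by simpa using hc) fun t ht => ?_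
        obtain ⟨s, hs, rfl⟩ := Multiset.mem_map.1 ht
        exact ih s hs
      · exact IsHat.box
      · intro x ms hc h hne ih
        rw [neg_cls]
        refine IsHat.join (!x) _ (by simpa using hc) ?_ ?_
        · intro t ht hb
          obtain ⟨s, hs, rfl⟩ := Multiset.mem_map.1 ht
          exact ih s hs fun h => hb (by rw [h, neg_bit])
        · obtain ⟨s, hs, hsx⟩ := hne
          refine ⟨s.neg, Multiset.mem_map_of_mem _ hs, fun he => ?_⟩
          exact flip_ne_bit (h s hs hsx) true _ he
  exact ⟨key.1 t, key.2 t⟩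

theorem Col.isColor_flip {d k : ℕ} {s : Col} (h : s.IsColor d k) (l : Bool) :
    (s.flip l).IsColor d k := by
  cases s with
  | r x => trivial
  | b x => trivial
  | f dt ht =>
    cases l
    · exact h
    · exact ⟨(Tree.isDot_isHat_neg dt).1 h.1, (Tree.isDot_isHat_neg ht).2 h.2⟩

theorem Col.flip_flip {d k : ℕ} {s : Col} (h : s.IsColor d k) (l : Bool) :
    (s.flip l).flip l = s := by
  cases s with
  | r x => cases l <;> cases x <;> rfl
  | b x => cases l <;> cases x <;> rfl
  | f dt ht =>
    simp only [Col.flip, Tree.flip_flip (Or.inl h.1), Tree.flip_flip (Or.inr h.2)]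

theorem flip_mem_OmegaT {d k T : ℕ} {s : Col} (h : s ∈ OmegaT d k T) (l : Bool) :
    s.flip l ∈ OmegaT d k T := by
  rw [mem_OmegaT] at h ⊢
  refine ⟨Col.isColor_flip h.1 l, ?_⟩
  cases s with
  | r x => simp [Col.flip, Col.size]
  | b x => simp [Col.flip, Col.size]
  | f dt ht =>
    have := h.2
    simp only [Col.flip, Col.size] at this ⊢
    rwa [Tree.size_flip (Or.inl h.1.1), Tree.size_flip (Or.inr h.1.2)]

theorem sum_piFinset_flip {d k T N : ℕ} (L : Fin N → Bool) (f : (Fin N → Col) → ℝ) :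
    ∑ ξ ∈ Fintype.piFinset fun _ : Fin N => OmegaT d k T, f (fun i => (ξ i).flip (L i)) =
      ∑ ξ ∈ Fintype.piFinset fun _ : Fin N => OmegaT d k T, f ξ := by
  refine Finset.sum_bij' (fun ξ _ i => (ξ i).flip (L i)) (fun ξ _ i => (ξ i).flip (L i)) ?_ ?_ ?_ ?_ ?_
  · intro ξ hξ
    rw [Fintype.mem_piFinset] at hξ ⊢
    exact fun i => flip_mem_OmegaT (hξ i) _
  · intro ξ hξ
    rw [Fintype.mem_piFinset] at hξ ⊢
    exact fun i => flip_mem_OmegaT (hξ i) _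
  · intro ξ hξ
    rw [Fintype.mem_piFinset] at hξ
    exact funext fun i => Col.flip_flip (mem_OmegaT.1 (hξ i)).1 _
  · intro ξ hξ
    rw [Fintype.mem_piFinset] at hξ
    exact funext fun i => Col.flip_flip (mem_OmegaT.1 (hξ i)).1 _
  · intro ξ hξ
    rfl

/-- At a clause without red edges the clause-to-variable messages are functions of the
variable-to-clause ones. Sums over compatible tuples of colors are thereby bounded by sums over
`Spin`s, uniformly in `T`. -/
theorem clauseOK_ext {N : ℕ} {ξ ξ' : Fin N → Col} (h : ClauseOK ξ) (h' : ClauseOK ξ')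
    (hr : ∀ i, ¬ (ξ i).IsRed) (hd : ∀ i, (ξ i).dot = (ξ' i).dot) : ξ = ξ' := by
  have hr' : ∀ i, ¬ (ξ' i).IsRed := by
    rintro i ⟨x, hx⟩
    have := hd i
    rw [hx] at this
    apply hr i
    cases hs : ξ i with
    | r y => exact ⟨y, rfl⟩
    | b y => rw [hs] at this; cases this
    | f a b => rw [hs] at this; cases this
  have hdt : ∀ i, (ξ i).dotTree = (ξ' i).dotTree := by
    intro i
    have := hd i
    revert this
    cases ξ i <;> cases ξ' i <;> simp +contextual [Col.dot, Col.dotTree]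
  rcases h with ⟨i, x, hi, -⟩ | ⟨-, -, h⟩
  · exact absurd ⟨x, hi⟩ (hr i)
  rcases h' with ⟨i, x, hi, -⟩ | ⟨-, -, h'⟩
  · exact absurd ⟨x, hi⟩ (hr' i)
  funext i
  have hi := hd i
  have h1 := h i
  have h2 := h' i
  simp only [hdt] at h1
  cases hs : ξ i with
  | r y => exact absurd ⟨y, hs⟩ (hr i)
  | b y =>
    rw [hs] at hi
    cases hs' : ξ' i with
    | r z => exact absurd ⟨z, hs'⟩ (hr' i)
    | b z => rw [hs'] at hi; cases hi; rfl
    | f a b => rw [hs'] at hi; cases hi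
  | f a b =>
    rw [hs] at hi
    cases hs' : ξ' i with
    | r z => exact absurd ⟨z, hs'⟩ (hr' i)
    | b z => rw [hs'] at hi; cases hi
    | f a' b' =>
      rw [hs'] at hi h2
      rw [hs] at h1
      have e1 := h1 ⟨_, _, rfl⟩
      have e2 := h2 ⟨_, _, rfl⟩
      simp only [Col.hatTree] at e1 e2
      have e3 : a = a' := by injection hi
      rw [e1, e2, e3]

theorem sum_union_le {α : Type*} [DecidableEq α] (A B : Finset α) {f : α → ℝ} (hf : ∀ a, 0 ≤ f a) :
    ∑ a ∈ A ∪ B, f a ≤ ∑ a ∈ A, f a + ∑ a ∈ B, f a := by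
  rw [← Finset.sum_union_inter]
  exact le_add_of_nonneg_right (Finset.sum_nonneg fun a _ => hf a)

-- Consequences of the inequalities of `Gamma` for clause sums.

section gamma
variable {C : ℝ} {d k T : ℕ} {q : Spin → ℝ} {lam : ℝ}

theorem Gamma.dot_flip (h : Gamma C d k T q) (s : Col) (l : Bool) :
    q (s.flip l).dot = q s.dot := by
  cases l
  · cases s <;> simp [Col.flip, Tree.flip]
  · rw [← h.neg_invariant s.dot]
    cases s <;> simp [Col.flip, Col.dot, Spin.neg, Tree.flip]

theorem Gamma.blue_eq (h : Gamma C d k T q) (x : Bool) : q (.b x) = q (.b false) := by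
  cases x
  · rfl
  · exact h.neg_invariant (.b false)

theorem Gamma.red_eq (h : Gamma C d k T q) (x : Bool) : q (.r x) = q (.r false) := by
  cases x
  · rfl
  · exact h.neg_invariant (.r false)

/-- The mass of the free messages. -/
noncomputable def freeMass (d k T : ℕ) (q : Spin → ℝ) : ℝ :=
  ∑ s ∈ (OmegaDotT d k T).filter fun s => ∃ t, s = .f t, q s

theorem Gamma.freeMass_nonneg (h : Gamma C d k T q) : 0 ≤ freeMass d k T q :=
  Finset.sum_nonneg fun s _ => h.nonneg s

theorem Gamma.sum_le (h : Gamma C d k T q) :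
    1 ≤ 2 * q (.r false) + (2 * q (.b false) + freeMass d k T q) := by
  rw [← h.sum_eq_one]
  have : OmegaDotT d k T ⊆ ({.r false, .r true, .b false, .b true} : Finset Spin) ∪
      (OmegaDotT d k T).filter fun s => ∃ t, s = .f t := by
    intro s hs
    rw [Finset.mem_union, Finset.mem_filter]
    rcases s with x | x | t
    · left; cases x <;> simp
    · left; cases x <;> simp
    · right; exact ⟨hs, t, rfl⟩
  refine (Finset.sum_le_sum_of_subset_of_nonneg this fun s _ _ => h.nonneg s).trans ?_
  refine (sum_union_le _ _ h.nonneg).trans ?_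
  · rw [Finset.sum_insert (by simp), Finset.sum_insert (by simp), Finset.sum_insert (by simp),
      Finset.sum_singleton, h.red_eq true, h.blue_eq true]
    unfold freeMass
    linarith

/-- If the blue mass vanished, `upper` would also annihilate the red and the free mass, against
total mass one. -/
theorem Gamma.blue_pos (h : Gamma C d k T q) : 0 < q (.b false) := by
  refine lt_of_le_of_ne (h.nonneg _) fun h0 => ?_
  have h1 := h.upper
  rw [h.red_eq true, h.blue_eq true, ← h0] at h1
  change _ + 2 ^ k * freeMass d k T q ≤ _ at h1
  have h2 := h.freeMass_nonneg
  have h3 := h.nonneg (.r false)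
  have h4 := h.sum_le
  have h5 : (1 : ℝ) ≤ 2 ^ k := one_le_pow₀ (by norm_num)
  nlinarith

theorem Gamma.red_le (h : Gamma C d k T q) : q (.r false) ≤ C * q (.b false) := by
  have h1 := h.upper
  rw [h.red_eq true, h.blue_eq true] at h1
  change _ + 2 ^ k * freeMass d k T q ≤ _ at h1
  have h2 := h.freeMass_nonneg
  have h5 : (0 : ℝ) < 2 ^ k := by positivity
  nlinarith [mul_nonneg h5.le h2]

theorem Gamma.freeMass_le (h : Gamma C d k T q) :
    freeMass d k T q ≤ 2 * q (.b false) * (C / 2 ^ k) := by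
  have h1 := h.upper
  rw [h.red_eq true, h.blue_eq true] at h1
  change _ + 2 ^ k * freeMass d k T q ≤ _ at h1
  have h3 := h.nonneg (.r false)
  have h5 : (0 : ℝ) < 2 ^ k := by positivity
  rw [mul_div_assoc', le_div_iff₀ h5]
  nlinarith

theorem Gamma.const_nonneg (h : Gamma C d k T q) : 0 ≤ C := by
  have h1 := h.red_le
  have h2 := h.blue_pos
  have h3 := h.nonneg (.r false)
  by_contra hC
  push Not at hC
  nlinarith

/-- By `hinj` the sum over colors injects into a sum over their variable-to-clause parts, each blue
or free, and the latter sum factorizes. -/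
theorem Gamma.sum_nonred_le (h : Gamma C d k T q) {N : ℕ} (P : (Fin N → Col) → Prop)
    [DecidablePred P] (hr : ∀ ξ, P ξ → ∀ i, ¬ (ξ i).IsRed)
    (hinj : ∀ ξ ξ', P ξ → P ξ' → (∀ i, (ξ i).dot = (ξ' i).dot) → ξ = ξ') :
    ∑ ξ ∈ (Fintype.piFinset fun _ : Fin N => OmegaT d k T).filter P, ∏ i, q (ξ i).dot ≤
      (2 * q (.b false) + freeMass d k T q) ^ N := by
  set A := (Fintype.piFinset fun _ : Fin N => OmegaT d k T).filter P with hA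
  set B : Finset Spin := {.b false, .b true} ∪ (OmegaDotT d k T).filter fun s => ∃ t, s = .f t
    with hB
  have h1 : ∑ ξ ∈ A, ∏ i, q (ξ i).dot = ∑ s ∈ A.image fun ξ i => (ξ i).dot, ∏ i, q (s i) := by
    rw [Finset.sum_image]
    intro ξ hξ ξ' hξ' he
    exact hinj _ _ (Finset.mem_filter.1 hξ).2 (Finset.mem_filter.1 hξ').2 fun i => congrFun he i
  have h2 : (A.image fun ξ i => (ξ i).dot) ⊆ Fintype.piFinset fun _ : Fin N => B := by
    intro s hs
    obtain ⟨ξ, hξ, rfl⟩ := Finset.mem_image.1 hs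
    obtain ⟨hξ1, hξ2⟩ := Finset.mem_filter.1 hξ
    rw [Fintype.mem_piFinset] at hξ1 ⊢
    intro i
    have h3 := hr ξ hξ2 i
    have h4 : (ξ i).dot ∈ OmegaDotT d k T := Finset.mem_image_of_mem _ (hξ1 i)
    rw [hB, Finset.mem_union, Finset.mem_filter]
    cases hs : ξ i with
    | r y => exact absurd ⟨y, hs⟩ h3
    | b y => left; cases y <;> simp [Col.dot]
    | f a b => right; rw [hs] at h4; exact ⟨h4, a, rfl⟩
  have h5 : ∑ s ∈ B, q s ≤ 2 * q (.b false) + freeMass d k T q := by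
    rw [hB]
    refine (sum_union_le _ _ h.nonneg).trans ?_
    · rw [Finset.sum_insert (by simp), Finset.sum_singleton, h.blue_eq true]
      unfold freeMass
      linarith
  rw [h1]
  refine (Finset.sum_le_sum_of_subset_of_nonneg h2 fun s _ _ =>
    Finset.prod_nonneg fun _ _ => h.nonneg _).trans ?_
  rw [← Finset.prod_univ_sum]
  simp only [Finset.prod_const, Finset.card_univ, Fintype.card_fin]
  exact pow_le_pow_left₀ (Finset.sum_nonneg fun s _ => h.nonneg s) h5 N

theorem Gamma.prod_flip (h : Gamma C d k T q) {N : ℕ} (L : Fin N → Bool) (ξ : Fin N → Col) :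
    ∏ i, q ((ξ i).flip (L i)).dot = ∏ i, q (ξ i).dot :=
  Finset.prod_congr rfl fun i _ => h.dot_flip _ _

/-- Since `q` is invariant under negation, a literal pattern can be absorbed by reindexing the
colors, so all patterns contribute equally. -/
theorem Gamma.sum_avgClause (h : Gamma C d k T q) (N : ℕ) :
    ∑ ξ ∈ Fintype.piFinset fun _ : Fin N => OmegaT d k T, avgClause lam ξ * ∏ i, q (ξ i).dot =
      ∑ ξ ∈ Fintype.piFinset fun _ : Fin N => OmegaT d k T,
        tilt lam (clauseWeight ξ) * ∏ i, q (ξ i).dot := by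
  have h1 : ∀ L : Fin N → Bool, ∑ ξ ∈ Fintype.piFinset fun _ : Fin N => OmegaT d k T,
      tilt lam (clauseWeight fun i => (ξ i).flip (L i)) * ∏ i, q (ξ i).dot =
      ∑ ξ ∈ Fintype.piFinset fun _ : Fin N => OmegaT d k T,
        tilt lam (clauseWeight ξ) * ∏ i, q (ξ i).dot := by
    intro L
    refine Eq.trans ?_ (sum_piFinset_flip L fun ξ => tilt lam (clauseWeight ξ) * ∏ i, q (ξ i).dot)
    exact Finset.sum_congr rfl fun ξ _ => by rw [h.prod_flip]
  simp only [avgClause, div_mul_eq_mul_div, ← Finset.sum_div, Finset.sum_mul]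
  rw [Finset.sum_comm, Finset.sum_congr rfl fun L _ => h1 L, Finset.sum_const, Finset.card_univ,
    nsmul_eq_mul]
  simp

/-- The unnormalized message of a clause to an edge of color `s`, for affirmative literals. -/
noncomputable def clauseMessage (d k T : ℕ) (lam : ℝ) (q : Spin → ℝ) (s : Col) : ℝ :=
  ∑ η ∈ Fintype.piFinset fun _ : Fin (k - 1) => OmegaT d k T,
    tilt lam (clauseWeight (Matrix.vecCons s η)) * ∏ i, q (η i).dot

theorem Gamma.sum_avgClause_vecCons (h : Gamma C d k T q) (s : Col) :
    ∑ η ∈ Fintype.piFinset fun _ : Fin (k - 1) => OmegaT d k T,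
      avgClause lam (Matrix.vecCons s η) * ∏ i, q (η i).dot =
    (clauseMessage d k T lam q (s.flip false) + clauseMessage d k T lam q (s.flip true)) / 2 := by
  have h1 : ∀ L : Fin (k - 1 + 1) → Bool, ∑ η ∈ Fintype.piFinset fun _ : Fin (k - 1) => OmegaT d k T,
      tilt lam (clauseWeight fun i => (Matrix.vecCons s η i).flip (L i)) * ∏ i, q (η i).dot =
      clauseMessage d k T lam q (s.flip (L 0)) := by
    intro L
    refine Eq.trans ?_ (sum_piFinset_flip (fun i => L i.succ) fun η =>
      tilt lam (clauseWeight (Matrix.vecCons (s.flip (L 0)) η)) * ∏ i, q (η i).dot)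
    refine Finset.sum_congr rfl fun η _ => ?_
    rw [h.prod_flip]
    congr 3
    funext i
    refine Fin.cases ?_ (fun j => ?_) i <;> simp
  simp only [avgClause, div_mul_eq_mul_div, ← Finset.sum_div, Finset.sum_mul]
  rw [Finset.sum_comm, Finset.sum_congr rfl fun L _ => h1 L]
  have h2 := (Fin.consEquiv (fun _ : Fin (k - 1 + 1) => Bool)).sum_comp fun L =>
    clauseMessage d k T lam q (s.flip (L 0))
  rw [← h2, Fintype.sum_prod_type]
  simp only [Fin.consEquiv, Equiv.coe_fn_mk, Fin.cons_zero, Finset.sum_const, Finset.card_univ,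
    nsmul_eq_mul]
  rw [Fintype.sum_bool]
  simp only [Fintype.card_pi, Fintype.card_bool, Finset.prod_const, Finset.card_univ,
    Fintype.card_fin, Nat.cast_pow, Nat.cast_ofNat]
  rw [pow_succ]
  field_simp
  ring

end gamma

/-- The colors around a clause that forces its `i`-th edge to `x`. -/
def forcingColors {N : ℕ} (i : Fin N) (x : Bool) : Fin N → Col :=
  fun j => if j = i then .r x else .b (!x)

theorem prod_forcingColors {N : ℕ} (f : Col → ℝ) (i : Fin N) (x : Bool) :
    ∏ j, f (forcingColors i x j) = f (.r x) * f (.b (!x)) ^ (N - 1) := by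
  rw [← prod_single i]
  refine Finset.prod_congr rfl fun j _ => ?_
  unfold forcingColors
  split_ifs <;> rfl

theorem clauseOK_forcingColors {N : ℕ} (i : Fin N) (x : Bool) : ClauseOK (forcingColors i x) :=
  Or.inl ⟨i, x, if_pos rfl, fun _ hj => if_neg hj⟩

theorem tilt_clauseWeight_nonneg {N : ℕ} (hN : 0 < N) (lam : ℝ) (ξ : Fin N → Col) :
    0 ≤ tilt lam (clauseWeight ξ) := tilt_nonneg (clauseWeight_nonneg hN ξ)

theorem avgClause_nonneg {N : ℕ} (hN : 0 < N) (lam : ℝ) (ξ : Fin N → Col) :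
    0 ≤ avgClause lam ξ :=
  div_nonneg (Finset.sum_nonneg fun _ _ => tilt_clauseWeight_nonneg hN lam _) (by positivity)

/-- A compatible clause has weight at most one and is either free of red edges or one of the tuples
`forcingColors i x`. The two kinds are summed by different means. -/
theorem tilt_clauseWeight_le {N : ℕ} (hN : 0 < N) {lam : ℝ} (hl : 0 ≤ lam) (ξ : Fin N → Col) :
    tilt lam (clauseWeight ξ) ≤ (if ClauseOK ξ ∧ ∀ i, ¬ (ξ i).IsRed then 1 else 0) +
      ∑ i, ∑ x : Bool, if ξ = forcingColors i x then 1 else 0 := by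
  have hnn : (0 : ℝ) ≤ ∑ i, ∑ x : Bool, if ξ = forcingColors i x then 1 else 0 :=
    Finset.sum_nonneg fun i _ => Finset.sum_nonneg fun x _ => by split_ifs <;> norm_num
  by_cases h : ClauseOK ξ
  · have h1 := tilt_le_one hl (clauseWeight_nonneg hN ξ) (clauseWeight_le_one ξ)
    refine h1.trans ?_
    rcases h with ⟨i, x, hi, hj⟩ | h2
    · have : ξ = forcingColors i x := by
        funext j
        unfold forcingColors
        split_ifs with hji
        · rw [hji, hi]
        · exact hj j hji
      have h3 : (1 : ℝ) ≤ ∑ i, ∑ x : Bool, if ξ = forcingColors i x then 1 else 0 := by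
        refine le_trans ?_ (Finset.single_le_sum (fun i _ => Finset.sum_nonneg fun x _ => ?_)
          (Finset.mem_univ i))
        · refine le_trans ?_ (Finset.single_le_sum (fun x _ => ?_) (Finset.mem_univ x))
          · rw [if_pos this]
          · split_ifs <;> norm_num
        · split_ifs <;> norm_num
      have h4 : (0 : ℝ) ≤ if ClauseOK ξ ∧ ∀ i, ¬ (ξ i).IsRed then 1 else 0 := by
        split_ifs <;> norm_num
      linarith
    · rw [if_pos ⟨Or.inr h2, h2.1⟩]
      linarith
  · have h1 : clauseWeight ξ = 0 := by rw [clauseWeight, if_pos h]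
    rw [h1, tilt, if_pos rfl]
    exact add_nonneg (by split_ifs <;> norm_num) hnn

theorem forcingColors_mem {d k T N : ℕ} (i : Fin N) (x : Bool) :
    forcingColors i x ∈ Fintype.piFinset fun _ : Fin N => OmegaT d k T := by
  rw [Fintype.mem_piFinset]
  intro j
  unfold forcingColors
  split_ifs
  · exact r_mem_OmegaT x
  · exact b_mem_OmegaT _

/-- A clause whose edges are all blue is compatible with most literals. -/
theorem avgClause_blue_ge {k : ℕ} (hk : 1 ≤ k) (lam : ℝ) (y : Fin k → Bool) :
    1 - 4 * k / 2 ^ k ≤ avgClause lam fun j => Col.b (y j) := by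
  have h1 := one_sub_extremeProb_le (k := k) (s := 1 / 2) ⟨by norm_num, by norm_num⟩
  have h2 : extremeProb k (1 / 2) = (2 + 2 * k) / 2 ^ k := by
    unfold extremeProb
    have : (1 / 2 : ℝ) ^ k = 1 / 2 * (1 / 2) ^ (k - 1) := by
      rw [← pow_succ', Nat.sub_add_cancel hk]
    norm_num
    rw [div_pow] at this
    rw [show (1 / 2 : ℝ) * (1 / 2) ^ (k - 1) = (1 / 2) ^ k by
      rw [← pow_succ', Nat.sub_add_cancel hk]]
    rw [one_div_pow]
    field_simp
    ring
  have h3 : ∑ u : Fin k → Bool, (∏ j : Fin k, if u j then (1 / 2 : ℝ) else 1 - 1 / 2) *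
      (if Mixed u then 1 else 0) ≤ avgClause lam fun j => Col.b (y j) := by
    unfold avgClause
    -- Shifting by `y` turns the literals into the evaluated bits, which are again uniform; mixed
    -- bits give weight one.
    have e : (Function.Involutive fun (u : Fin k → Bool) j => xor (y j) (u j)) := by
      intro u; funext j; simp
    rw [← Equiv.sum_comp (Function.Involutive.toPerm _ e), Finset.sum_div]
    refine Finset.sum_le_sum fun L _ => ?_
    have h4 : ∀ u : Fin k → Bool, (∏ j : Fin k, if u j then (1 / 2 : ℝ) else 1 - 1 / 2) =
        1 / 2 ^ k := by
      intro u
      rw [Finset.prod_congr rfl (g := fun _ => (1 / 2 : ℝ)) fun j _ => by split_ifs <;> norm_num]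
      simp
    rw [h4]
    by_cases hm : Mixed (e.toPerm _ L)
    · rw [if_pos hm, mul_one]
      refine div_le_div_of_nonneg_right ?_ (by positivity)
      have hok : ClauseOK (fun j => (Col.b (y j)).flip (L j)) :=
        clauseOK_of_counts (z := fun j => xor (y j) (L j)) fun b => by
          cases b
          · exact hm.1
          · exact hm.2
      have hex : ∀ b, ∃ j, (Col.b (y j)).flip (L j) = .b b := by
        intro b
        have : 2 ≤ (Finset.univ.filter fun j => e.toPerm _ L j = b).card := by
          cases b
          · exact hm.1
          · exact hm.2
        obtain ⟨j, hj⟩ := Finset.card_pos.1 (lt_of_lt_of_le two_pos this)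
        refine ⟨j, ?_⟩
        have := (Finset.mem_filter.1 hj).2
        simp only [Col.flip, Col.b.injEq]
        exact this
      have hred : ¬ ∃ i, ((Col.b (y i)).flip (L i)).IsRed := by
        rintro ⟨i, x, hx⟩
        cases hx
      rw [clauseWeight, if_neg (not_not.2 hok), if_neg hred, if_pos ⟨hex _, hex _⟩, tilt_one]
    · rw [if_neg hm, mul_zero]
      exact div_nonneg (tilt_clauseWeight_nonneg hk lam _) (by positivity)
  refine le_trans ?_ (h1.trans h3)
  rw [h2]
  have : ((2 : ℝ) + 2 * k) / 2 ^ k ≤ 4 * k / 2 ^ k := by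
    refine div_le_div_of_nonneg_right ?_ (by positivity)
    have : (1 : ℝ) ≤ k := by exact_mod_cast hk
    linarith
  linarith

theorem one_add_pow_le {k : ℕ} {x : ℝ} (hx : 0 ≤ x) (hkx : k * x ≤ 1) :
    (1 + x) ^ k ≤ 1 + 2 * (k * x) := by
  have h1 : (1 + x) ^ k ≤ Real.exp (k * x) := by
    rw [Real.exp_nat_mul]
    exact pow_le_pow_left₀ (by linarith) (by linarith [Real.add_one_le_exp x]) k
  have h2 := Real.abs_exp_sub_one_le (x := k * x) (by rw [abs_of_nonneg (by positivity)]; exact hkx)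
  rw [abs_of_nonneg (show 0 ≤ k * x by positivity)] at h2
  linarith [le_abs_self (Real.exp (k * x) - 1)]

section gamma
variable {C : ℝ} {d k T : ℕ} {q : Spin → ℝ} {lam : ℝ}

theorem Gamma.sum_tilt_clauseWeight_le (h : Gamma C d k T q) (hk : 0 < k) (hl : 0 ≤ lam) :
    ∑ ξ ∈ Fintype.piFinset fun _ : Fin k => OmegaT d k T,
      tilt lam (clauseWeight ξ) * ∏ i, q (ξ i).dot ≤
    2 * k * (q (.r false) * q (.b false) ^ (k - 1)) +
      (2 * q (.b false) + freeMass d k T q) ^ k := by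
  have hp : ∀ ξ : Fin k → Col, 0 ≤ ∏ i, q (ξ i).dot := fun ξ =>
    Finset.prod_nonneg fun i _ => h.nonneg _
  refine (Finset.sum_le_sum fun ξ _ => mul_le_mul_of_nonneg_right
    (tilt_clauseWeight_le hk hl ξ) (hp ξ)).trans ?_
  simp only [add_mul, Finset.sum_add_distrib, ite_mul, one_mul, zero_mul, Finset.sum_mul]
  rw [add_comm]
  refine add_le_add ?_ ?_
  · rw [Finset.sum_comm]
    have : ∀ i : Fin k, ∑ ξ ∈ Fintype.piFinset fun _ : Fin k => OmegaT d k T, ∑ x : Bool,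
        (if ξ = forcingColors i x then ∏ i, q (ξ i).dot else 0) =
        2 * (q (.r false) * q (.b false) ^ (k - 1)) := by
      intro i
      rw [Finset.sum_comm, Fintype.sum_bool]
      simp only [Finset.sum_ite_eq', forcingColors_mem, if_true]
      rw [prod_forcingColors fun s => q s.dot, prod_forcingColors fun s => q s.dot]
      simp only [Col.dot, h.red_eq true, h.blue_eq (!false)]
      simp only [Bool.not_true]
      ring
    rw [Finset.sum_congr rfl fun i _ => this i]
    simp only [Finset.sum_const, Finset.card_univ, Fintype.card_fin, nsmul_eq_mul]
    linarith
  · rw [← Finset.sum_filter]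
    exact h.sum_nonred_le (fun ξ => ClauseOK ξ ∧ ∀ i, ¬ (ξ i).IsRed) (fun ξ hξ => hξ.2) fun ξ ξ' h1 h2 h3 => clauseOK_ext h1.1 h2.1 h1.2 h3

theorem Gamma.clauseMessage_nonneg (h : Gamma C d k T q) (s : Col) :
    0 ≤ clauseMessage d k T lam q s :=
  Finset.sum_nonneg fun η _ => mul_nonneg (tilt_clauseWeight_nonneg (Nat.succ_pos _) _ _)
    (Finset.prod_nonneg fun i _ => h.nonneg _)

/-- Keep the single term in which all other edges are `b (!x)`. -/
theorem Gamma.le_clauseMessage_red (h : Gamma C d k T q) (x : Bool) :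
    q (.b false) ^ (k - 1) ≤ clauseMessage d k T lam q (.r x) := by
  have hmem : (fun _ => Col.b (!x)) ∈ Fintype.piFinset fun _ : Fin (k - 1) => OmegaT d k T := by
    rw [Fintype.mem_piFinset]
    exact fun _ => b_mem_OmegaT _
  refine le_trans ?_ (Finset.single_le_sum (fun _ _ => mul_nonneg
    (tilt_clauseWeight_nonneg (Nat.succ_pos _) _ _)
    (Finset.prod_nonneg fun _ _ => h.nonneg _)) hmem)
  have h1 : Matrix.vecCons (Col.r x) (fun _ : Fin (k - 1) => Col.b (!x)) = forcingColors 0 x := by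
    funext i
    refine Fin.cases ?_ (fun j => ?_) i <;> simp [forcingColors]
  have h2 : clauseWeight (forcingColors (0 : Fin (k - 1 + 1)) x) = 1 := by
    rw [clauseWeight, if_neg (not_not.2 (clauseOK_forcingColors _ _)), if_pos ⟨0, x, by
      simp [forcingColors]⟩]
  rw [h1, h2, tilt_one, one_mul]
  simp [Col.dot, h.blue_eq (!x)]

/-- A clause with an edge `b x` either forces one of its `k - 1` other edges, necessarily to `!x`,
or has no red edge at all. -/
theorem Gamma.clauseMessage_blue_le (h : Gamma C d k T q) (hl : 0 ≤ lam) (x : Bool) :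
    clauseMessage d k T lam q (.b x) ≤
      (k - 1 : ℕ) * (q (.r false) * q (.b false) ^ (k - 1 - 1)) +
        (2 * q (.b false) + freeMass d k T q) ^ (k - 1) := by
  have hp : ∀ η : Fin (k - 1) → Col, 0 ≤ ∏ i, q (η i).dot := fun ξ =>
    Finset.prod_nonneg fun i _ => h.nonneg _
  have hle : ∀ η : Fin (k - 1) → Col, tilt lam (clauseWeight (Matrix.vecCons (.b x) η)) ≤
      (if ClauseOK (Matrix.vecCons (.b x) η) ∧ ∀ i, ¬ (Matrix.vecCons (.b x) η i).IsRed then 1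
        else 0) + ∑ i, if η = forcingColors i (!x) then 1 else 0 := by
    intro η
    refine (tilt_clauseWeight_le (Nat.succ_pos _) hl _).trans (add_le_add le_rfl ?_)
    rw [Fin.sum_univ_succ]
    have h0 : ∀ y, ¬ Matrix.vecCons (Col.b x) η = forcingColors 0 y := by
      intro y he
      have := congrFun he 0
      simp [forcingColors] at this
    simp only [h0, if_false, Finset.sum_const_zero, zero_add]
    refine Finset.sum_le_sum fun i _ => ?_
    have h1 : ∀ y, Matrix.vecCons (Col.b x) η = forcingColors i.succ y →
        y = !x ∧ η = forcingColors i (!x) := by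
      intro y he
      have e0 := congrFun he 0
      have : (0 : Fin (k - 1 + 1)) ≠ i.succ := (Fin.succ_ne_zero i).symm
      simp only [Matrix.cons_val_zero, forcingColors, if_neg this, Col.b.injEq] at e0
      have hy : y = !x := by rw [e0]; simp
      refine ⟨hy, funext fun j => ?_⟩
      have ej := congrFun he j.succ
      simpa [forcingColors, hy] using ej
    by_cases hη : η = forcingColors i (!x)
    · rw [if_pos hη, Fintype.sum_bool]
      cases x
      · have : ¬ Matrix.vecCons (Col.b false) η = forcingColors i.succ false := fun he => by
          have := (h1 _ he).1
          simp at this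
        rw [if_neg this]
        split_ifs <;> norm_num
      · have : ¬ Matrix.vecCons (Col.b true) η = forcingColors i.succ true := fun he => by
          have := (h1 _ he).1
          simp at this
        rw [if_neg this]
        split_ifs <;> norm_num
    · rw [if_neg hη]
      refine (Finset.sum_eq_zero fun y _ => if_neg fun he => hη (h1 y he).2).le
  unfold clauseMessage
  refine (Finset.sum_le_sum fun ξ _ => mul_le_mul_of_nonneg_right (hle ξ) (hp ξ)).trans ?_
  simp only [add_mul, Finset.sum_add_distrib, ite_mul, one_mul, zero_mul, Finset.sum_mul]
  rw [add_comm]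
  refine add_le_add ?_ ?_
  · rw [Finset.sum_comm]
    have hi : ∀ i : Fin (k - 1), ∑ η ∈ Fintype.piFinset fun _ : Fin (k - 1) => OmegaT d k T,
        (if η = forcingColors i (!x) then ∏ i, q (η i).dot else 0) =
        q (.r false) * q (.b false) ^ (k - 1 - 1) := by
      intro i
      rw [Finset.sum_ite_eq', if_pos (forcingColors_mem _ _), prod_forcingColors fun s => q s.dot]
      simp only [Col.dot, h.red_eq (!x), h.blue_eq (!!x)]
    rw [Finset.sum_congr rfl fun i _ => hi i, Finset.sum_const, Finset.card_univ, Fintype.card_fin,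
      nsmul_eq_mul]
  · rw [← Finset.sum_filter]
    refine h.sum_nonred_le (fun η => ClauseOK (Matrix.vecCons (.b x) η) ∧
      ∀ i, ¬ (Matrix.vecCons (.b x) η i).IsRed) (fun ξ hξ i => ?_) fun ξ ξ' h1 h2 h3 => ?_
    · simpa using hξ.2 i.succ
    · have := clauseOK_ext h1.1 h2.1 h1.2 fun i => by
        refine Fin.cases ?_ (fun j => ?_) i
        · rfl
        · simpa using h3 j
      funext i
      simpa using congrFun this i.succ

end gamma

section gamma
variable {C : ℝ} {d k T : ℕ} {q : Spin → ℝ} {lam : ℝ}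

/-- The normalization of `lift`. -/
noncomputable def liftMass (d k T : ℕ) (q : Spin → ℝ) : ℝ := ∑ s ∈ OmegaT d k T, q s.dot

theorem Gamma.liftMass_pos (h : Gamma C d k T q) : 0 < liftMass d k T q :=
  lt_of_lt_of_le h.blue_pos (Finset.single_le_sum (f := fun s : Col => q s.dot)
    (fun _ _ => h.nonneg _) (b_mem_OmegaT false))

theorem lift_of_mem {s : Col} (hs : s ∈ OmegaT d k T) :
    lift d k T q s = q s.dot / liftMass d k T q := by
  rw [lift, normalize, if_pos hs]
  rfl

theorem prod_lift {N : ℕ} {ξ : Fin N → Col}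
    (hξ : ξ ∈ Fintype.piFinset fun _ : Fin N => OmegaT d k T) :
    ∏ i, lift d k T q (ξ i) = (∏ i, q (ξ i).dot) / liftMass d k T q ^ N := by
  rw [Fintype.mem_piFinset] at hξ
  rw [Finset.prod_congr rfl fun i _ => lift_of_mem (hξ i), Finset.prod_div_distrib,
    Finset.prod_const, Finset.card_univ, Fintype.card_fin]

/-- The free mass is at most a fraction `C / 2 ^ k` of the blue mass, and at most `k` such factors
multiply. -/
theorem Gamma.sum_blue_free_pow_le (h : Gamma C d k T q) {N : ℕ} (hN : N ≤ k)
    (hkC : k * (C / 2 ^ k) ≤ 1) :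
    (2 * q (.b false) + freeMass d k T q) ^ N ≤
      (2 * q (.b false)) ^ N * (1 + 2 * (k * (C / 2 ^ k))) := by
  have hC := h.const_nonneg
  have hx : 0 ≤ C / 2 ^ k := by positivity
  have hB := h.blue_pos
  have h1 : 2 * q (.b false) + freeMass d k T q ≤ 2 * q (.b false) * (1 + C / 2 ^ k) := by
    have := h.freeMass_le
    linarith
  have hNk : (N : ℝ) * (C / 2 ^ k) ≤ k * (C / 2 ^ k) :=
    mul_le_mul_of_nonneg_right (by exact_mod_cast hN) hx
  have h0 : 0 ≤ 2 * q (.b false) + freeMass d k T q := by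
    have := h.freeMass_nonneg
    linarith
  refine (pow_le_pow_left₀ h0 h1 N).trans ?_
  rw [mul_pow]
  refine mul_le_mul_of_nonneg_left ?_ (by positivity)
  exact (one_add_pow_le hx (hNk.trans hkC)).trans (by linarith)

/-- The typical fraction of clauses of each blue pattern is close to `2 ^ (-k)`. -/
theorem Gamma.le_hat (h : Gamma C d k T q) (hk : 1 ≤ k) (hl : 0 ≤ lam)
    (hkC : k * (C / 2 ^ k) ≤ 1) (y : Fin k → Bool) :
    1 / 2 ^ k * (1 - 4 * k * (1 + C) / 2 ^ k) ≤ (Hstar d k T lam q).hat fun j => .b (y j) := by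
  have hC := h.const_nonneg
  have hB := h.blue_pos
  have hM := h.liftMass_pos
  have hmem : (fun j => Col.b (y j)) ∈ Fintype.piFinset fun _ : Fin k => OmegaT d k T := by
    rw [Fintype.mem_piFinset]
    exact fun _ => b_mem_OmegaT _
  have hden : ∑ ξ' ∈ Fintype.piFinset fun _ : Fin k => OmegaT d k T,
      avgClause lam ξ' * ∏ i, lift d k T q (ξ' i) =
      (∑ ξ ∈ Fintype.piFinset fun _ : Fin k => OmegaT d k T,
        tilt lam (clauseWeight ξ) * ∏ i, q (ξ i).dot) / liftMass d k T q ^ k := by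
    rw [← h.sum_avgClause, Finset.sum_div]
    exact Finset.sum_congr rfl fun ξ hξ => by rw [prod_lift hξ, mul_div_assoc]
  set D := ∑ ξ ∈ Fintype.piFinset fun _ : Fin k => OmegaT d k T,
        tilt lam (clauseWeight ξ) * ∏ i, q (ξ i).dot with hD
  -- Relative to the all-blue term `(2 * q (.b false)) ^ k`, the forcing clauses and the free colors
  -- each add at most `2 * k * C / 2 ^ k`.
  have hDle : D ≤ (2 * q (.b false)) ^ k * (1 + 4 * k * C / 2 ^ k) := by
    refine (h.sum_tilt_clauseWeight_le hk hl).trans ?_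
    have h1 := h.sum_blue_free_pow_le le_rfl hkC
    have h2 : 2 * k * (q (.r false) * q (.b false) ^ (k - 1)) ≤
        (2 * q (.b false)) ^ k * (2 * k * C / 2 ^ k) := by
      have e : (2 * q (.b false)) ^ k = 2 ^ k * (q (.b false) * q (.b false) ^ (k - 1)) := by
        rw [mul_pow, ← pow_succ', Nat.sub_add_cancel hk]
      rw [e]
      have : 2 ^ k * (q (.b false) * q (.b false) ^ (k - 1)) * (2 * k * C / 2 ^ k) =
          2 * k * (C * q (.b false) * q (.b false) ^ (k - 1)) := by field_simp
      rw [this]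
      refine mul_le_mul_of_nonneg_left (mul_le_mul_of_nonneg_right h.red_le (by positivity))
        (by positivity)
    have e3 : (2 * q (.b false)) ^ k * (1 + 4 * k * C / 2 ^ k) =
      (2 * q (.b false)) ^ k * (2 * k * C / 2 ^ k) +
        (2 * q (.b false)) ^ k * (1 + 2 * (k * (C / 2 ^ k))) := by ring
    rw [e3]
    exact add_le_add h2 h1
  have hav := avgClause_blue_ge hk lam y
  have hav0 := avgClause_nonneg hk lam fun j => Col.b (y j)
  have hnum : ∏ i, q (Col.b (y i)).dot = q (.b false) ^ k := by
    simp only [Col.dot, fun i => h.blue_eq (y i)]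
    simp
  have hDge : avgClause lam (fun j => Col.b (y j)) * q (.b false) ^ k ≤ D := by
    rw [hD, ← h.sum_avgClause, ← hnum]
    exact Finset.single_le_sum (f := fun ξ : Fin k → Col => avgClause lam ξ * ∏ i, q (ξ i).dot)
      (fun ξ _ => mul_nonneg (avgClause_nonneg hk lam ξ)
      (Finset.prod_nonneg fun i _ => h.nonneg _)) hmem
  have hval : (Hstar d k T lam q).hat (fun j => .b (y j)) =
      avgClause lam (fun j => Col.b (y j)) * q (.b false) ^ k / D := by
    simp only [Hstar]
    rw [hden, prod_lift hmem, hnum, ← mul_div_assoc, div_div_div_cancel_right₀ (by positivity)]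
  rw [hval]
  have hx : (0 : ℝ) ≤ 4 * k * C / 2 ^ k := by positivity
  have hx' : (0 : ℝ) ≤ 4 * k / 2 ^ k := by positivity
  have esplit : 4 * (k : ℝ) * (1 + C) / 2 ^ k = 4 * k / 2 ^ k + 4 * k * C / 2 ^ k := by ring
  rw [esplit]
  by_cases hneg : 1 - 4 * (k : ℝ) / 2 ^ k ≤ 0
  · refine le_trans ?_ (div_nonneg (by positivity) ((by positivity : (0:ℝ) ≤
      avgClause lam (fun j => Col.b (y j)) * q (.b false) ^ k).trans hDge))
    refine mul_nonpos_of_nonneg_of_nonpos (by positivity) (by linarith)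
  push Not at hneg
  have hDpos : 0 < D := lt_of_lt_of_le (mul_pos (lt_of_lt_of_le hneg hav) (by positivity)) hDge
  rw [le_div_iff₀ hDpos]
  by_cases hneg' : 1 - (4 * (k : ℝ) / 2 ^ k + 4 * k * C / 2 ^ k) ≤ 0
  · exact (mul_nonpos_of_nonpos_of_nonneg (mul_nonpos_of_nonneg_of_nonpos (by positivity) hneg')
      hDpos.le).trans (by positivity)
  push Not at hneg'
  calc _ ≤ 1 / 2 ^ k * (1 - (4 * (k : ℝ) / 2 ^ k + 4 * k * C / 2 ^ k)) *
        ((2 * q (.b false)) ^ k * (1 + 4 * k * C / 2 ^ k)) :=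
        mul_le_mul_of_nonneg_left hDle (by positivity)
    _ = (1 - (4 * (k : ℝ) / 2 ^ k + 4 * k * C / 2 ^ k)) * (1 + 4 * k * C / 2 ^ k) *
        q (.b false) ^ k := by rw [mul_pow]; field_simp
    _ ≤ (1 - 4 * (k : ℝ) / 2 ^ k) * q (.b false) ^ k := by
        refine mul_le_mul_of_nonneg_right ?_ (by positivity)
        nlinarith
    _ ≤ _ := mul_le_mul_of_nonneg_right hav (by positivity)

theorem Gamma.lift_nonneg (h : Gamma C d k T q) (s : Col) : 0 ≤ lift d k T q s := by
  unfold lift normalize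
  refine div_nonneg ?_ (Finset.sum_nonneg fun s _ => h.nonneg _)
  split_ifs
  · exact h.nonneg _
  · exact le_rfl

theorem Gamma.clauseBP_nonneg (h : Gamma C d k T q) (s : Col) :
    0 ≤ clauseBP d k T lam (lift d k T q) s := by
  have h1 : ∀ s, 0 ≤ edgeWeight s ^ lam *
      ∑ η ∈ Fintype.piFinset fun _ : Fin (k - 1) => OmegaT d k T,
        avgClause lam (Matrix.vecCons s η) * ∏ i, lift d k T q (η i) := fun s =>
    mul_nonneg (Real.rpow_nonneg (edgeWeight_nonneg s) _) (Finset.sum_nonneg fun η _ =>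
      mul_nonneg (avgClause_nonneg (Nat.succ_pos _) _ _)
        (Finset.prod_nonneg fun i _ => h.lift_nonneg _))
  unfold clauseBP normalize
  refine div_nonneg ?_ (Finset.sum_nonneg fun s _ => h1 s)
  split_ifs
  · exact h1 s
  · exact le_rfl

/-- Only ratios of messages are needed. On colors of edge weight one all normalizations merge into
one constant, independent of the color. -/
theorem Gamma.exists_clauseBP_eq (h : Gamma C d k T q) : ∃ c : ℝ, 0 < c ∧
    ∀ s : Col, s ∈ OmegaT d k T → edgeWeight s = 1 → clauseBP d k T lam (lift d k T q) s =
      c * (clauseMessage d k T lam q (s.flip false) + clauseMessage d k T lam q (s.flip true)) := by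
  have hM := h.liftMass_pos
  have hB := h.blue_pos
  set g : Col → ℝ := fun s => edgeWeight s ^ lam *
    ∑ η ∈ Fintype.piFinset fun _ : Fin (k - 1) => OmegaT d k T,
      avgClause lam (Matrix.vecCons s η) * ∏ i, lift d k T q (η i) with hg
  have h1 : ∀ s, g s = edgeWeight s ^ lam * ((clauseMessage d k T lam q (s.flip false) +
      clauseMessage d k T lam q (s.flip true)) / 2 / liftMass d k T q ^ (k - 1)) := by
    intro s
    rw [← h.sum_avgClause_vecCons, Finset.sum_div]
    simp only [hg]
    congr 1
    exact Finset.sum_congr rfl fun ξ hξ => by rw [prod_lift hξ, mul_div_assoc]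
  have hg0 : ∀ s, 0 ≤ g s := fun s => by
    rw [h1]
    have e1 := h.clauseMessage_nonneg (lam := lam) (s.flip false)
    have e2 := h.clauseMessage_nonneg (lam := lam) (s.flip true)
    have e3 := Real.rpow_nonneg (edgeWeight_nonneg s) lam
    positivity
  have hpos : 0 < ∑ s ∈ OmegaT d k T, g s := by
    refine lt_of_lt_of_le ?_ (Finset.single_le_sum (fun s _ => hg0 s) (r_mem_OmegaT false))
    rw [h1]
    have e1 := h.le_clauseMessage_red (lam := lam) false
    have e2 := h.le_clauseMessage_red (lam := lam) true
    have e3 : 0 < q (.b false) ^ (k - 1) := by positivity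
    have e4 : (Col.r false).flip false = .r false := rfl
    have e5 : (Col.r false).flip true = .r true := rfl
    rw [e4, e5]
    have e6 : edgeWeight (.r false) = 1 := rfl
    rw [e6, Real.one_rpow, one_mul]
    refine div_pos (half_pos (by linarith)) (by positivity)
  refine ⟨1 / 2 / liftMass d k T q ^ (k - 1) / ∑ s ∈ OmegaT d k T, g s, by positivity,
    fun s hs he => ?_⟩
  rw [clauseBP, normalize, if_pos hs]
  change g s / ∑ s' ∈ OmegaT d k T, g s' = _
  rw [h1 s, he, Real.one_rpow]
  ring

/-- A red message is at least the mass `q (.b false) ^ (k - 1)` of a single blue pattern, while a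
blue message sums about `2 ^ (k - 1)` such patterns. The bound `2 ^ k` leaves a factor two, which
absorbs the free and forcing corrections. -/
theorem Gamma.clauseBP_red_blue (h : Gamma C d k T q) (hk : 2 ≤ k) (hl : 0 ≤ lam)
    (hkC : k * (C / 2 ^ k) ≤ 1 / 8) : ∃ r b : ℝ, 0 < r ∧ 0 ≤ b ∧ b ≤ 2 ^ k * r ∧
    (∀ x, clauseBP d k T lam (lift d k T q) (.r x) = r) ∧
    ∀ x, clauseBP d k T lam (lift d k T q) (.b x) = b := by
  obtain ⟨c, hc, hcs⟩ := h.exists_clauseBP_eq (lam := lam)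
  have hB := h.blue_pos
  have hC := h.const_nonneg
  have e1 := h.le_clauseMessage_red (lam := lam)
  have e0 := h.clauseMessage_nonneg (lam := lam)
  have e3 : 0 < q (.b false) ^ (k - 1) := by positivity
  have hb1 : ∀ x, clauseMessage d k T lam q (.b x) ≤ 2 ^ k * q (.b false) ^ (k - 1) := by
    intro x
    refine (h.clauseMessage_blue_le hl x).trans ?_
    have h1 := h.sum_blue_free_pow_le (N := k - 1) (by omega) (by linarith)
    have h2 : ((k - 1 : ℕ) : ℝ) * (q (.r false) * q (.b false) ^ (k - 1 - 1)) ≤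
        k * C * q (.b false) ^ (k - 1) := by
      have e : q (.b false) ^ (k - 1) = q (.b false) * q (.b false) ^ (k - 1 - 1) := by
        rw [← pow_succ', Nat.sub_add_cancel (by omega)]
      rw [e]
      have e4 : ((k - 1 : ℕ) : ℝ) ≤ k := by exact_mod_cast Nat.sub_le _ _
      calc _ ≤ (k : ℝ) * (C * q (.b false) * q (.b false) ^ (k - 1 - 1)) := by
            refine mul_le_mul e4 (mul_le_mul_of_nonneg_right h.red_le (by positivity)) ?_
              (by positivity)
            exact mul_nonneg (h.nonneg _) (by positivity)
        _ = _ := by ring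
    have e5 : (k : ℝ) * C ≤ 2 ^ k * (1 / 8) := by
      rw [mul_div_assoc', div_le_iff₀ (by positivity)] at hkC
      linarith
    have e6 : (2 : ℝ) ^ k = 2 * 2 ^ (k - 1) := by rw [← pow_succ', Nat.sub_add_cancel (by omega)]
    have e7 : (2 * q (.b false)) ^ (k - 1) * (1 + 2 * (k * (C / 2 ^ k))) ≤
        2 ^ k * q (.b false) ^ (k - 1) * (5 / 8) := by
      rw [mul_pow, e6]
      have : (1 + 2 * (k * (C / 2 ^ k))) ≤ 5 / 4 := by linarith
      have := mul_le_mul_of_nonneg_left this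
        (by positivity : 0 ≤ (2 : ℝ) ^ (k - 1) * q (.b false) ^ (k - 1))
      rw [e6] at this
      linarith
    have e8 := mul_le_mul_of_nonneg_right e5 e3.le
    have e9 : 0 < 2 ^ k * q (.b false) ^ (k - 1) := by positivity
    linarith
  refine ⟨c * (clauseMessage d k T lam q (.r false) + clauseMessage d k T lam q (.r true)),
    c * (clauseMessage d k T lam q (.b false) + clauseMessage d k T lam q (.b true)),
    ?_, ?_, ?_, fun x => ?_, fun x => ?_⟩
  · have := e1 false
    have := e1 true
    refine mul_pos hc (by linarith)
  · exact mul_nonneg hc.le (add_nonneg (e0 _) (e0 _))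
  · rw [mul_left_comm]
    refine mul_le_mul_of_nonneg_left ?_ hc.le
    rw [mul_add]
    exact add_le_add ((hb1 _).trans (mul_le_mul_of_nonneg_left (e1 _) (by positivity)))
      ((hb1 _).trans (mul_le_mul_of_nonneg_left (e1 _) (by positivity)))
  · rw [hcs _ (r_mem_OmegaT x) rfl]
    cases x
    · rfl
    · rw [add_comm]; rfl
  · rw [hcs _ (b_mem_OmegaT x) rfl]
    cases x
    · rfl
    · rw [add_comm]; rfl

/-- The colors around a frozen variable. -/
def FrozenColors {N : ℕ} (ζ : Fin N → Col) : Prop :=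
  ∃ x, (∃ i, ζ i = .r x) ∧ ∀ i, ζ i = .r x ∨ ζ i = .b x

theorem varWeight_frozenColors {N : ℕ} {ζ : Fin N → Col} (h : FrozenColors ζ) :
    varWeight ζ = 1 := by
  have h1 : VarOK ζ := Or.inl h
  obtain ⟨x, ⟨i, hi⟩, -⟩ := h
  rw [varWeight, if_neg (not_not.2 h1), if_pos ⟨i, x, hi⟩]

theorem sum_red_blue {N : ℕ} (x : Bool) (f : Col → ℝ) :
    ∑ ζ ∈ Fintype.piFinset fun _ : Fin N => ({.r x, .b x} : Finset Col), ∏ i, f (ζ i) =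
      (f (.r x) + f (.b x)) ^ N := by
  rw [← Finset.prod_univ_sum]
  simp

/-- Red has at least the share `1 / (1 + A)` of `r + b`, so damping red by `1 - t` gains `exp (-t /
(1 + A))` per edge. The case `t = 1 / 2` is the generating function of the red degree, and `t = 1`
the probability of having no red edge. -/
theorem ratio_pow_le {r b A : ℝ} (hr : 0 < r) (hb : 0 ≤ b) (hA : 0 < A) (h : b ≤ A * r) {t : ℝ}
    (ht0 : 0 ≤ t) (ht : t ≤ 1) (N : ℕ) :
    (r * (1 - t) + b) ^ N ≤ (r + b) ^ N * Real.exp (-(t * (N / (1 + A)))) := by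
  have h1 : r * (1 - t) + b ≤ (r + b) * Real.exp (-(t / (1 + A))) := by
    have h2 := Real.add_one_le_exp (-(t / (1 + A)))
    refine le_trans ?_ (mul_le_mul_of_nonneg_left h2 (by positivity))
    have : (r + b) * (t / (1 + A)) ≤ r * t := by
      rw [mul_div_assoc', div_le_iff₀ (by positivity)]
      nlinarith
    linarith
  refine (pow_le_pow_left₀ (by nlinarith) h1 N).trans (le_of_eq ?_)
  rw [mul_pow, ← Real.exp_nat_mul]
  congr 2
  ring

/-- Dropping the requirement of a red edge leaves a sum over `{r x, b x} ^ d` for each of the two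
values `x`, which factorizes. -/
theorem sum_frozenColors_le {Q : Col → ℝ} (hQ0 : ∀ s, 0 ≤ Q s) {r b A p : ℝ} (hr : 0 < r)
    (hb : 0 ≤ b) (hA : 0 < A) (hbr : b ≤ A * r) (hQr : ∀ x, Q (.r x) = r)
    (hQb : ∀ x, Q (.b x) = b) (hp : p = Real.exp (-(1 / 2 * (d / (1 + A))))) :
    ∑ ζ ∈ (Fintype.piFinset fun _ : Fin d => OmegaT d k T).filter FrozenColors,
      (∏ i, Q (ζ i)) * (1 / 2) ^ (Finset.univ.filter fun i => (ζ i).IsRed).card ≤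
      2 * ((r + b) ^ d * p) := by
  have h1 : ∀ ζ : Fin d → Col, (∏ i, Q (ζ i)) *
      (1 / 2) ^ (Finset.univ.filter fun i => (ζ i).IsRed).card =
      ∏ i, (Q (ζ i) * if (ζ i).IsRed then 1 / 2 else 1) := by
    intro ζ
    rw [Finset.prod_mul_distrib]
    congr 1
    rw [Finset.prod_ite, Finset.prod_const, Finset.prod_const_one, mul_one]
  have h2 : ((Fintype.piFinset fun _ : Fin d => OmegaT d k T).filter FrozenColors) ⊆
      (Fintype.piFinset fun _ : Fin d => ({.r false, .b false} : Finset Col)) ∪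
      (Fintype.piFinset fun _ : Fin d => ({.r true, .b true} : Finset Col)) := by
    intro ζ hζ
    obtain ⟨x, -, hx⟩ := (Finset.mem_filter.1 hζ).2
    rw [Finset.mem_union, Fintype.mem_piFinset, Fintype.mem_piFinset]
    cases x
    · exact Or.inl fun i => by simpa using hx i
    · exact Or.inr fun i => by simpa using hx i
  have hnn : ∀ ζ : Fin d → Col, 0 ≤ ∏ i, (Q (ζ i) * if (ζ i).IsRed then 1 / 2 else 1) :=
    fun ζ => Finset.prod_nonneg fun i _ => mul_nonneg (hQ0 _) (by split_ifs <;> norm_num)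
  have h3 : ∀ x, ∑ ζ ∈ (Fintype.piFinset fun _ : Fin d => ({.r x, .b x} : Finset Col)),
      ∏ i, (Q (ζ i) * if (ζ i).IsRed then 1 / 2 else 1) ≤ (r + b) ^ d * p := by
    intro x
    rw [sum_red_blue x fun s => Q s * if s.IsRed then 1 / 2 else 1]
    have e1 : (Col.r x).IsRed := ⟨x, rfl⟩
    have e2 : ¬ (Col.b x).IsRed := by rintro ⟨y, hy⟩; cases hy
    rw [if_pos e1, if_neg e2, hQr, hQb]
    have := ratio_pow_le hr hb hA hbr (t := 1 / 2) (by norm_num) (by norm_num) d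
    rw [← hp] at this
    refine le_trans (le_of_eq ?_) this
    congr 1
    ring
  simp only [h1]
  refine (Finset.sum_le_sum_of_subset_of_nonneg h2 fun ζ _ _ => hnn ζ).trans
    ((sum_union_le _ _ hnn).trans ?_)
  have := h3 false
  have := h3 true
  linarith

/-- In the typical empirical measure few frozen variables have few red edges. -/
theorem Gamma.sum_dot_le (h : Gamma C d k T q) (hk : 2 ≤ k) (hl : 0 ≤ lam)
    (hkC : k * (C / 2 ^ k) ≤ 1 / 8) {p : ℝ} (hp : p = Real.exp (-(1 / 2 * (d / (1 + 2 ^ k)))))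
    (hp2 : p ≤ 1 / 2) :
    ∑ ζ ∈ (Fintype.piFinset fun _ : Fin d => OmegaT d k T).filter FrozenColors,
      (Hstar d k T lam q).dot ζ * (1 / 2) ^ (Finset.univ.filter fun i => (ζ i).IsRed).card ≤
      4 * p := by
  obtain ⟨r, b, hr, hb, hbr, hQr, hQb⟩ := h.clauseBP_red_blue hk hl hkC
  set Q := clauseBP d k T lam (lift d k T q) with hQ
  have hQ0 : ∀ s, 0 ≤ Q s := fun s => h.clauseBP_nonneg s
  have hp0 : 0 < p := hp ▸ Real.exp_pos _
  set D := ∑ ζ' ∈ Fintype.piFinset fun _ : Fin d => OmegaT d k T,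
      tilt lam (varWeight ζ') * ∏ i, Q (ζ' i) with hD
  have hsub : ∀ x, (Fintype.piFinset fun _ : Fin d => ({.r x, .b x} : Finset Col)) ⊆
      Fintype.piFinset fun _ : Fin d => OmegaT d k T := by
    intro x
    refine Fintype.piFinset_subset _ _ fun _ s hs => ?_
    rw [Finset.mem_insert, Finset.mem_singleton] at hs
    rcases hs with rfl | rfl
    · exact r_mem_OmegaT x
    · exact b_mem_OmegaT x
  have hA : (0 : ℝ) < 2 ^ k := by positivity
  have hrb : 0 < (r + b) ^ d := by positivity
  -- The denominator is bounded below by the tuples frozen to `false`, that is, all red-blue tuples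
  -- except the entirely blue one. The latter has relative weight at most `p ^ 2`, by `ratio_pow_le`
  -- with `t = 1`.
  have hDge : (r + b) ^ d * (1 - p ^ 2) ≤ D := by
    have h1 : ∑ ζ ∈ (Fintype.piFinset fun _ : Fin d => ({.r false, .b false} : Finset Col)),
        ∏ i, Q (ζ i) = (r + b) ^ d := by rw [sum_red_blue, hQr, hQb]
    have hall : (fun _ => Col.b false) ∈
        Fintype.piFinset fun _ : Fin d => ({.r false, .b false} : Finset Col) := by
      rw [Fintype.mem_piFinset]; simp
    rw [← Finset.add_sum_erase _ _ hall] at h1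
    have h2 : ∏ i : Fin d, Q (Col.b false) = b ^ d := by simp [hQb]
    rw [h2] at h1
    have h3 : ∑ ζ ∈ (Fintype.piFinset fun _ : Fin d =>
        ({.r false, .b false} : Finset Col)).erase (fun _ => Col.b false), ∏ i, Q (ζ i) ≤ D := by
      rw [hD]
      refine le_trans (Finset.sum_le_sum fun ζ hζ => ?_) (Finset.sum_le_sum_of_subset_of_nonneg
        ((Finset.erase_subset _ _).trans (hsub false)) fun ζ _ _ =>
          mul_nonneg (tilt_nonneg (varWeight_nonneg ζ)) (Finset.prod_nonneg fun i _ => hQ0 _))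
      rw [Finset.mem_erase, Fintype.mem_piFinset] at hζ
      have : FrozenColors ζ := by
        refine ⟨false, ?_, fun i => by simpa using hζ.2 i⟩
        by_contra hno
        push Not at hno
        refine hζ.1 (funext fun i => ?_)
        have := hζ.2 i
        rw [Finset.mem_insert, Finset.mem_singleton] at this
        exact this.resolve_left (hno i)
      rw [varWeight_frozenColors this, tilt_one, one_mul]
    have h4 : b ^ d ≤ (r + b) ^ d * p ^ 2 := by
      have := ratio_pow_le hr hb hA hbr zero_le_one le_rfl d
      have e : p ^ 2 = Real.exp (-(1 * (d / (1 + 2 ^ k)))) := by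
        rw [hp, ← Real.exp_nat_mul]
        congr 1
        push_cast
        ring
      rw [e]
      simpa using this
    linarith
  have hp3 : 1 / 2 ≤ 1 - p ^ 2 := by nlinarith
  have hDpos : 0 < D := lt_of_lt_of_le (by positivity) hDge
  have hnum := sum_frozenColors_le (d := d) (k := k) (T := T) hQ0 hr hb hA hbr hQr hQb hp
  have hval : ∀ ζ : Fin d → Col, FrozenColors ζ →
      (Hstar d k T lam q).dot ζ = (∏ i, Q (ζ i)) / D := by
    intro ζ hζ
    simp only [Hstar]
    rw [varWeight_frozenColors hζ, tilt_one, one_mul]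
  rw [Finset.sum_congr rfl fun ζ hζ => by
    rw [hval ζ (Finset.mem_filter.1 hζ).2, div_mul_eq_mul_div], ← Finset.sum_div,
    div_le_iff₀ hDpos]
  refine hnum.trans ?_
  nlinarith [mul_le_mul_of_nonneg_left (hDge.trans' (mul_le_mul_of_nonneg_left hp3 hrb.le)) hp0.le]

end gamma

section
variable {C : ℝ} {n m d k T : ℕ} {q : Spin → ℝ} {lam : ℝ} {G : Instance n m d k} {σ : Config n d}

theorem atVar_frozenColors (h : σ ∈ colorings T G) {v : Fin n} (hv : v ∈ frozenVars σ) :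
    FrozenColors (atVar σ v) := by
  rcases (mem_colorings.1 h).2.1 v with h1 | ⟨hf, -⟩
  · exact h1
  · exfalso
    simp only [frozenVars, Finset.mem_filter, Finset.mem_univ, true_and] at hv
    apply hv
    unfold frozen
    have : ∀ x, ¬ ∃ i, σ (v, i) = .r x := by
      rintro x ⟨i, hi⟩
      obtain ⟨a, b, hab⟩ := hf i
      simp only [atVar, hi] at hab
      cases hab
    rw [if_neg (this _), if_neg (this _)]

/-- Group the frozen variables by their color tuples. The statistic is at most one, so replacing the
empirical measure by `H` costs at most their `ℓ¹` distance. -/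
theorem sum_redDegree_le (h : σ ∈ colorings T G) (H : Profile d k) :
    ∑ v ∈ frozenVars σ, (1 / 2 : ℝ) ^ redDegree σ v ≤
      n * (∑ ζ ∈ (Fintype.piFinset fun _ : Fin d => OmegaT d k T).filter FrozenColors,
        H.dot ζ * (1 / 2) ^ (Finset.univ.filter fun i => (ζ i).IsRed).card +
        profileDist T (empirical G σ) H) := by
  set A := (Fintype.piFinset fun _ : Fin d => OmegaT d k T).filter FrozenColors with hA
  set w : (Fin d → Col) → ℝ := fun ζ =>
    (1 / 2 : ℝ) ^ (Finset.univ.filter fun i => (ζ i).IsRed).card with hw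
  have hw0 : ∀ ζ, 0 ≤ w ζ := fun ζ => by positivity
  have hw1 : ∀ ζ, w ζ ≤ 1 := fun ζ => pow_le_one₀ (by norm_num) (by norm_num)
  have hmaps : ∀ v ∈ frozenVars σ, atVar σ v ∈ A := by
    intro v hv
    rw [hA, Finset.mem_filter, Fintype.mem_piFinset]
    exact ⟨fun i => (mem_colorings.1 h).1 (v, i), atVar_frozenColors h hv⟩
  have h1 : ∑ v ∈ frozenVars σ, (1 / 2 : ℝ) ^ redDegree σ v =
      ∑ ζ ∈ A, ((frozenVars σ).filter fun v => atVar σ v = ζ).card * w ζ := by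
    rw [← Finset.sum_fiberwise_of_maps_to hmaps]
    refine Finset.sum_congr rfl fun ζ _ => ?_
    rw [← nsmul_eq_mul, ← Finset.sum_const]
    refine Finset.sum_congr rfl fun v hv => ?_
    rw [← (Finset.mem_filter.1 hv).2]
    rfl
  rw [h1]
  rcases Nat.eq_zero_or_pos n with hn | hn
  · subst hn
    have : frozenVars σ = ∅ := Finset.eq_empty_of_forall_notMem fun v => v.elim0
    simp [this]
  have hn' : (0 : ℝ) < n := by exact_mod_cast hn
  have h2 : ∀ ζ ∈ A, (((frozenVars σ).filter fun v => atVar σ v = ζ).card : ℝ) * w ζ ≤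
      n * (H.dot ζ * w ζ + |(empirical G σ).dot ζ - H.dot ζ|) := by
    intro ζ _
    have e1 : (((frozenVars σ).filter fun v => atVar σ v = ζ).card : ℝ) ≤
        n * (empirical G σ).dot ζ := by
      simp only [empirical]
      rw [mul_div_cancel₀ _ hn'.ne']
      exact_mod_cast Finset.card_le_card (Finset.filter_subset_filter _ (Finset.subset_univ _))
    have e2 : (empirical G σ).dot ζ * w ζ ≤
        H.dot ζ * w ζ + |(empirical G σ).dot ζ - H.dot ζ| := by
      have := le_abs_self ((empirical G σ).dot ζ - H.dot ζ)
      have h0 := abs_nonneg ((empirical G σ).dot ζ - H.dot ζ)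
      nlinarith [hw0 ζ, hw1 ζ, mul_le_mul_of_nonneg_left this (hw0 ζ)]
    calc _ ≤ n * (empirical G σ).dot ζ * w ζ := mul_le_mul_of_nonneg_right e1 (hw0 ζ)
      _ ≤ _ := by rw [mul_assoc]; exact mul_le_mul_of_nonneg_left e2 hn'.le
  refine (Finset.sum_le_sum h2).trans ?_
  rw [← Finset.mul_sum, Finset.sum_add_distrib]
  refine mul_le_mul_of_nonneg_left (add_le_add le_rfl ?_) hn'.le
  refine (Finset.sum_le_sum_of_subset_of_nonneg (Finset.filter_subset _ _)
    fun _ _ _ => abs_nonneg _).trans ?_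
  unfold profileDist
  have e1 : 0 ≤ ∑ ξ ∈ Fintype.piFinset fun _ => OmegaT d k T, |(empirical G σ).hat ξ - H.hat ξ| :=
    Finset.sum_nonneg fun _ _ => abs_nonneg _
  have e2 : 0 ≤ ∑ s ∈ OmegaT d k T, |(empirical G σ).bar s - H.bar s| :=
    Finset.sum_nonneg fun _ _ => abs_nonneg _
  linarith

theorem abs_hat_sub_le (H : Profile d k) {ξ : Fin k → Col}
    (hξ : ξ ∈ Fintype.piFinset fun _ : Fin k => OmegaT d k T) :
    |(empirical G σ).hat ξ - H.hat ξ| ≤ profileDist T (empirical G σ) H := by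
  have e1 : 0 ≤ ∑ ζ ∈ Fintype.piFinset fun _ => OmegaT d k T, |(empirical G σ).dot ζ - H.dot ζ| :=
    Finset.sum_nonneg fun _ _ => abs_nonneg _
  have e2 : 0 ≤ ∑ s ∈ OmegaT d k T, |(empirical G σ).bar s - H.bar s| :=
    Finset.sum_nonneg fun _ _ => abs_nonneg _
  have e3 := Finset.single_le_sum (f := fun ξ => |(empirical G σ).hat ξ - H.hat ξ|)
    (fun _ _ => abs_nonneg _) hξ
  unfold profileDist
  linarith

/-- Colorings near the typical empirical measure are typical. -/
theorem Gamma.typical_of_near (h : Gamma C d k T q) (hk : 2 ≤ k) (hl : 0 ≤ lam)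
    (hkC : k * (C / 2 ^ k) ≤ 1 / 8) {p : ℝ} (hp : p = Real.exp (-(1 / 2 * (d / (1 + 2 ^ k)))))
    (hp2 : p ≤ 1 / 2) (hn1 : (n : ℝ) ^ (-(1 / 3) : ℝ) ≤ 1 / 2 ^ k * (4 * k * (1 + C) / 2 ^ k))
    (hn2 : (n : ℝ) ^ (-(1 / 3) : ℝ) ≤ 4 * p) (hσ : σ ∈ near T (Hstar d k T lam q) G) :
    Typical T (8 * k * (1 + C) / 2 ^ k) (8 * p) G σ := by
  obtain ⟨hc, hd⟩ := Finset.mem_filter.1 hσ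
  refine ⟨hc, fun y => ?_, ?_⟩
  · rcases Nat.eq_zero_or_pos m with hm | hm
    · subst hm
      simp
    have hm' : (0 : ℝ) < m := by exact_mod_cast hm
    have h1 := h.le_hat (by omega) hl (by linarith) y
    have h2 := abs_le.1 ((abs_hat_sub_le (G := G) (σ := σ) (T := T) (Hstar d k T lam q)
      (ξ := fun j => .b (y j)) (by
        rw [Fintype.mem_piFinset]
        exact fun _ => b_mem_OmegaT _)).trans (hd.trans hn1))
    have h3 : 1 / 2 ^ k * (1 - 8 * k * (1 + C) / 2 ^ k) ≤
        (empirical G σ).hat fun j => .b (y j) := by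
      have : (1 : ℝ) / 2 ^ k * (1 - 8 * k * (1 + C) / 2 ^ k) =
          1 / 2 ^ k * (1 - 4 * k * (1 + C) / 2 ^ k) - 1 / 2 ^ k * (4 * k * (1 + C) / 2 ^ k) := by
        ring
      linarith [h2.1]
    simp only [empirical] at h3
    rw [le_div_iff₀ hm'] at h3
    refine le_trans (le_of_eq ?_) h3
    ring
  · refine (sum_redDegree_le hc (Hstar d k T lam q)).trans ?_
    rw [mul_comm]
    refine mul_le_mul_of_nonneg_right ?_ (Nat.cast_nonneg _)
    have := h.sum_dot_le hk hl hkC hp hp2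
    linarith [hd.trans hn2]

end

/-! ### Entropy against energy -/

/-- This is `log y ≤ y - 1` at `y = √(1 / (2 * t))`, the usual comparison of relative entropy with
Hellinger distance. -/
theorem mul_log_inv_two_mul_le {t : ℝ} (ht : 0 ≤ t) :
    t * Real.log t⁻¹ ≤ t * Real.log 2 + 2 * (√(t / 2) - t) := by
  rcases ht.eq_or_lt with rfl | ht
  · simp
  have h1 : Real.log t⁻¹ = Real.log 2 + 2 * Real.log √(1 / (2 * t)) := by
    rw [Real.log_sqrt (by positivity), Real.log_div one_ne_zero (by positivity),
      Real.log_mul two_ne_zero ht.ne', Real.log_inv, Real.log_one]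
    ring
  have h2 := Real.log_le_sub_one_of_pos (x := √(1 / (2 * t))) (by positivity)
  have h3 : t * √(1 / (2 * t)) = √(t / 2) := by
    rw [eq_comm, Real.sqrt_eq_iff_mul_self_eq (by positivity) (by positivity)]
    have := Real.mul_self_sqrt (show 0 ≤ 1 / (2 * t) by positivity)
    symm
    calc t * √(1 / (2 * t)) * (t * √(1 / (2 * t))) =
          t * t * (√(1 / (2 * t)) * √(1 / (2 * t))) := by ring
      _ = t / 2 := by rw [this]; field_simp
  rw [h1]
  nlinarith [mul_le_mul_of_nonneg_left h2 ht.le]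

/-- The two instances of `mul_log_inv_two_mul_le` add up to `log 2 - 2 * (1 - β)`, where `β = √(t /
2) + √((1 - t) / 2)` is the affinity with a fair coin, and `β` is at most `1 - (t - 1 / 2) ^ 2 / 2`.
-/
theorem binEntropy_le_log_two_sub {t : ℝ} (ht : t ∈ Set.Icc (0 : ℝ) 1) :
    Real.binEntropy t ≤ Real.log 2 - (t - 1 / 2) ^ 2 := by
  have h1 := mul_log_inv_two_mul_le ht.1
  have h2 := mul_log_inv_two_mul_le (sub_nonneg.2 ht.2)
  have h3 : √(t / 2) + √((1 - t) / 2) ≤ 1 - (t - 1 / 2) ^ 2 / 2 := by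
    have e1 := Real.sq_sqrt (show 0 ≤ t / 2 by linarith [ht.1])
    have e2 := Real.sq_sqrt (show 0 ≤ (1 - t) / 2 by linarith [ht.2])
    have e3 : √(t / 2) * √((1 - t) / 2) ≤ 1 / 4 - (t - 1 / 2) ^ 2 / 2 := by
      rw [← Real.sqrt_mul (by linarith [ht.1])]
      refine Real.sqrt_le_iff.2 ⟨by nlinarith [ht.1, ht.2], ?_⟩
      nlinarith [sq_nonneg ((t - 1 / 2) ^ 2)]
    refine abs_le_of_sq_le_sq' ?_ (by nlinarith [ht.1, ht.2]) |>.2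
    nlinarith [sq_nonneg ((t - 1 / 2) ^ 2)]
  rw [Real.binEntropy]
  nlinarith

theorem extremeProb_symm (k : ℕ) (s : ℝ) : extremeProb k (1 - s) = extremeProb k s := by
  unfold extremeProb
  rw [sub_sub_cancel]
  ring

theorem lower_tail_le {k : ℕ} {s : ℝ} (hs : s ∈ Set.Icc (0 : ℝ) 1) :
    (1 - s) ^ k + k * (s * (1 - s) ^ (k - 1)) ≤ (k + 1) * (1 - s) ^ (k - 1) := by
  have h1 : (1 - s) ^ k ≤ (1 - s) ^ (k - 1) :=
    pow_le_pow_of_le_one (by linarith [hs.2]) (by linarith [hs.1]) (Nat.sub_le _ _)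
  have h2 : s * (1 - s) ^ (k - 1) ≤ (1 - s) ^ (k - 1) :=
    mul_le_of_le_one_left (pow_nonneg (by linarith [hs.2]) _) hs.2
  have h3 := mul_le_mul_of_nonneg_left h2 (Nat.cast_nonneg k (α := ℝ))
  linarith

theorem extremeProb_le {k : ℕ} {s r : ℝ} (hs : s ∈ Set.Icc (0 : ℝ) 1)
    (h1 : s ≤ r) (h2 : 1 - s ≤ r) : extremeProb k s ≤ 2 * ((k + 1) * r ^ (k - 1)) := by
  have e1 := lower_tail_le (k := k) hs
  have e2 := lower_tail_le (k := k) (s := 1 - s) ⟨by linarith [hs.2], by linarith [hs.1]⟩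
  rw [sub_sub_cancel] at e2
  have e3 := mul_le_mul_of_nonneg_left (pow_le_pow_left₀ hs.1 h1 (k - 1))
    (by positivity : (0 : ℝ) ≤ k + 1)
  have e4 := mul_le_mul_of_nonneg_left (pow_le_pow_left₀ (by linarith [hs.2]) h2 (k - 1))
    (by positivity : (0 : ℝ) ≤ k + 1)
  unfold extremeProb
  linarith

/-- A binomial variable of mean bounded below is at least two with probability bounded below. -/
theorem lower_tail_le_of_le {k : ℕ} (hk : 2 ≤ k) {s : ℝ} (hs : s ∈ Set.Icc (0 : ℝ) 1)
    (h : 1 / (17 * k) ≤ s) :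
    (1 - s) ^ k + k * (s * (1 - s) ^ (k - 1)) ≤ 1 - 1 / 2500 := by
  have hk' : (2 : ℝ) ≤ k := by exact_mod_cast hk
  have hkc : ((k - 1 : ℕ) : ℝ) = k - 1 := by
    rw [Nat.cast_sub (by omega)]; simp
  -- With `u` the mean of `k - 1` of the bits, the tail equals `(1 - s) ^ (k - 1) * (1 + u)`, hence
  -- is at most `exp (-u) * (1 + u)`. This is bounded away from one because `u ≥ 1 / 34`.
  set u : ℝ := (k - 1) * s with hu
  have hu1 : 1 / 34 ≤ u := by
    rw [div_le_iff₀ (by positivity)] at h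
    rw [hu]
    nlinarith
  have e1 : (1 - s) ^ k + k * (s * (1 - s) ^ (k - 1)) = (1 - s) ^ (k - 1) * (1 + u) := by
    have : (1 - s) ^ k = (1 - s) * (1 - s) ^ (k - 1) := by
      rw [← pow_succ', Nat.sub_add_cancel (by omega)]
    rw [this, hu]
    ring
  have e2 : (1 - s) ^ (k - 1) ≤ Real.exp (-u) := by
    have : Real.exp (-u) = Real.exp (-s) ^ (k - 1) := by
      rw [← Real.exp_nat_mul, hkc, hu]
      congr 1
      ring
    rw [this]
    exact pow_le_pow_left₀ (by linarith [hs.2]) (by linarith [Real.add_one_le_exp (-s)]) _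
  have e3 := Real.quadratic_le_exp_of_nonneg (x := u) (by linarith)
  have e4 : Real.exp (-u) * Real.exp u = 1 := by rw [← Real.exp_add]; simp
  rw [e1]
  have e5 : Real.exp (-u) * (1 + u) ≤ 1 - 1 / 2500 := by
    have h0 := Real.exp_pos (-u)
    have : 1 + u ≤ (1 - 1 / 2500) * (1 + u + u ^ 2 / 2) := by nlinarith
    calc Real.exp (-u) * (1 + u) ≤ Real.exp (-u) * ((1 - 1 / 2500) * Real.exp u) := by
          refine mul_le_mul_of_nonneg_left (this.trans ?_) h0.le
          exact mul_le_mul_of_nonneg_left e3 (by norm_num)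
      _ = (1 - 1 / 2500) * (Real.exp (-u) * Real.exp u) := by ring
      _ = _ := by rw [e4, mul_one]
  exact (mul_le_mul_of_nonneg_right e2 (by linarith)).trans e5

theorem eventually_mul_pow_le (a : ℝ) (j : ℕ) {r : ℝ} (hr0 : 0 ≤ r) (hr : r < 1) {ε : ℝ}
    (hε : 0 < ε) : ∀ᶠ k : ℕ in atTop, a * ((k : ℝ) ^ j * r ^ k) ≤ ε := by
  have h := (tendsto_pow_const_mul_const_pow_of_abs_lt_one j
    (show |r| < 1 by rwa [abs_of_nonneg hr0])).const_mul a
  rw [mul_zero] at h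
  exact h.eventually_le_const hε

set_option maxHeartbeats 1000000 in
-- There are three ranges of `t`. Below a fixed `ε` the entropy is tiny, while `extremeProb` stays
-- away from one because `k * s` is bounded below. For `ε ≤ t ≤ 1 / 2 - 1 / k` the quantity
-- `extremeProb` decays exponentially in `k`, against an entropy deficit of at least `1 / k ^ 2`.
-- Within `1 / k` of one half it is of order `k / 2 ^ k` and the error of order `k ^ 2 / 2 ^ k`,
-- both below the assumed deficit.
theorem entropy_energy_of_le_half (c : ℝ) (hc : 8 ≤ c) : ∀ᶠ k : ℕ in atTop, ∀ t s : ℝ,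
    1 / (16 * k) ≤ t → t ≤ 1 / 2 → (k : ℝ) ^ 8 / 2 ^ k / 16 ≤ (t - 1 / 2) ^ 2 →
    s ∈ Set.Icc (0 : ℝ) 1 → |s - t| ≤ 2 * (c * k / 2 ^ k) →
    Real.binEntropy t + 12 * k * (c * k / 2 ^ k) + Real.log 2 * extremeProb k s ≤ Real.log 2 := by
  have hlog : 0 < Real.log 2 := Real.log_pos one_lt_two
  have hlog1 : Real.log 2 ≤ 1 := by
    have := Real.log_le_sub_one_of_pos (x := 2) two_pos
    linarith
  -- Budget for small `t`, in units of `log 2 / 10000`: the gain `1 / 2500` from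
  -- `lower_tail_le_of_le` is worth 4, of which the entropy takes 2, the error term 1 and the upper
  -- tail 1.
  obtain ⟨ε₀, hε₀, hε⟩ : ∃ ε > 0, ∀ t : ℝ, |t| < ε → Real.binEntropy t ≤ Real.log 2 / 5000 := by
    have h1 : Tendsto Real.binEntropy (𝓝 0) (𝓝 0) := by
      have := Real.binEntropy_continuous.tendsto 0
      rwa [Real.binEntropy_zero] at this
    have h2 := h1.eventually_le_const (show 0 < Real.log 2 / 5000 by positivity)
    obtain ⟨ε, hε, h3⟩ := Metric.eventually_nhds_iff.1 h2
    exact ⟨ε, hε, fun t ht => h3 (by rwa [Real.dist_eq, sub_zero])⟩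
  set ε := min ε₀ (1 / 4) with hεdef
  have hεpos : 0 < ε := lt_min hε₀ (by norm_num)
  have hε4 : ε ≤ 1 / 4 := min_le_right _ _
  set ρ := 1 - ε / 2 with hρ
  have hρ1 : ρ < 1 := by rw [hρ]; linarith
  have hρ0 : 3 / 4 ≤ ρ := by rw [hρ]; linarith
  have hρp : 0 < ρ := by linarith
  filter_upwards [eventually_ge_atTop 2,
    eventually_mul_pow_le (544 * c) 2 (r := 1 / 2) (by norm_num) (by norm_num) one_pos,
    eventually_mul_pow_le (12 * c) 2 (r := 1 / 2) (by norm_num) (by norm_num)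
      (show 0 < Real.log 2 / 10000 by positivity),
    eventually_mul_pow_le (4 / 3 * 2) 1 (r := 3 / 4) (by norm_num) (by norm_num)
      (show (0 : ℝ) < 1 / 10000 by positivity),
    eventually_mul_pow_le (12 * c) 4 (r := 1 / 2) (by norm_num) (by norm_num)
      (show (0 : ℝ) < 1 / 2 by positivity),
    eventually_mul_pow_le (4 / ρ) 3 hρp.le hρ1 (show (0 : ℝ) < 1 / 2 by positivity),
    (tendsto_natCast_atTop_atTop (R := ℝ)).eventually_ge_atTop
      (16 * (12 * c + 8 * Real.exp 3)), eventually_mul_pow_le (4 * c / ε) 1 (r := 1 / 2) (by norm_num) (by norm_num) one_pos]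
    with k hk K1 K2 K2' K3 K3' K4 K5 t s ht1 ht2 hδ hs hst
  have hk' : (2 : ℝ) ≤ k := by exact_mod_cast hk
  have hkp : (0 : ℝ) < k := by linarith
  set η := c * k / 2 ^ k with hη
  have hpow : (1 / 2 : ℝ) ^ k = 1 / 2 ^ k := by rw [one_div_pow]
  have hη0 : 0 ≤ η := by rw [hη]; positivity
  have hkη : k * η = c * ((k : ℝ) ^ 2 * (1 / 2) ^ k) := by rw [hη, hpow]; ring
  have hη1 : 544 * (k * η) ≤ 1 := by rw [hkη]; linarith
  have hη2 : η ≤ 1 / 1000 := by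
    have : 2 * η ≤ k * η := mul_le_mul_of_nonneg_right hk' hη0
    linarith
  have hηε : 4 * η ≤ ε := by
    rw [div_mul_eq_mul_div, div_le_one hεpos] at K5
    rw [hη]
    rw [hpow] at K5
    calc _ = 4 * c * ((k : ℝ) ^ 1 * (1 / 2 ^ k)) := by ring
      _ ≤ ε := K5
  obtain ⟨hst1, hst2⟩ := abs_le.1 hst
  by_cases hA : t < ε
  · have hH := hε t (by
      rw [abs_of_nonneg (le_trans (by positivity) ht1)]
      exact hA.trans_le (min_le_left _ _))
    have hs0 : 1 / (17 * k) ≤ s := by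
      have : 1 / (17 * k) + 2 * η ≤ 1 / (16 * (k : ℝ)) := by
        rw [← sub_nonneg]
        have : 1 / (16 * (k : ℝ)) - (1 / (17 * k) + 2 * η) = (1 - 544 * (k * η)) / (272 * k) := by
          field_simp
          ring
        rw [this]
        exact div_nonneg (by linarith) (by positivity)
      linarith
    have e1 := lower_tail_le_of_le hk hs hs0
    have e2 := lower_tail_le (k := k) (s := 1 - s)
      ⟨by linarith [hs.2], by linarith [hs.1]⟩
    rw [sub_sub_cancel] at e2
    have e3 : (k + 1) * s ^ (k - 1) ≤ 1 / 10000 := by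
      have h1 : s ^ (k - 1) ≤ (3 / 4) ^ (k - 1) := pow_le_pow_left₀ hs.1 (by linarith) _
      have h2 : (3 / 4 : ℝ) ^ (k - 1) = 4 / 3 * (3 / 4) ^ k := by
        have : (3 / 4 : ℝ) ^ k = 3 / 4 * (3 / 4) ^ (k - 1) := by
          rw [← pow_succ', Nat.sub_add_cancel (by omega)]
        rw [this]; ring
      rw [h2] at h1
      have h3 : (0 : ℝ) ≤ (3 / 4) ^ k := by positivity
      calc _ ≤ (2 * k : ℝ) * (4 / 3 * (3 / 4) ^ k) :=
            mul_le_mul (by linarith) h1 (pow_nonneg hs.1 _) (by positivity)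
        _ = 4 / 3 * 2 * ((k : ℝ) ^ 1 * (3 / 4) ^ k) := by ring
        _ ≤ _ := K2'
    have e4 : extremeProb k s ≤ 1 - 1 / 2500 + 1 / 10000 := by
      unfold extremeProb; linarith
    have e5 : 12 * k * η ≤ Real.log 2 / 10000 := by
      calc 12 * k * η = 12 * (k * η) := by ring
        _ = 12 * c * ((k : ℝ) ^ 2 * (1 / 2) ^ k) := by rw [hkη]; ring
        _ ≤ _ := K2
    have e6 := mul_le_mul_of_nonneg_left e4 hlog.le
    linarith
  push Not at hA
  have hH := binEntropy_le_log_two_sub (t := t)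
    ⟨le_trans (by positivity) ht1, by linarith⟩
  have he0 : 0 ≤ extremeProb k s := by
    unfold extremeProb
    have h1 := hs.1
    have h2 : 0 ≤ 1 - s := by linarith [hs.2]
    positivity
  have hle : Real.log 2 * extremeProb k s ≤ extremeProb k s := mul_le_of_le_one_left he0 hlog1
  suffices h : 12 * k * η + extremeProb k s ≤ (t - 1 / 2) ^ 2 by linarith
  by_cases hB : 1 / k ≤ 1 / 2 - t
  · have e1 := extremeProb_le (k := k) (r := ρ) hs (by rw [hρ]; linarith)
      (by rw [hρ]; linarith)
    have e2 : 1 / (k : ℝ) ^ 2 ≤ (t - 1 / 2) ^ 2 := by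
      rw [← one_div_pow, ← neg_sq (t - 1 / 2)]
      exact pow_le_pow_left₀ (by positivity) (by linarith) 2
    refine le_trans ?_ e2
    rw [le_div_iff₀ (by positivity)]
    have h2 : ρ ^ (k - 1) = ρ ^ k / ρ := by
      rw [eq_div_iff hρp.ne', ← pow_succ, Nat.sub_add_cancel (by omega)]
    have e3 : 12 * k * η * (k : ℝ) ^ 2 ≤ 1 / 2 := by
      calc 12 * k * η * (k : ℝ) ^ 2 = 12 * (k * η) * (k : ℝ) ^ 2 := by ring
        _ = 12 * c * ((k : ℝ) ^ 4 * (1 / 2) ^ k) := by rw [hkη]; ring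
        _ ≤ _ := K3
    have e4 : 2 * ((k + 1) * ρ ^ (k - 1)) * (k : ℝ) ^ 2 ≤ 1 / 2 := by
      refine le_trans ?_ K3'
      rw [h2]
      calc _ ≤ 2 * ((2 * k) * (ρ ^ k / ρ)) * (k : ℝ) ^ 2 := by gcongr; linarith
        _ = _ := by ring
    nlinarith [mul_le_mul_of_nonneg_right e1 (by positivity : (0:ℝ) ≤ (k : ℝ) ^ 2)]
  · push Not at hB
    have e1 := extremeProb_le (k := k) (r := 1 / 2 * (1 + (2 / k + 4 * η))) hs
      (by have : 0 < 1 / (k : ℝ) := by positivity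
          have : (2 : ℝ) / k = 2 * (1 / k) := by ring
          linarith)
      (by have : (2 : ℝ) / k = 2 * (1 / k) := by ring
          linarith)
    have e2 : (1 / 2 * (1 + (2 / k + 4 * η))) ^ (k - 1) ≤ 2 / 2 ^ k * Real.exp 3 := by
      rw [mul_pow]
      have h1 : (1 / 2 : ℝ) ^ (k - 1) = 2 / 2 ^ k := by
        have : (1 / 2 : ℝ) ^ k = 1 / 2 * (1 / 2) ^ (k - 1) := by
          rw [← pow_succ', Nat.sub_add_cancel (by omega)]
        rw [hpow] at this
        field_simp at this ⊢
        linarith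
      rw [h1]
      refine mul_le_mul_of_nonneg_left ?_ (by positivity)
      have h2 : (1 + (2 / k + 4 * η)) ^ (k - 1) ≤ Real.exp (2 / k + 4 * η) ^ (k - 1) :=
        pow_le_pow_left₀ (by positivity) (by linarith [Real.add_one_le_exp (2 / k + 4 * η)]) _
      refine h2.trans ?_
      rw [← Real.exp_nat_mul, Real.exp_le_exp]
      have h3 : ((k - 1 : ℕ) : ℝ) ≤ k := by exact_mod_cast Nat.sub_le _ _
      refine (mul_le_mul_of_nonneg_right h3 (by positivity)).trans ?_
      have : (k : ℝ) * (2 / k + 4 * η) = 2 + 4 * (k * η) := by field_simp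
      rw [this]
      linarith
    refine le_trans ?_ hδ
    have e3 : 12 * k * η = 12 * c * (k : ℝ) ^ 2 / 2 ^ k := by rw [hη]; ring
    have e4 : extremeProb k s ≤ 8 * Real.exp 3 * k / 2 ^ k := by
      refine e1.trans ?_
      calc _ ≤ 2 * ((2 * k) * (2 / 2 ^ k * Real.exp 3)) := by
            refine mul_le_mul_of_nonneg_left ?_ zero_le_two
            exact mul_le_mul (by linarith) e2 (by positivity) (by positivity)
        _ = _ := by ring
    rw [e3]
    refine (add_le_add le_rfl e4).trans ?_
    rw [← add_div, div_div, mul_comm _ (16 : ℝ), ← div_div]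
    refine div_le_div_of_nonneg_right ?_ (by positivity)
    have hx := Real.exp_pos 3
    have h6 : (k : ℝ) ^ 3 ≤ (k : ℝ) ^ 8 := pow_le_pow_right₀ (by linarith) (by norm_num)
    have h7 : 12 * c * (k : ℝ) ^ 2 + 8 * Real.exp 3 * k ≤ (12 * c + 8 * Real.exp 3) * (k : ℝ) ^ 2 := by
      have : (k : ℝ) ≤ k ^ 2 := le_self_pow₀ (by linarith) two_ne_zero
      have := mul_le_mul_of_nonneg_left this (by positivity : 0 ≤ 8 * Real.exp 3)
      linarith
    have h8 : (12 * c + 8 * Real.exp 3) * (k : ℝ) ^ 2 ≤ k / 16 * (k : ℝ) ^ 2 :=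
      mul_le_mul_of_nonneg_right (by linarith) (by positivity)
    have h9 : (k : ℝ) / 16 * (k : ℝ) ^ 2 = (k : ℝ) ^ 3 / 16 := by ring
    linarith

/-- The symmetry `t ↦ 1 - t`, `s ↦ 1 - s` reduces to `t ≤ 1 / 2`. The margin `12 * k * η` there,
twice what is kept here, pays for the factors `1 - 4 / 2 ^ k` and `1 - η`. -/
theorem entropy_energy (c : ℝ) (hc : 8 ≤ c) : ∀ᶠ k : ℕ in atTop, ∀ t s : ℝ,
    1 / (16 * k) ≤ t → t ≤ 1 - 1 / (16 * k) → (k : ℝ) ^ 8 / 2 ^ k / 16 ≤ (t - 1 / 2) ^ 2 →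
    s ∈ Set.Icc (0 : ℝ) 1 → |s - t| ≤ 2 * (c * k / 2 ^ k) →
    Real.binEntropy t + 6 * k * (c * k / 2 ^ k) + 1 / 2 ^ k ≤
      Real.log 2 * (1 - 4 / 2 ^ k) * (1 - c * k / 2 ^ k) * (1 - extremeProb k s) := by
  have hlog : 0 < Real.log 2 := Real.log_pos one_lt_two
  have hlog1 : Real.log 2 ≤ 1 := by
    have := Real.log_le_sub_one_of_pos (x := 2) two_pos
    linarith
  filter_upwards [entropy_energy_of_le_half c hc, eventually_ge_atTop 2,
    eventually_mul_pow_le c 1 (r := 1 / 2) (by norm_num) (by norm_num) one_pos]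
    with k h hk K1 t s ht1 ht2 hδ hs hst
  have hk' : (2 : ℝ) ≤ k := by exact_mod_cast hk
  have h1 : Real.binEntropy t + 12 * k * (c * k / 2 ^ k) + Real.log 2 * extremeProb k s ≤
      Real.log 2 := by
    rcases le_total t (1 / 2) with ht | ht
    · exact h t s ht1 ht hδ hs hst
    · rw [← Real.binEntropy_one_sub, ← extremeProb_symm]
      refine h (1 - t) (1 - s) (by linarith) (by linarith) ?_ ⟨by linarith [hs.2], by
        linarith [hs.1]⟩ ?_
      · rw [show (1 - t - 1 / 2) ^ 2 = (t - 1 / 2) ^ 2 by ring]; exact hδ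
      · rw [show 1 - s - (1 - t) = -(s - t) by ring, abs_neg]; exact hst
  have hx : (0 : ℝ) < 1 / 2 ^ k := by positivity
  have hη : c * k / 2 ^ k = c * k * (1 / 2 ^ k) := by ring
  have hη8 : 16 * (1 / 2 ^ k) ≤ c * k / 2 ^ k := by
    rw [hη]
    refine mul_le_mul_of_nonneg_right ?_ hx.le
    nlinarith
  have h4 : (4 : ℝ) / 2 ^ k = 4 * (1 / 2 ^ k) := by ring
  have hη1 : c * k / 2 ^ k ≤ 1 := by
    rw [one_div_pow, pow_one] at K1
    calc c * k / 2 ^ k = c * (k * (1 / 2 ^ k)) := by ring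
      _ ≤ 1 := K1
  have he0 : 0 ≤ extremeProb k s := by
    unfold extremeProb
    have h1 := hs.1
    have h2 : 0 ≤ 1 - s := by linarith [hs.2]
    positivity
  set η := c * k / 2 ^ k
  set e := extremeProb k s
  set y : ℝ := 1 / 2 ^ k
  rw [h4]
  have e1 : (1 - 4 * y) * (1 - η) ≥ 1 - 4 * y - η := by nlinarith
  have hpos : 0 ≤ (1 - 4 * y) * (1 - η) := mul_nonneg (by linarith) (by linarith)
  have hle1 : (1 - 4 * y) * (1 - η) ≤ 1 := mul_le_one₀ (by linarith) (by linarith) (by linarith)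
  have e2 : (1 - 4 * y) * (1 - η) * (1 - e) ≥ 1 - 4 * y - η - e := by nlinarith
  have e3 := mul_le_mul_of_nonneg_left e2 hlog.le
  have e4 : Real.log 2 * (4 * y + η) ≤ 4 * y + η := mul_le_of_le_one_left (by linarith) hlog1
  have e5 : 2 * η ≤ k * η := mul_le_mul_of_nonneg_right hk' (by linarith)
  nlinarith

/-! ### Configurations at intermediate distance -/

/-- For `t = j / n` the summand is `t ^ j * (1 - t) ^ (n - j)`, the probability of one particular
set of size `j` under sampling with parameter `t`. Each size therefore contributes at most one. -/
theorem sum_exp_binEntropy_le {n : ℕ} (hn : 0 < n) :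
    ∑ S : Finset (Fin n), Real.exp (-(n * Real.binEntropy (S.card / n))) ≤ n + 1 := by
  have hn' : (0 : ℝ) < n := by exact_mod_cast hn
  have h1 := Finset.sum_powerset_apply_card (x := (Finset.univ : Finset (Fin n)))
    (fun j => Real.exp (-(n * Real.binEntropy (j / n))))
  rw [Finset.powerset_univ, Finset.card_univ, Fintype.card_fin] at h1
  rw [h1]
  have h2 : ∀ j ∈ Finset.range (n + 1),
      n.choose j • Real.exp (-(n * Real.binEntropy (j / n))) ≤ 1 := by
    intro j hj
    have hjn : j ≤ n := Nat.lt_succ_iff.1 (Finset.mem_range.1 hj)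
    have hjn' : (j : ℝ) ≤ n := by exact_mod_cast hjn
    set t : ℝ := j / n with ht
    have ht0 : 0 ≤ t := by positivity
    have ht1 : t ≤ 1 := div_le_one_of_le₀ hjn' hn'.le
    have hnt : n * t = j := by rw [ht]; field_simp
    have hexp : ∀ (i : ℕ) (u : ℝ), 0 ≤ u → (n : ℝ) * u = i → Real.exp (i * Real.log u) = u ^ i := by
      intro i u hu hi
      rcases hu.eq_or_lt with rfl | hu
      · have : i = 0 := by
          rw [mul_zero] at hi
          exact_mod_cast hi.symm
        subst this
        simp
      · rw [← Real.log_pow, Real.exp_log (by positivity)]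
    have h3 : Real.exp (-(n * Real.binEntropy t)) = t ^ j * (1 - t) ^ (n - j) := by
      rw [← hexp j t ht0 hnt, ← hexp (n - j) (1 - t) (by linarith)
        (by rw [Nat.cast_sub hjn]; linarith), ← Real.exp_add, Real.binEntropy, Real.log_inv,
        Real.log_inv, Nat.cast_sub hjn]
      congr 1
      rw [← hnt]
      ring
    rw [h3, nsmul_eq_mul]
    have h4 := add_pow t (1 - t) n
    rw [add_sub_cancel, one_pow] at h4
    refine le_trans (le_of_eq ?_) ((Finset.single_le_sum (f := fun m =>
      t ^ m * (1 - t) ^ (n - m) * (n.choose m : ℝ)) (fun i _ => ?_) hj).trans h4.ge)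
    · ring
    · have : 0 ≤ 1 - t := by linarith
      positivity
  refine (Finset.sum_le_sum h2).trans ?_
  simp

/-- Give a set `U` the weight `y ^ U.card`: the total is `(1 + y) ^ n`, and every counted set has
weight at least `y ^ b`. -/
theorem card_subsets_le {n b : ℕ} {y : ℝ} (hy : 0 < y) (hy1 : y ≤ 1) :
    (((Finset.univ : Finset (Finset (Fin n))).filter fun U => U.card ≤ b).card : ℝ) ≤
      (1 + y) ^ n / y ^ b := by
  have h1 := Finset.sum_pow_mul_eq_add_pow y 1 (Finset.univ : Finset (Fin n))
  simp only [one_pow, mul_one, Finset.powerset_univ, Finset.card_univ, Fintype.card_fin] at h1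
  rw [le_div_iff₀ (by positivity), add_comm, ← h1, ← nsmul_eq_mul, ← Finset.sum_const]
  refine (Finset.sum_le_sum fun U hU => ?_).trans (Finset.sum_le_sum_of_subset_of_nonneg
    (Finset.filter_subset _ _) fun U _ _ => by positivity)
  exact pow_le_pow_of_le_one hy.le hy1 (Finset.mem_filter.1 hU).2

/-- Given the flipped set `S`, the free set of `x'` fixes `x'` on the variables frozen in `x`. On
those free in `x` one further bit per variable is needed. -/
theorem card_flippedVars_fiber_le {n b : ℕ} (x : Fin n → Option Bool) (S : Finset (Fin n)) :
    ((Finset.univ : Finset (Fin n → Option Bool)).filter fun x' => flippedVars x x' = S ∧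
      (Finset.univ.filter fun v => x' v = none).card ≤ b).card ≤
    ((Finset.univ : Finset (Finset (Fin n))).filter fun U => U.card ≤ b).card *
      2 ^ (Finset.univ.filter fun v => x v = none).card := by
  rw [← Finset.card_powerset, ← Finset.card_product]
  refine Finset.card_le_card_of_injOn (fun x' => (Finset.univ.filter fun v => x' v = none,
    Finset.univ.filter fun v => x v = none ∧ x' v = some true)) ?_ ?_
  · intro x' hx'
    simp only [Finset.coe_filter, Finset.mem_univ, true_and, Set.mem_ofPred_eq] at hx'
    simp only [Finset.coe_product, Set.mem_prod, Finset.mem_coe, Finset.mem_filter,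
      Finset.mem_univ, true_and, Finset.mem_powerset]
    exact ⟨hx'.2, fun v hv => by
      simp only [Finset.mem_filter, Finset.mem_univ, true_and] at hv ⊢
      exact hv.1⟩
  · intro x1 h1 x2 h2 he
    simp only [Finset.coe_filter, Finset.mem_univ, true_and, Set.mem_ofPred_eq] at h1 h2
    simp only [Prod.mk.injEq] at he
    funext v
    have e1 := Finset.ext_iff.1 he.1 v
    have e2 := Finset.ext_iff.1 he.2 v
    have e3 := Finset.ext_iff.1 (h1.1.trans h2.1.symm) v
    simp only [flippedVars, Finset.mem_filter, Finset.mem_univ, true_and] at e1 e2 e3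
    revert e1 e2 e3
    cases hx : x v with
    | none =>
      cases x1 v with
      | none => cases x2 v <;> simp
      | some a => cases x2 v with
        | none => simp
        | some b => cases a <;> cases b <;> simp
    | some w =>
      cases x1 v with
      | none => cases x2 v <;> simp
      | some a => cases x2 v with
        | none => simp
        | some b => cases a <;> cases b <;> cases w <;> simp

section mid
variable {n m d k T : ℕ} {G : Instance n m d k} {σ : Config n d} {η α : ℝ}

/-- The distance of `x'` to `x` is neither small nor large nor close to one half. -/
def Intermediate (k : ℕ) (x x' : Fin n → Option Bool) : Prop :=
  1 / (16 * k) ≤ ((flippedVars x x').card : ℝ) / n ∧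
    ((flippedVars x x').card : ℝ) / n ≤ 1 - 1 / (16 * k) ∧
    (k : ℝ) ^ 8 / 2 ^ k / 16 ≤ (((flippedVars x x').card : ℝ) / n - 1 / 2) ^ 2

/-- For one `x'`, the lower degree bound makes `2 * m / 2 ^ k` at least `n * log 2 * (1 - 4 / 2 ^
k)`, and `hE` converts the energy into entropy plus a reserve `6 * k * η * n + n / 2 ^ k`. Of the
reserve, `2 * k * η * n` pays for clauses that meet free variables of `x'`, and `4 * k * η * n` for
the number of `x'` with a given flipped set. The sum over flipped sets is `sum_exp_binEntropy_le`,
and `n / 2 ^ k` is the surviving gain. -/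
theorem Typical.sum_intermediate_le {c : ℝ} (hη : η = c * k / 2 ^ k) (h : Typical T η α G σ)
    (hn : 0 < n) (hd : 0 < d) (hk : 2 ≤ k) (hη2 : η ≤ 1 / 2) (hc : 1 ≤ c)
    (hE : ∀ t s : ℝ, 1 / (16 * k) ≤ t → t ≤ 1 - 1 / (16 * k) →
      (k : ℝ) ^ 8 / 2 ^ k / 16 ≤ (t - 1 / 2) ^ 2 → s ∈ Set.Icc (0 : ℝ) 1 →
      |s - t| ≤ 2 * (c * k / 2 ^ k) →
      Real.binEntropy t + 6 * k * (c * k / 2 ^ k) + 1 / 2 ^ k ≤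
        Real.log 2 * (1 - 4 / 2 ^ k) * (1 - c * k / 2 ^ k) * (1 - extremeProb k s))
    (hd1 : ((2 : ℝ) ^ k / 2 - 2) * Real.log 2 ≤ (d : ℝ) / k)
    (hd2 : (d : ℝ) / k ≤ (2 : ℝ) ^ k / 2 * Real.log 2) {b : ℕ} (hb : (b : ℝ) ≤ η * n)
    (A : Finset (Fin n → Option Bool))
    (hA : ∀ x' ∈ A, Intermediate k (frozen σ) x' ∧
      (Finset.univ.filter fun v => x' v = none).card ≤ b) :
    ∑ ρ ∈ colorPerms (blueClass σ), ∑ x' ∈ A,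
      ∏ a, (if GoodClause (NAESat.permute G ρ).1 σ x' a then 1 - 2 / 2 ^ k else 1 : ℝ) ≤
    (colorPerms (blueClass σ)).card *
      (samplingFactor σ * ((n + 1) * Real.exp (-(n / 2 ^ k)))) := by
  have hn' : (0 : ℝ) < n := by exact_mod_cast hn
  have hk' : (2 : ℝ) ≤ k := by exact_mod_cast hk
  have hkp : (0 : ℝ) < k := by linarith
  have hη0 : 0 ≤ η := by rw [hη]; positivity
  have hlog : 0 < Real.log 2 := Real.log_pos one_lt_two
  have hlog1 : Real.log 2 ≤ 1 := by
    have := Real.log_le_sub_one_of_pos (x := 2) two_pos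
    linarith
  have hx0 : (0 : ℝ) < 1 / 2 ^ k := by positivity
  have h2k : (4 : ℝ) ≤ 2 ^ k := by
    calc (4 : ℝ) = 2 ^ 2 := by norm_num
      _ ≤ 2 ^ k := pow_le_pow_right₀ one_le_two hk
  have hθ : (2 : ℝ) / 2 ^ k ≤ 1 / 2 := by
    rw [div_le_iff₀ (by positivity)]; linarith
  have hmn : (n : ℝ) * d = m * k := by exact_mod_cast card_edges G
  have hm : (m : ℝ) = n * (d / k) := by field_simp; linarith
  have hm1 : (n : ℝ) * (Real.log 2 * (1 - 4 / 2 ^ k)) ≤ 2 / 2 ^ k * m := by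
    rw [hm]
    calc (n : ℝ) * (Real.log 2 * (1 - 4 / 2 ^ k)) =
          n * (2 / 2 ^ k * ((2 ^ k / 2 - 2) * Real.log 2)) := by field_simp; ring
      _ ≤ n * (2 / 2 ^ k * (d / k)) := by gcongr
      _ = _ := by ring
  have hb1 : 2 * (2 / 2 ^ k) * ((b * d : ℕ) : ℝ) ≤ 2 * k * η * n := by
    have e1 : (d : ℝ) ≤ k * (2 ^ k / 2) := by
      rw [div_le_iff₀ hkp] at hd2
      have : (2 : ℝ) ^ k / 2 * Real.log 2 ≤ 2 ^ k / 2 := mul_le_of_le_one_right (by positivity) hlog1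
      nlinarith
    push_cast
    calc 2 * (2 / 2 ^ k) * ((b : ℝ) * d) ≤ 2 * (2 / 2 ^ k) * ((η * n) * (k * (2 ^ k / 2))) := by
          gcongr
      _ = 2 * k * η * n := by field_simp
  have hpt : ∀ x' ∈ A, ∑ ρ ∈ colorPerms (blueClass σ),
      ∏ a, (if GoodClause (NAESat.permute G ρ).1 σ x' a then 1 - 2 / 2 ^ k else 1 : ℝ) ≤
      (colorPerms (blueClass σ)).card * (samplingFactor σ * Real.exp (-(4 * k * η * n) -
        n / 2 ^ k - n * Real.binEntropy ((flippedVars (frozen σ) x').card / n))) := by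
    intro x' hx'
    obtain ⟨⟨hI1, hI2, hI3⟩, hfree⟩ := hA x' hx'
    have hcard : (Finset.univ.filter fun e : Fin n × Fin d => x' e.1 = none).card ≤ b * d := by
      have : (Finset.univ.filter fun e : Fin n × Fin d => x' e.1 = none) ⊆
          (Finset.univ.filter fun v => x' v = none) ×ˢ Finset.univ := by
        intro e he
        simp only [Finset.mem_filter, Finset.mem_univ, true_and] at he
        simp [he]
      refine (Finset.card_le_card this).trans ?_
      rw [Finset.card_product, Finset.card_univ, Fintype.card_fin]
      exact Nat.mul_le_mul_right _ hfree
    have h1 := h.sum_goodClause_le (x' := x') (θ := 2 / 2 ^ k) (by positivity) hθ hcard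
      (by linarith) rfl
    set s := (blueDensity σ (flippedVars (frozen σ) x') true +
      blueDensity σ (flippedVars (frozen σ) x') false) / 2 with hs
    refine h1.trans ?_
    refine mul_le_mul_of_nonneg_left (mul_le_mul_of_nonneg_left ?_ samplingFactor_nonneg)
      (Nat.cast_nonneg _)
    rw [Real.exp_le_exp]
    have hsI : s ∈ Set.Icc (0 : ℝ) 1 := by
      have e1 := blueDensity_mem σ (flippedVars (frozen σ) x') true
      have e2 := blueDensity_mem σ (flippedVars (frozen σ) x') false
      rw [hs]
      constructor
      · linarith [e1.1, e2.1]
      · linarith [e1.2, e2.2]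
    have hclose := h.blueDensity_close hn hd hη0 hη2 (flippedVars (frozen σ) x')
    have h2 := hE _ s hI1 hI2 hI3 hsI (by rw [← hη]; exact hclose)
    rw [← hη] at h2
    -- Otherwise the right side of `h2` would be nonpositive, while its left side is positive.
    have hex : 0 ≤ 1 - extremeProb k s := by
      by_contra hneg
      push Not at hneg
      have e1 := Real.binEntropy_nonneg (p := (flippedVars (frozen σ) x').card / n)
        (le_trans (by positivity) hI1) (hI2.trans (sub_le_self _ (by positivity)))
      have e2 : 0 ≤ 1 - (4 : ℝ) / 2 ^ k := by
        rw [sub_nonneg, div_le_one (by positivity)]; exact h2k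
      have e3 : Real.log 2 * (1 - 4 / 2 ^ k) * (1 - η) * (1 - extremeProb k s) ≤ 0 :=
        mul_nonpos_of_nonneg_of_nonpos (mul_nonneg (mul_nonneg hlog.le e2) (by linarith)) hneg.le
      have e4 : 0 ≤ 6 * k * η := by positivity
      linarith
    have h3 : n * (Real.log 2 * (1 - 4 / 2 ^ k) * (1 - η) * (1 - extremeProb k s)) ≤
        2 / 2 ^ k * m * (1 - η) * (1 - extremeProb k s) := by
      have := mul_le_mul_of_nonneg_right (mul_le_mul_of_nonneg_right hm1
        (show 0 ≤ 1 - η by linarith)) hex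
      linarith
    have h4 := mul_le_mul_of_nonneg_left h2 hn'.le
    have e5 : (n : ℝ) / 2 ^ k = n * (1 / 2 ^ k) := by ring
    rw [e5]
    linarith
  rw [Finset.sum_comm]
  refine (Finset.sum_le_sum hpt).trans ?_
  rw [← Finset.mul_sum, ← Finset.mul_sum]
  refine mul_le_mul_of_nonneg_left (mul_le_mul_of_nonneg_left ?_ samplingFactor_nonneg)
    (Nat.cast_nonneg _)
  have hf := h.numFree_le hd
  -- Taking `y = 2 ^ (-k)` in `card_subsets_le`, the free set of `x'` costs at most `η * n + k * η *
  -- n` in the exponent and the bits on the free variables of `σ` at most `η * n`. The total is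
  -- within `4 * k * η * n`.
  have hcount : ∀ S : Finset (Fin n), ((A.filter fun x' => flippedVars (frozen σ) x' = S).card : ℝ) ≤
      Real.exp (4 * k * η * n) := by
    intro S
    have h1 : (A.filter fun x' => flippedVars (frozen σ) x' = S).card ≤ _ :=
      (Finset.card_le_card (fun x' hx' => by
        rw [Finset.mem_filter] at hx' ⊢
        exact ⟨Finset.mem_univ _, hx'.2, (hA x' hx'.1).2⟩)).trans
        (card_flippedVars_fiber_le (b := b) (frozen σ) S)
    have h2 := card_subsets_le (n := n) (b := b) hx0 (by
      rw [div_le_one (by positivity)]; linarith)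
    have h3 : ((A.filter fun x' => flippedVars (frozen σ) x' = S).card : ℝ) ≤
        (1 + 1 / 2 ^ k) ^ n / (1 / 2 ^ k) ^ b * 2 ^ numFree σ := by
      refine (Nat.cast_le.2 h1).trans ?_
      push_cast
      exact mul_le_mul_of_nonneg_right h2 (by positivity)
    have two_le : ∀ j : ℕ, (2 : ℝ) ^ j ≤ Real.exp j := by
      intro j
      rw [← mul_one (j : ℝ), Real.exp_nat_mul]
      exact pow_le_pow_left₀ zero_le_two (by linarith [Real.add_one_le_exp 1]) j
    have h4 : (1 + 1 / 2 ^ k : ℝ) ^ n ≤ Real.exp (n * (1 / 2 ^ k)) := by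
      rw [Real.exp_nat_mul]
      exact pow_le_pow_left₀ (by positivity) (by linarith [Real.add_one_le_exp (1 / 2 ^ k : ℝ)]) n
    have h5 : (1 + 1 / 2 ^ k : ℝ) ^ n / (1 / 2 ^ k) ^ b = (1 + 1 / 2 ^ k) ^ n * 2 ^ (k * b) := by
      rw [one_div_pow, ← pow_mul]
      simp
    rw [h5] at h3
    refine h3.trans ?_
    calc (1 + 1 / 2 ^ k : ℝ) ^ n * 2 ^ (k * b) * 2 ^ numFree σ ≤
          Real.exp (n * (1 / 2 ^ k)) * Real.exp ((k * b : ℕ)) * Real.exp (numFree σ) := by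
          gcongr
          · exact two_le _
          · exact two_le _
      _ = Real.exp (n * (1 / 2 ^ k) + (k * b : ℕ) + numFree σ) := by
          rw [Real.exp_add, Real.exp_add]
      _ ≤ _ := by
          rw [Real.exp_le_exp]
          push_cast
          have e1 : (k : ℝ) * b ≤ k * (η * n) := mul_le_mul_of_nonneg_left hb hkp.le
          have e2 : 1 / 2 ^ k ≤ η := by
            rw [hη]
            refine div_le_div_of_nonneg_right ?_ (by positivity)
            nlinarith
          have e3 : (n : ℝ) * (1 / 2 ^ k) ≤ n * η := mul_le_mul_of_nonneg_left e2 hn'.le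
          have e4 : 2 * (η * n) ≤ k * (η * n) := mul_le_mul_of_nonneg_right hk' (by positivity)
          nlinarith [mul_nonneg hη0 hn'.le]
  rw [← Finset.sum_fiberwise_of_maps_to (t := (Finset.univ : Finset (Finset (Fin n))))
    (g := fun x' => flippedVars (frozen σ) x') fun _ _ => Finset.mem_univ _]
  have hfib : ∀ S : Finset (Fin n), ∑ x' ∈ A.filter (fun x' => flippedVars (frozen σ) x' = S),
      Real.exp (-(4 * k * η * n) - n / 2 ^ k -
        n * Real.binEntropy ((flippedVars (frozen σ) x').card / n)) ≤
      Real.exp (-(n / 2 ^ k)) * Real.exp (-(n * Real.binEntropy (S.card / n))) := by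
    intro S
    rw [Finset.sum_congr rfl fun x' hx' => by rw [(Finset.mem_filter.1 hx').2], Finset.sum_const,
      nsmul_eq_mul]
    refine (mul_le_mul_of_nonneg_right (hcount S) (Real.exp_nonneg _)).trans (le_of_eq ?_)
    rw [← Real.exp_add, ← Real.exp_add]
    congr 1
    ring
  refine (Finset.sum_le_sum fun S _ => hfib S).trans ?_
  rw [← Finset.mul_sum, mul_comm]
  exact mul_le_mul_of_nonneg_right (sum_exp_binEntropy_le hn) (Real.exp_nonneg _)

end mid

/-! ### Separability -/

/-- Weigh configurations by `(1 / n)` to the power of the distance: the total is `(1 + 2 / n) ^ n ≤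
exp 2`, two being the number of other values at a variable. -/
theorem card_hamming_ball_le {n : ℕ} (hn : 0 < n) (x : Fin n → Option Bool) (M : ℕ) :
    (((Finset.univ : Finset (Fin n → Option Bool)).filter fun x' =>
      (Finset.univ.filter fun v => x' v ≠ x v).card ≤ M).card : ℝ) ≤ Real.exp 2 * n ^ M := by
  have hn' : (1 : ℝ) ≤ n := by exact_mod_cast hn
  have hn0 : (0 : ℝ) < n := by linarith
  set y : ℝ := 1 / n with hy
  have hy0 : 0 < y := by positivity
  have hy1 : y ≤ 1 := by rw [hy, div_le_one hn0]; exact hn'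
  have h1 : ∑ x' : Fin n → Option Bool, y ^ (Finset.univ.filter fun v => x' v ≠ x v).card =
      (1 + 2 * y) ^ n := by
    have e1 : ∀ x' : Fin n → Option Bool, y ^ (Finset.univ.filter fun v => x' v ≠ x v).card =
        ∏ v, if x' v = x v then 1 else y := by
      intro x'
      rw [Finset.prod_ite, Finset.prod_const_one, one_mul, Finset.prod_const]
    have e2 := Finset.prod_univ_sum (fun _ : Fin n => (Finset.univ : Finset (Option Bool)))
      (fun v o => if o = x v then 1 else y)
    rw [Fintype.piFinset_univ] at e2
    simp only [e1]
    rw [← e2]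
    have e3 : ∀ v : Fin n, ∑ o : Option Bool, (if o = x v then 1 else y) = 1 + 2 * y := by
      intro v
      rw [Fintype.sum_option, Fintype.sum_bool]
      rcases x v with _ | w
      · simp
        ring
      · cases w <;> simp <;> ring
    rw [Finset.prod_congr rfl fun v _ => e3 v]
    simp
  have h2 : (1 + 2 * y) ^ n ≤ Real.exp 2 := by
    have : Real.exp 2 = Real.exp (2 * y) ^ n := by
      rw [← Real.exp_nat_mul, hy]
      congr 1
      field_simp
    rw [this]
    exact pow_le_pow_left₀ (by positivity) (by linarith [Real.add_one_le_exp (2 * y)]) n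
  have h3 : (((Finset.univ : Finset (Fin n → Option Bool)).filter fun x' =>
      (Finset.univ.filter fun v => x' v ≠ x v).card ≤ M).card : ℝ) * y ^ M ≤ Real.exp 2 := by
    refine le_trans ?_ (h1.le.trans h2)
    rw [← nsmul_eq_mul, ← Finset.sum_const]
    refine (Finset.sum_le_sum fun U hU => ?_).trans (Finset.sum_le_sum_of_subset_of_nonneg
      (Finset.filter_subset _ _) fun U _ _ => by positivity)
    exact pow_le_pow_of_le_one hy0.le hy1 (Finset.mem_filter.1 hU).2
  rw [hy, one_div_pow, mul_one_div, div_le_iff₀ (by positivity)] at h3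
  exact h3

section separable
variable {n m d k T : ℕ} {G : Instance n m d k} {σ σ' : Config n d} {η α : ℝ} {H : Profile d k}

theorem card_diff_le {x x' : Fin n → Option Bool}
    (h : (newlyFrozen x x').card ≤ (changedFrozen x x').card) :
    (Finset.univ.filter fun v => x' v ≠ x v).card ≤ 2 * (changedFrozen x x').card := by
  have : (Finset.univ.filter fun v => x' v ≠ x v) ⊆ newlyFrozen x x' ∪ changedFrozen x x' := by
    intro v hv
    simp only [newlyFrozen, changedFrozen, Finset.mem_union, Finset.mem_filter, Finset.mem_univ,
      true_and] at hv ⊢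
    by_cases hx : x v = none
    · left; rw [hx] at hv ⊢; exact ⟨rfl, hv⟩
    · right; exact ⟨hx, hv⟩
  have h2 := (Finset.card_le_card this).trans (Finset.card_union_le _ _)
  omega

theorem card_free_negFrozen (x : Fin n → Option Bool) :
    (Finset.univ.filter fun v => negFrozen x v = none) = Finset.univ.filter fun v => x v = none := by
  ext v
  simp [negFrozen]

theorem card_changedFrozen_le (x x' : Fin n → Option Bool) :
    (changedFrozen x x').card ≤ (flippedVars x x').card +
      (Finset.univ.filter fun v => x' v = none).card := by
  refine (Finset.card_le_card fun v hv => ?_).trans (Finset.card_union_le _ _)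
  simp only [flippedVars, changedFrozen, Finset.mem_union, Finset.mem_filter, Finset.mem_univ,
    true_and] at hv ⊢
  tauto

/-- A variable flipped between `x` and `x'` has the same value in `x` and in the negation of `x'`,
so the two sets are disjoint. -/
theorem le_card_changedFrozen_negFrozen (x x' : Fin n → Option Bool) :
    (changedFrozen x (negFrozen x')).card + (flippedVars x x').card ≤ n := by
  rw [← Finset.card_union_of_disjoint]
  · simpa using Finset.card_le_univ (changedFrozen x (negFrozen x') ∪ flippedVars x x')
  · rw [Finset.disjoint_left]
    intro v h1 h2
    have e1 := (Finset.mem_filter.1 h1).2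
    have e2 := (Finset.mem_filter.1 h2).2
    simp only [negFrozen] at e1
    cases hx : x v with
    | none => exact e1.1 hx
    | some a => cases hx' : x' v with
      | none => exact e2.2.1 hx'
      | some b =>
        rw [hx, hx'] at e1 e2
        cases a <;> cases b <;> simp at e1 e2

theorem flippedVars_card_le_diff (x x' : Fin n → Option Bool) :
    (flippedVars x x').card ≤ (Finset.univ.filter fun v => x v ≠ x' v).card := by
  refine Finset.card_le_card fun v hv => ?_
  simp only [flippedVars, Finset.mem_filter, Finset.mem_univ, true_and] at hv ⊢
  exact fun h => hv.2.2 h.symm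

theorem diff_card_le_flippedVars (x x' : Fin n → Option Bool) :
    (Finset.univ.filter fun v => x v ≠ x' v).card ≤ (flippedVars x x').card +
      ((Finset.univ.filter fun v => x v = none).card +
      (Finset.univ.filter fun v => x' v = none).card) := by
  have : (Finset.univ.filter fun v => x v ≠ x' v) ⊆ flippedVars x x' ∪
      ((Finset.univ.filter fun v => x v = none) ∪ (Finset.univ.filter fun v => x' v = none)) := by
    intro v hv
    simp only [flippedVars, Finset.mem_union, Finset.mem_filter, Finset.mem_univ,
      true_and] at hv ⊢
    have := Ne.symm hv
    tauto
  have h1 := Finset.card_le_card this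
  have h2 := Finset.card_union_le (flippedVars x x')
    ((Finset.univ.filter fun v => x v = none) ∪ (Finset.univ.filter fun v => x' v = none))
  have h3 := Finset.card_union_le (Finset.univ.filter fun v => x v = none)
    (Finset.univ.filter fun v => x' v = none)
  omega

/-- A coloring whose overlap is outside the interval is close to `x`, close to the negation of
`x`, or at intermediate distance. -/
theorem intermediate_of_overlap (hn : 0 < n) (hk : 1 ≤ k) (hη0 : 0 ≤ η)
    (hη1 : η ≤ 1 / (16 * k)) (hη2 : 8 * η ≤ (k : ℝ) ^ 4 / (2 : ℝ) ^ ((k : ℝ) / 2))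
    (hf : (numFree σ : ℝ) ≤ η * n) (hf' : (numFree σ' : ℝ) ≤ η * n)
    (hov : overlap σ σ' ∉ Isep k)
    (h1 : n < 8 * k * (changedFrozen (frozen σ) (frozen σ')).card)
    (h2 : n < 8 * k * (changedFrozen (frozen σ) (negFrozen (frozen σ'))).card) :
    Intermediate k (frozen σ) (frozen σ') := by
  have hn' : (0 : ℝ) < n := by exact_mod_cast hn
  have hk' : (0 : ℝ) < k := by exact_mod_cast hk
  have h1' : (n : ℝ) < 8 * k * (changedFrozen (frozen σ) (frozen σ')).card := by exact_mod_cast h1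
  have h2' : (n : ℝ) < 8 * k * (changedFrozen (frozen σ) (negFrozen (frozen σ'))).card := by
    exact_mod_cast h2
  have e1 : ((changedFrozen (frozen σ) (frozen σ')).card : ℝ) ≤
      (flippedVars (frozen σ) (frozen σ')).card + numFree σ' := by
    exact_mod_cast card_changedFrozen_le (frozen σ) (frozen σ')
  have e2 : ((changedFrozen (frozen σ) (negFrozen (frozen σ'))).card : ℝ) +
      (flippedVars (frozen σ) (frozen σ')).card ≤ n := by
    exact_mod_cast le_card_changedFrozen_negFrozen (frozen σ) (frozen σ')
  have e3 : ((flippedVars (frozen σ) (frozen σ')).card : ℝ) / n ≤ overlap σ σ' := by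
    refine div_le_div_of_nonneg_right ?_ hn'.le
    exact_mod_cast flippedVars_card_le_diff (frozen σ) (frozen σ')
  have e4 : overlap σ σ' ≤ ((flippedVars (frozen σ) (frozen σ')).card : ℝ) / n + 2 * η := by
    unfold overlap
    rw [div_le_iff₀ hn', add_mul, div_mul_cancel₀ _ hn'.ne']
    have : ((Finset.univ.filter fun v => frozen σ v ≠ frozen σ' v).card : ℝ) ≤
        (flippedVars (frozen σ) (frozen σ')).card + (numFree σ + numFree σ') := by
      exact_mod_cast diff_card_le_flippedVars (frozen σ) (frozen σ')
    linarith
  set t : ℝ := ((flippedVars (frozen σ) (frozen σ')).card : ℝ) / n with ht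
  have htn : ((flippedVars (frozen σ) (frozen σ')).card : ℝ) = t * n := by rw [ht]; field_simp
  rw [htn] at e1 e2
  refine ⟨?_, ?_, ?_⟩
  · rw [← ht, div_le_iff₀ (by positivity)]
    rw [le_div_iff₀ (by positivity)] at hη1
    have e5 : (n : ℝ) < 8 * k * (t * n + η * n) :=
      h1'.trans_le (mul_le_mul_of_nonneg_left (by linarith) (by positivity))
    have e6 : (1 : ℝ) < 8 * k * (t + η) := by
      have : 8 * k * (t * n + η * n) = 8 * k * (t + η) * n := by ring
      rw [this] at e5
      by_contra hno
      push Not at hno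
      nlinarith
    linarith
  · rw [← ht]
    have e5 : (n : ℝ) < 8 * k * (n - t * n) :=
      h2'.trans_le (mul_le_mul_of_nonneg_left (by linarith) (by positivity))
    have e6 : (1 : ℝ) < 8 * k * (1 - t) := by
      have : 8 * k * (n - t * n) = 8 * k * (1 - t) * n := by ring
      rw [this] at e5
      by_contra hno
      push Not at hno
      nlinarith
    rw [le_sub_comm, div_le_iff₀ (by positivity)]
    linarith
  · rw [← ht]
    set δ := (k : ℝ) ^ 4 / (2 : ℝ) ^ ((k : ℝ) / 2) with hδ
    have hδ0 : 0 ≤ δ := by positivity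
    have hδ2 : δ ^ 2 = (k : ℝ) ^ 8 / 2 ^ k := by
      have : ((2 : ℝ) ^ ((k : ℝ) / 2)) ^ 2 = 2 ^ k := by
        rw [← Real.rpow_natCast, ← Real.rpow_mul zero_le_two, ← Real.rpow_natCast]
        congr 1
        push_cast
        ring
      rw [hδ, div_pow, ← pow_mul, this]
    rw [← hδ2]
    rw [Isep, Set.mem_Icc, not_and_or, not_le, not_le, ← hδ] at hov
    -- The overlap is more than `δ / 2` away from one half, and free variables account for a
    -- discrepancy of at most `2 * η ≤ δ / 4` between it and `t`.
    have : δ / 4 ≤ |t - 1 / 2| := by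
      rcases hov with hov | hov
      · rw [abs_sub_comm]
        exact le_trans (by linarith) (le_abs_self _)
      · exact le_trans (by linarith) (le_abs_self _)
    calc δ ^ 2 / 16 = (δ / 4) ^ 2 := by ring
      _ ≤ |t - 1 / 2| ^ 2 := pow_le_pow_left₀ (by positivity) this 2
      _ = _ := sq_abs _

/-- For every counted `σ'`, the frozen configuration or its negation lies in the Hamming ball of
radius `2 * L` about that of `σ`: `h2` rules out intermediate distance, `h1` rules out `L` or more
changed frozen variables, and newly frozen variables at most double the distance. As colorings are
determined by their frozen configurations, two ball volumes bound the count. -/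
theorem separable_of_forall (hn : 0 < n) (hk : 3 ≤ k) (hη0 : 0 ≤ η)
    (hη1 : η ≤ 1 / (16 * k)) (hη2 : 8 * η ≤ (k : ℝ) ^ 4 / (2 : ℝ) ^ ((k : ℝ) / 2))
    (hnear : ∀ σ' ∈ near T H G, (numFree σ' : ℝ) ≤ η * n) (hσ : σ ∈ near T H G) {L : ℕ}
    (hL : 2 * (Real.exp 2 * (n : ℝ) ^ (2 * L)) ≤ Real.exp (Real.log n ^ 4))
    (h1 : ∀ j, L ≤ j → 8 * k * j ≤ n → nearbyFrozen G (frozen σ) j = ∅)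
    (h2 : ∀ x', Intermediate k (frozen σ) x' →
      (Finset.univ.filter fun v => x' v = none).card ≤ ⌊η * n⌋₊ → ¬ FrozenValid G x') :
    Separable T H G σ := by
  set B := (Finset.univ : Finset (Fin n → Option Bool)).filter fun x' =>
      (Finset.univ.filter fun v => x' v ≠ frozen σ v).card ≤ 2 * L with hB
  have hBcard := card_hamming_ball_le hn (frozen σ) (2 * L)
  have hcol : ∀ σ' ∈ near T H G, σ' ∈ colorings T G := fun σ' h => (Finset.mem_filter.1 h).1
  have hclose : ∀ x', FrozenValid G x' → (newlyFrozen (frozen σ) x').card ≤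
      (changedFrozen (frozen σ) x').card → 8 * k * (changedFrozen (frozen σ) x').card ≤ n →
      x' ∈ B := by
    intro x' hv hnew hle
    have hlt : (changedFrozen (frozen σ) x').card < L := by
      by_contra hge
      push Not at hge
      have := h1 _ hge hle
      rw [Finset.eq_empty_iff_forall_notMem] at this
      exact this x' (Finset.mem_filter.2 ⟨Finset.mem_univ _, hv, rfl, hnew⟩)
    rw [hB, Finset.mem_filter]
    refine ⟨Finset.mem_univ _, (card_diff_le hnew).trans (by omega)⟩
  set A := (near T H G).filter fun σ' => numFree σ ≤ numFree σ' ∧ overlap σ σ' ∉ Isep k with hA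
  have hcover : A ⊆ (A.filter fun σ' => frozen σ' ∈ B) ∪
      A.filter fun σ' => negFrozen (frozen σ') ∈ B := by
    intro σ' hσ'
    obtain ⟨hm, hnf, hov⟩ := Finset.mem_filter.1 hσ'
    rw [Finset.mem_union]
    have hv := frozenValid_of_coloring (by omega) (hcol σ' hm)
    by_contra hno
    rw [not_or] at hno
    have hno1 : frozen σ' ∉ B := fun h => hno.1 (Finset.mem_filter.2 ⟨hσ', h⟩)
    have hno2 : negFrozen (frozen σ') ∉ B := fun h => hno.2 (Finset.mem_filter.2 ⟨hσ', h⟩)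
    have e1 : n < 8 * k * (changedFrozen (frozen σ) (frozen σ')).card := by
      by_contra hle
      push Not at hle
      exact hno1 (hclose _ hv (card_newlyFrozen_le hnf) hle)
    have e2 : n < 8 * k * (changedFrozen (frozen σ) (negFrozen (frozen σ'))).card := by
      by_contra hle
      push Not at hle
      refine hno2 (hclose _ hv.negFrozen (card_newlyFrozen_le ?_) hle)
      rw [card_free_negFrozen]
      exact hnf
    refine h2 _ (intermediate_of_overlap hn (by omega) hη0 hη1 hη2 (hnear σ hσ) (hnear σ' hm) hov
      e1 e2) ?_ hv
    exact Nat.le_floor (hnear σ' hm)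
  have hinj : Set.InjOn (frozen : Config n d → _) (A : Set (Config n d)) := by
    intro a ha b hb hab
    exact coloring_ext hk (hcol a (Finset.mem_filter.1 ha).1) (hcol b (Finset.mem_filter.1 hb).1)
      hab
  have c1 : (A.filter fun σ' => frozen σ' ∈ B).card ≤ B.card :=
    Finset.card_le_card_of_injOn frozen (fun a ha => (Finset.mem_filter.1 ha).2)
      (hinj.mono fun a ha => (Finset.mem_filter.1 ha).1)
  have c2 : (A.filter fun σ' => negFrozen (frozen σ') ∈ B).card ≤ B.card :=
    Finset.card_le_card_of_injOn (fun a => negFrozen (frozen a))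
      (fun a ha => (Finset.mem_filter.1 ha).2)
      (fun a ha b hb hab => hinj (Finset.mem_filter.1 ha).1 (Finset.mem_filter.1 hb).1 (by
        have := congrArg negFrozen hab
        simpa only [negFrozen_negFrozen] using this))
  have c3 : A.card ≤ 2 * B.card := by
    have := (Finset.card_le_card hcover).trans (Finset.card_union_le _ _)
    omega
  have c4 : (A.card : ℝ) ≤ 2 * B.card := by exact_mod_cast c3
  unfold Separable
  rw [← hA]
  linarith

end separable

-- From the counts to the expected partition functions.

section expectation
variable {n m d k T : ℕ} {H : Profile d k} {lam : ℝ}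

theorem Znear_eq_sum (G : Instance n m d k) : Znear lam T H G =
    ∑ σ ∈ Fintype.piFinset fun _ : Fin n × Fin d => OmegaT d k T, contribution lam T H σ G := by
  unfold Znear contribution
  rw [← Finset.sum_filter]
  refine Finset.sum_congr (Finset.ext fun σ => ?_) fun _ _ => rfl
  rw [Finset.mem_filter]
  refine ⟨fun h => ⟨?_, h⟩, fun h => h.2⟩
  exact (Finset.mem_filter.1 (Finset.mem_filter.1 h).1).1

theorem Snear_eq_sum (G : Instance n m d k) : Snear lam T H G =
    ∑ σ ∈ Fintype.piFinset fun _ : Fin n × Fin d => OmegaT d k T,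
      contribution lam T H σ G * if Separable T H G σ then 1 else 0 := by
  have hsub : near T H G ⊆ Fintype.piFinset fun _ : Fin n × Fin d => OmegaT d k T := fun σ h =>
    (Finset.mem_filter.1 (Finset.mem_filter.1 h).1).1
  rw [← Finset.sum_subset hsub fun σ _ h => by rw [contribution, if_neg h, zero_mul], Snear,
    Finset.sum_filter]
  refine Finset.sum_congr rfl fun σ h => ?_
  rw [contribution, if_pos h, mul_ite, mul_one, mul_zero]

theorem Snear_nonneg (hk : 0 < k) (G : Instance n m d k) : 0 ≤ Snear lam T H G :=
  Finset.sum_nonneg fun σ _ => Real.rpow_nonneg (weight_nonneg hk G σ) _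

theorem Snear_le_Znear (hk : 0 < k) (G : Instance n m d k) :
    Snear lam T H G ≤ Znear lam T H G :=
  Finset.sum_le_sum_of_subset_of_nonneg (Finset.filter_subset _ _)
    fun σ _ _ => Real.rpow_nonneg (weight_nonneg hk G σ) _

/-- The colorings that are not separable carry a small part of the expected partition function. -/
theorem sum_Znear_sub_Snear_le {c c' η α : ℝ} (hη : η = c * k / 2 ^ k)
    (hT : ∀ (G : Instance n m d k) (σ : Config n d), σ ∈ near T H G → Typical T η α G σ)
    (hn : 0 < n) (hd : 0 < d) (hk : 3 ≤ k) (hη2 : η ≤ 1 / 2) (hc : 1 ≤ c)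
    (hE : ∀ t s : ℝ, 1 / (16 * k) ≤ t → t ≤ 1 - 1 / (16 * k) →
      (k : ℝ) ^ 8 / 2 ^ k / 16 ≤ (t - 1 / 2) ^ 2 → s ∈ Set.Icc (0 : ℝ) 1 →
      |s - t| ≤ 2 * (c * k / 2 ^ k) →
      Real.binEntropy t + 6 * k * (c * k / 2 ^ k) + 1 / 2 ^ k ≤
        Real.log 2 * (1 - 4 / 2 ^ k) * (1 - c * k / 2 ^ k) * (1 - extremeProb k s))
    (hd1 : ((2 : ℝ) ^ k / 2 - 2) * Real.log 2 ≤ (d : ℝ) / k)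
    (hd2 : (d : ℝ) / k ≤ (2 : ℝ) ^ k / 2 * Real.log 2)
    (hη1 : η ≤ 1 / (16 * k)) (hη8 : 8 * η ≤ (k : ℝ) ^ 4 / (2 : ℝ) ^ ((k : ℝ) / 2))
    (hα : 0 < α) (hc' : 1 ≤ c') (hcη : 4 * k * η * d ≤ c')
    (hβ : 72 * Real.exp 1 ^ 2 * (k * α * c') ≤ Real.exp (-1)) {L : ℕ} (hL1 : 1 ≤ L)
    (hL : 2 * (Real.exp 2 * (n : ℝ) ^ (2 * L)) ≤ Real.exp (Real.log n ^ 4)) :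
    ∑ G : Instance n m d k, (Znear lam T H G - Snear lam T H G) ≤
      ((n : ℝ) * d + 1) ^ 2 * ((n + 1) * Real.exp (-L) + (n + 1) * Real.exp (-(n / 2 ^ k))) *
        ∑ G : Instance n m d k, Znear lam T H G := by
  have hη0 : 0 ≤ η := by rw [hη]; positivity
  have hk0 : 0 < k := by omega
  set J := (Finset.range (n + 1)).filter fun j => L ≤ j ∧ 8 * k * j ≤ n with hJ
  let A : Config n d → Finset (Fin n → Option Bool) := fun σ => Finset.univ.filter fun x' =>
    Intermediate k (frozen σ) x' ∧ (Finset.univ.filter fun v => x' v = none).card ≤ ⌊η * n⌋₊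
  let Y₁ : Config n d → Instance n m d k → ℝ := fun σ G =>
    ∑ j ∈ J, ((nearbyFrozen G (frozen σ) j).card : ℝ)
  let Y₂ : Config n d → Instance n m d k → ℝ := fun σ G =>
    ∑ x' ∈ A σ, if FrozenValid G x' then 1 else 0
  have hY₁ : ∀ σ G, 0 ≤ Y₁ σ G := fun σ G => Finset.sum_nonneg fun _ _ => Nat.cast_nonneg _
  have hY₂ : ∀ σ G, 0 ≤ Y₂ σ G := fun σ G => Finset.sum_nonneg fun _ _ => by
    split_ifs <;> norm_num
  -- `Y₁` and `Y₂` are counts. If their sum is below one they both vanish, and `separable_of_forall`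
  -- applies; so a non-separable coloring near `H` is charged at least once.
  have hpt : ∀ σ G, contribution lam T H σ G * (1 - if Separable T H G σ then 1 else 0) ≤
      contribution lam T H σ G * Y₁ σ G + contribution lam T H σ G * Y₂ σ G := by
    intro σ G
    by_cases hσ : σ ∈ near T H G
    swap
    · have : contribution lam T H σ G = 0 := if_neg hσ
      rw [this]; simp
    rw [← mul_add]
    refine mul_le_mul_of_nonneg_left ?_ (contribution_nonneg hk0)
    split_ifs with hsep
    · linarith [hY₁ σ G, hY₂ σ G]
    by_contra hlt
    push Not at hlt
    rw [sub_zero] at hlt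
    have h1 : Y₁ σ G < 1 := by linarith [hY₂ σ G]
    have h2 : Y₂ σ G < 1 := by linarith [hY₁ σ G]
    refine hsep (separable_of_forall hn hk hη0 hη1 hη8
      (fun σ' hσ' => (hT G σ' hσ').numFree_le hd) hσ hL (fun j hj hjn => ?_) fun x' hI hf hv => ?_)
    · by_contra hne
      have hjJ : j ∈ J := by
        rw [hJ, Finset.mem_filter, Finset.mem_range]
        refine ⟨?_, hj, hjn⟩
        have : 1 * j ≤ 8 * k * j := Nat.mul_le_mul_right j (by omega)
        omega
      have e1 := Finset.single_le_sum (f := fun j => ((nearbyFrozen G (frozen σ) j).card : ℝ))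
        (fun _ _ => Nat.cast_nonneg _) hjJ
      have e2 : (1 : ℝ) ≤ (nearbyFrozen G (frozen σ) j).card := by
        exact_mod_cast Finset.card_pos.2 (Finset.nonempty_iff_ne_empty.2 hne)
      exact absurd (e2.trans e1) (not_le.2 h1)
    · have hxA : x' ∈ A σ := Finset.mem_filter.2 ⟨Finset.mem_univ _, hI, hf⟩
      have e1 := Finset.single_le_sum (f := fun x' => if FrozenValid G x' then (1 : ℝ) else 0)
        (fun _ _ => by split_ifs <;> norm_num) hxA
      simp only [if_pos hv] at e1
      exact absurd e1 (not_le.2 h2)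
  have hb₁ : ∀ σ : Config n d, ∑ G, contribution lam T H σ G * Y₁ σ G ≤
      ((n : ℝ) * d + 1) ^ 2 * ((n + 1) * Real.exp (-L)) *
        ∑ G : Instance n m d k, contribution lam T H σ G := by
    intro σ
    refine sum_contribution_mul_le hk0 _ fun G hσ => ?_
    have hty := hT G σ hσ
    simp only [Y₁]
    rw [Finset.sum_comm]
    have h1 : ∀ j ∈ J, ∑ ρ ∈ colorPerms (blueClass σ),
        ((nearbyFrozen (NAESat.permute G ρ) (frozen σ) j).card : ℝ) ≤
        (colorPerms (blueClass σ)).card * (((n : ℝ) * d + 1) ^ 2 * Real.exp (-L)) := by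
      intro j hj
      rw [hJ, Finset.mem_filter] at hj
      refine (hty.sum_card_nearbyFrozen_le hk hd hη2 hα hc' hcη (hL1.trans hj.2.1) hj.2.2).trans ?_
      refine mul_le_mul_of_nonneg_left ?_ (Nat.cast_nonneg _)
      refine mul_le_mul samplingFactor_le ?_ (by positivity) (by positivity)
      refine (pow_le_pow_left₀ (by positivity) hβ j).trans ?_
      rw [← Real.exp_nat_mul, Real.exp_le_exp]
      have : (L : ℝ) ≤ j := by exact_mod_cast hj.2.1
      linarith
    refine (Finset.sum_le_sum h1).trans ?_
    rw [Finset.sum_const, nsmul_eq_mul]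
    have h2 : (J.card : ℝ) ≤ n + 1 := by
      have := (Finset.card_filter_le (Finset.range (n + 1)) fun j => L ≤ j ∧ 8 * k * j ≤ n)
      rw [Finset.card_range] at this
      exact_mod_cast this
    calc (J.card : ℝ) * ((colorPerms (blueClass σ)).card * (((n : ℝ) * d + 1) ^ 2 * Real.exp (-L)))
        ≤ (n + 1) * ((colorPerms (blueClass σ)).card * (((n : ℝ) * d + 1) ^ 2 * Real.exp (-L))) :=
          mul_le_mul_of_nonneg_right h2 (by positivity)
      _ = _ := by ring
  have hb₂ : ∀ σ : Config n d, ∑ G, contribution lam T H σ G * Y₂ σ G ≤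
      ((n : ℝ) * d + 1) ^ 2 * ((n + 1) * Real.exp (-(n / 2 ^ k))) *
        ∑ G : Instance n m d k, contribution lam T H σ G := by
    intro σ
    -- The literals are averaged first. The resulting product depends on the matching only, and is
    -- then averaged over the permutations of the blue edges.
    have h1 : ∑ G, contribution lam T H σ G * Y₂ σ G ≤
        ∑ G : Instance n m d k, contribution lam T H σ G * ∑ x' ∈ A σ,
          ∏ a, (if GoodClause G.1 σ x' a then 1 - 2 / 2 ^ k else 1 : ℝ) := by
      simp only [Y₂, Finset.mul_sum]
      rw [Finset.sum_comm]
      refine (Finset.sum_le_sum fun x' _ =>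
        sum_contribution_frozenValid_le (by omega) lam H σ x').trans (le_of_eq ?_)
      rw [Finset.sum_comm]
    refine h1.trans (sum_contribution_mul_le hk0 _ fun G hσ => ?_)
    have hty := hT G σ hσ
    refine (hty.sum_intermediate_le hη hn hd (by omega) hη2 hc hE hd1 hd2
      (Nat.floor_le (by positivity)) (A σ) fun x' hx' => (Finset.mem_filter.1 hx').2).trans ?_
    exact mul_le_mul_of_nonneg_left (mul_le_mul_of_nonneg_right samplingFactor_le (by positivity))
      (Nat.cast_nonneg _)
  have hZS : ∀ G : Instance n m d k, Znear lam T H G - Snear lam T H G =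
      ∑ σ ∈ Fintype.piFinset fun _ : Fin n × Fin d => OmegaT d k T,
        contribution lam T H σ G * (1 - if Separable T H G σ then 1 else 0) := by
    intro G
    rw [Znear_eq_sum, Snear_eq_sum, ← Finset.sum_sub_distrib]
    exact Finset.sum_congr rfl fun σ _ => by ring
  rw [Finset.sum_congr rfl fun G _ => hZS G,
    Finset.sum_congr rfl fun (G : Instance n m d k) _ => Znear_eq_sum (lam := lam) (H := H) G,
    Finset.sum_comm, Finset.sum_comm (s := Finset.univ (α := Instance n m d k)), Finset.mul_sum]
  refine Finset.sum_le_sum fun σ _ => ?_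
  refine (Finset.sum_le_sum fun G _ => hpt σ G).trans ?_
  rw [Finset.sum_add_distrib]
  refine (add_le_add (hb₁ σ) (hb₂ σ)).trans (le_of_eq ?_)
  ring

end expectation

-- Asymptotics in `n`, conditions on `k`, and conclusion.

/-- The factor `exp (-(log n) ^ 2)` beats the polynomial prefactor of degree three: once `log n ≥
4`, it is at most `n ^ (-4)`. -/
theorem tendsto_error_bound (d k : ℕ) : Tendsto (fun n : ℕ =>
    ((n : ℝ) * d + 1) ^ 2 * ((n + 1) * Real.exp (-(⌈Real.log n ^ 2⌉₊ : ℝ)) +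
      (n + 1) * Real.exp (-(n / 2 ^ k)))) atTop (𝓝 0) := by
  have hn : Tendsto (fun n : ℕ => (n : ℝ)) atTop atTop := tendsto_natCast_atTop_atTop
  have hlog : Tendsto (fun n : ℕ => Real.log n) atTop atTop := Real.tendsto_log_atTop.comp hn
  set r : ℝ := Real.exp (-(1 / 2 ^ k)) with hr
  have hr1 : r < 1 := by
    rw [hr, Real.exp_lt_one_iff]
    have : (0 : ℝ) < 1 / 2 ^ k := by positivity
    linarith
  have hr0 : 0 < r := Real.exp_pos _
  have h1 : Tendsto (fun n : ℕ => (n : ℝ)⁻¹) atTop (𝓝 0) := tendsto_inv_atTop_nhds_zero_nat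
  have h2 : Tendsto (fun n : ℕ => (n : ℝ) ^ 3 * r ^ n) atTop (𝓝 0) :=
    tendsto_pow_const_mul_const_pow_of_abs_lt_one 3 (by rwa [abs_of_pos hr0])
  have h3 := (h1.add h2).const_mul (((d : ℝ) + 1) ^ 2 * 2)
  rw [add_zero, mul_zero] at h3
  refine squeeze_zero' (Eventually.of_forall fun n => by positivity) ?_ h3
  filter_upwards [hlog.eventually_ge_atTop 4, eventually_ge_atTop 1] with n hl hn1
  have hn1' : (1 : ℝ) ≤ n := by exact_mod_cast hn1
  have hn0 : (0 : ℝ) < n := by linarith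
  have e1 : ((n : ℝ) * d + 1) ^ 2 ≤ (d + 1) ^ 2 * n ^ 2 := by
    rw [← mul_pow]
    refine pow_le_pow_left₀ (by positivity) ?_ 2
    nlinarith
  have e2 : (n : ℝ) + 1 ≤ 2 * n := by linarith
  have e3 : Real.exp (-(⌈Real.log n ^ 2⌉₊ : ℝ)) * n ^ 3 ≤ (n : ℝ)⁻¹ := by
    have : (n : ℝ) ^ 3 = Real.exp (3 * Real.log n) := by
      rw [show (3 : ℝ) * Real.log n = (3 : ℕ) * Real.log n by norm_num, Real.exp_nat_mul,
        Real.exp_log hn0]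
    have h' : (n : ℝ)⁻¹ = Real.exp (-Real.log n) := by rw [Real.exp_neg, Real.exp_log hn0]
    rw [this, h', ← Real.exp_add, Real.exp_le_exp]
    have := Nat.le_ceil (Real.log n ^ 2)
    nlinarith
  have e4 : Real.exp (-(n / 2 ^ k : ℝ)) = r ^ n := by
    rw [hr, ← Real.exp_nat_mul]
    congr 1
    ring
  rw [e4, ← mul_add]
  calc ((n : ℝ) * d + 1) ^ 2 * ((n + 1) * (Real.exp (-(⌈Real.log n ^ 2⌉₊ : ℝ)) + r ^ n)) ≤
        ((d + 1) ^ 2 * n ^ 2) * ((2 * n) * (Real.exp (-(⌈Real.log n ^ 2⌉₊ : ℝ)) + r ^ n)) := by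
        gcongr
    _ = (d + 1) ^ 2 * 2 * (Real.exp (-(⌈Real.log n ^ 2⌉₊ : ℝ)) * n ^ 3 + n ^ 3 * r ^ n) := by ring
    _ ≤ _ := by gcongr

/-- With radius of order `(log n) ^ 2` the ball has about `exp (2 * (log n) ^ 3)` points per unit of
the bound `2 * L`, so the fourth power of the logarithm dominates. -/
theorem eventually_ball_bound : ∀ᶠ n : ℕ in atTop, 1 ≤ ⌈Real.log n ^ 2⌉₊ ∧
    2 * (Real.exp 2 * (n : ℝ) ^ (2 * ⌈Real.log n ^ 2⌉₊)) ≤ Real.exp (Real.log n ^ 4) := by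
  have hn : Tendsto (fun n : ℕ => (n : ℝ)) atTop atTop := tendsto_natCast_atTop_atTop
  have hlog : Tendsto (fun n : ℕ => Real.log n) atTop atTop := Real.tendsto_log_atTop.comp hn
  filter_upwards [hlog.eventually_ge_atTop 3, eventually_ge_atTop 1] with n hl hn1
  have hn0 : (0 : ℝ) < n := by exact_mod_cast hn1
  refine ⟨Nat.one_le_ceil_iff.2 (by positivity), ?_⟩
  have e1 : (n : ℝ) ^ (2 * ⌈Real.log n ^ 2⌉₊) =
      Real.exp ((2 * ⌈Real.log n ^ 2⌉₊ : ℕ) * Real.log n) := by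
    rw [Real.exp_nat_mul, Real.exp_log hn0]
  have e2 : (2 : ℝ) ≤ Real.exp 1 := by linarith [Real.add_one_le_exp 1]
  calc 2 * (Real.exp 2 * (n : ℝ) ^ (2 * ⌈Real.log n ^ 2⌉₊)) ≤
        Real.exp 1 * (Real.exp 2 * (n : ℝ) ^ (2 * ⌈Real.log n ^ 2⌉₊)) := by gcongr
    _ = Real.exp (1 + (2 + (2 * ⌈Real.log n ^ 2⌉₊ : ℕ) * Real.log n)) := by
        rw [e1, Real.exp_add, Real.exp_add]
    _ ≤ _ := by
        rw [Real.exp_le_exp]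
        push_cast
        have h1 := (Nat.ceil_lt_add_one (sq_nonneg (Real.log n))).le
        set l := Real.log n
        have h2 : 2 * (⌈l ^ 2⌉₊ : ℝ) * l ≤ 2 * (l ^ 2 + 1) * l := by gcongr
        have h3 : 9 ≤ l ^ 2 := by nlinarith
        have h4 : l ^ 4 = l ^ 2 * l ^ 2 := by ring
        have h5 : 3 * l ≤ l ^ 2 := by nlinarith
        have h6 : 3 * l * l ^ 2 ≤ l ^ 2 * l ^ 2 := mul_le_mul_of_nonneg_right h5 (by positivity)
        have h7 : l * 9 ≤ l * l ^ 2 := mul_le_mul_of_nonneg_left h3 (by linarith)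
        nlinarith

/-- The conditions on `k` under which the argument works, for a given constant `C`. -/
theorem eventually_clause_size {C : ℝ} (hC : 0 ≤ C) : ∀ᶠ k : ℕ in atTop, 5 ≤ k ∧
    k * (C / 2 ^ k) ≤ 1 / 8 ∧ 8 * (1 + C) * k / 2 ^ k ≤ 1 / (16 * k) ∧
    8 * (8 * (1 + C) * k / 2 ^ k) ≤ (k : ℝ) ^ 4 / (2 : ℝ) ^ ((k : ℝ) / 2) ∧
    Real.exp (-(k / 16)) ≤ 1 / 2 ∧
    72 * Real.exp 1 ^ 2 * (k * (8 * Real.exp (-(k / 16))) * (16 * (1 + C) * k ^ 3)) ≤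
      Real.exp (-1) := by
  have hr0 := Real.exp_pos (-(1 / 16))
  have hr1 : Real.exp (-(1 / 16)) < 1 := by rw [Real.exp_lt_one_iff]; norm_num
  filter_upwards [eventually_ge_atTop 5,
    eventually_mul_pow_le C 1 (r := 1 / 2) (by norm_num) (by norm_num)
      (show (0 : ℝ) < 1 / 8 by norm_num),
    eventually_mul_pow_le (128 * (1 + C)) 2 (r := 1 / 2) (by norm_num) (by norm_num) one_pos,
    eventually_mul_pow_le 1 0 hr0.le hr1 (show (0 : ℝ) < 1 / 2 by norm_num),
    eventually_mul_pow_le (72 * Real.exp 1 ^ 2 * 128 * (1 + C)) 4 hr0.le hr1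
      (Real.exp_pos (-1)),
    (tendsto_natCast_atTop_atTop (R := ℝ)).eventually_ge_atTop (64 * (1 + C))]
    with k hk h1 h2 h3 h4 h5
  have hk' : (5 : ℝ) ≤ k := by exact_mod_cast hk
  have hk0 : (0 : ℝ) < k := by linarith
  have hpow : (1 / 2 : ℝ) ^ k = 1 / 2 ^ k := by rw [one_div_pow]
  have hexp : Real.exp (-(1 / 16)) ^ k = Real.exp (-(k / 16)) := by
    rw [← Real.exp_nat_mul]
    congr 1
    ring
  rw [hpow] at h1 h2
  rw [hexp] at h3 h4
  refine ⟨hk, ?_, ?_, ?_, ?_, ?_⟩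
  · calc (k : ℝ) * (C / 2 ^ k) = C * ((k : ℝ) ^ 1 * (1 / 2 ^ k)) := by ring
      _ ≤ _ := h1
  · rw [le_div_iff₀ (by positivity)]
    calc 8 * (1 + C) * k / 2 ^ k * (16 * k) = 128 * (1 + C) * ((k : ℝ) ^ 2 * (1 / 2 ^ k)) := by ring
      _ ≤ _ := h2
  · have e1 : (2 : ℝ) ^ ((k : ℝ) / 2) ≤ 2 ^ k := by
      rw [← Real.rpow_natCast]
      exact Real.rpow_le_rpow_of_exponent_le one_le_two (by linarith)
    have e2 : 64 * (1 + C) * k ≤ (k : ℝ) ^ 4 := by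
      calc 64 * (1 + C) * k ≤ (k : ℝ) * k := mul_le_mul_of_nonneg_right h5 hk0.le
        _ = (k : ℝ) ^ 2 := by ring
        _ ≤ (k : ℝ) ^ 4 := pow_le_pow_right₀ (by linarith) (by norm_num)
    calc 8 * (8 * (1 + C) * k / 2 ^ k) = 64 * (1 + C) * k / 2 ^ k := by ring
      _ ≤ (k : ℝ) ^ 4 / 2 ^ k := by gcongr
      _ ≤ _ := by gcongr
  · rw [pow_zero, one_mul, one_mul] at h3
    exact h3
  · refine le_trans (le_of_eq ?_) h4
    ring

/-- The degree is of order `k * 2 ^ k`. The middle bound makes the damping factor of the red degrees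
at most `exp (-k / 16)`, which beats the powers of `k` lost elsewhere. -/
theorem degree_bounds {d k : ℕ} (hk : 5 ≤ k)
    (hd1 : ((2 : ℝ) ^ k / 2 - 2) * Real.log 2 ≤ (d : ℝ) / k)
    (hd2 : (d : ℝ) / k ≤ (2 : ℝ) ^ k / 2 * Real.log 2) :
    0 < d ∧ (k : ℝ) / 16 ≤ 1 / 2 * (d / (1 + 2 ^ k)) ∧ (d : ℝ) ≤ k * (2 ^ k / 2) := by
  have hk' : (5 : ℝ) ≤ k := by exact_mod_cast hk
  have hk0 : (0 : ℝ) < k := by linarith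
  have hlog : 1 / 2 ≤ Real.log 2 := by linarith [Real.log_two_gt_d9]
  have hlog1 : Real.log 2 ≤ 1 := by linarith [Real.log_two_lt_d9]
  have h2k : (32 : ℝ) ≤ 2 ^ k := by
    calc (32 : ℝ) = 2 ^ 5 := by norm_num
      _ ≤ 2 ^ k := pow_le_pow_right₀ one_le_two hk
  have h1 : ((2 : ℝ) ^ k / 2 - 2) * (1 / 2) ≤ (d : ℝ) / k :=
    le_trans (mul_le_mul_of_nonneg_left hlog (by linarith)) hd1
  rw [le_div_iff₀ hk0] at h1
  have h3 : (1 + 2 ^ k : ℝ) / 8 ≤ (2 ^ k / 2 - 2) * (1 / 2) := by linarith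
  have h4 : (1 + 2 ^ k : ℝ) / 8 * k ≤ d := (mul_le_mul_of_nonneg_right h3 hk0.le).trans h1
  refine ⟨?_, ?_, ?_⟩
  · have : (0 : ℝ) < d := lt_of_lt_of_le (by positivity) h4
    exact_mod_cast this
  · have : (k : ℝ) / 8 ≤ d / (1 + 2 ^ k) := by
      rw [le_div_iff₀ (by positivity)]
      linarith
    linarith
  · rw [div_le_iff₀ hk0] at hd2
    refine hd2.trans ?_
    have : (2 : ℝ) ^ k / 2 * Real.log 2 ≤ 2 ^ k / 2 := mul_le_of_le_one_right (by positivity) hlog1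
    nlinarith

theorem expectation_mono {n m d k : ℕ} {X Y : Instance n m d k → ℝ} (h : ∀ G, X G ≤ Y G) :
    expectation X ≤ expectation Y :=
  div_le_div_of_nonneg_right (Finset.sum_le_sum fun G _ => h G) (Nat.cast_nonneg _)

theorem expectation_nonneg {n m d k : ℕ} {X : Instance n m d k → ℝ} (h : ∀ G, 0 ≤ X G) :
    0 ≤ expectation X :=
  div_nonneg (Finset.sum_nonneg fun G _ => h G) (Nat.cast_nonneg _)

/-- For large `n`, the non-separable colorings near the typical empirical measure contribute
little to the expected partition function. -/
theorem eventually_expectation_sub_le {C : ℝ} (hC : 0 ≤ C) : ∀ᶠ k : ℕ in atTop, ∀ d : ℕ,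
    ((2 : ℝ) ^ k / 2 - 2) * Real.log 2 ≤ (d : ℝ) / k →
    (d : ℝ) / k ≤ (2 : ℝ) ^ k / 2 * Real.log 2 → ∀ lam : ℝ, 0 ≤ lam → ∀ (T : ℕ) (q : Spin → ℝ),
    Gamma C d k T q → ∀ᶠ n : ℕ in atTop, ∀ m : ℕ,
      expectation (fun G : Instance n m d k => Znear lam T (Hstar d k T lam q) G) -
        expectation (fun G : Instance n m d k => Snear lam T (Hstar d k T lam q) G) ≤
      ((n : ℝ) * d + 1) ^ 2 * ((n + 1) * Real.exp (-(⌈Real.log n ^ 2⌉₊ : ℝ)) +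
        (n + 1) * Real.exp (-(n / 2 ^ k))) *
        expectation (fun G : Instance n m d k => Znear lam T (Hstar d k T lam q) G) := by
  filter_upwards [eventually_clause_size hC, entropy_energy (8 * (1 + C)) (by linarith)]
    with k hk hE d hd1 hd2 lam hl T q hq
  obtain ⟨hk5, hkC, hη16, hη8, hp2, hβ⟩ := hk
  obtain ⟨hd0, hpd, hd3⟩ := degree_bounds hk5 hd1 hd2
  have hk' : (5 : ℝ) ≤ k := by exact_mod_cast hk5
  have hk0 : (0 : ℝ) < k := by linarith
  set p := Real.exp (-(1 / 2 * (d / (1 + 2 ^ k) : ℝ))) with hp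
  have hp0 : 0 < p := Real.exp_pos _
  have hple : p ≤ Real.exp (-(k / 16)) := Real.exp_le_exp.2 (by linarith)
  have hn : Tendsto (fun n : ℕ => (n : ℝ) ^ (-(1 / 3) : ℝ)) atTop (𝓝 0) :=
    (tendsto_rpow_neg_atTop (by norm_num : (0 : ℝ) < 1 / 3)).comp tendsto_natCast_atTop_atTop
  filter_upwards [eventually_ball_bound, eventually_gt_atTop 0,
    hn.eventually_le_const (show (0 : ℝ) < 1 / 2 ^ k * (4 * k * (1 + C) / 2 ^ k) by positivity),
    hn.eventually_le_const (show (0 : ℝ) < 4 * p by positivity)] with n hL hn0 hn1 hn2 m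
  have hη0 : (0 : ℝ) ≤ 8 * (1 + C) * k / 2 ^ k := by positivity
  have h16 : 1 / (16 * (k : ℝ)) ≤ 1 / 2 := by
    rw [div_le_div_iff₀ (by positivity) two_pos]
    linarith
  -- The values `η = 8 * (1 + C) * k / 2 ^ k` and `α = 8 * p` come from `Gamma.typical_of_near`.
  -- With `d ≤ k * 2 ^ k / 2`, the quantity `4 * k * η * d` is at most `16 * (1 + C) * k ^ 3`, which
  -- is the choice of `c'`.
  have hmain := sum_Znear_sub_Snear_le (m := m) (T := T) (H := Hstar d k T lam q) (lam := lam)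
    (c := 8 * (1 + C)) (c' := 16 * (1 + C) * k ^ 3) (α := 8 * p) rfl (fun G σ hσ => by
      have := hq.typical_of_near (by omega) hl hkC hp (hple.trans hp2) hn1 hn2 hσ
      rwa [show 8 * (k : ℝ) * (1 + C) / 2 ^ k = 8 * (1 + C) * k / 2 ^ k by ring] at this)
    hn0 hd0 (by omega) (hη16.trans h16) (by linarith) hE hd1 hd2 hη16 hη8 (by positivity)
    (by
      have : (1 : ℝ) ≤ k ^ 3 := one_le_pow₀ (by linarith)
      nlinarith)
    (by
      calc 4 * k * (8 * (1 + C) * k / 2 ^ k) * d ≤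
            4 * k * (8 * (1 + C) * k / 2 ^ k) * (k * (2 ^ k / 2)) :=
            mul_le_mul_of_nonneg_left hd3 (by positivity)
        _ = 16 * (1 + C) * (k : ℝ) ^ 3 := by field_simp; ring)
    (le_trans (by gcongr) hβ) hL.1 hL.2
  unfold expectation
  rw [← sub_div, ← Finset.sum_sub_distrib, ← mul_div_assoc]
  exact div_le_div_of_nonneg_right hmain (Nat.cast_nonneg _)

end NAESat

theorem propositionp :
    ∀ C : ℝ, ∃ k₀ : ℕ, ∀ k : ℕ, k₀ ≤ k → ∀ d : ℕ,
      ((2 : ℝ) ^ k / 2 - 2) * Real.log 2 ≤ (d : ℝ) / k →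
      (d : ℝ) / k ≤ (2 : ℝ) ^ k / 2 * Real.log 2 →
      ∀ lam : ℝ, 0 ≤ lam → lam ≤ 1 → ∀ T : ℕ, 1 ≤ T →
      (∃ H : NAESat.Profile d k, H.Admissible T ∧ 0 ≤ NAESat.rate lam T H) →
      ∀ q : NAESat.Spin → ℝ, NAESat.Gamma C d k T q → NAESat.IsBPFixedPoint d k T lam q →
      ∃ ε : ℕ → ℝ, Filter.Tendsto ε Filter.atTop (nhds 0) ∧
        ∀ n m : ℕ, n * d = m * k →
          NAESat.expectation
              (fun G : NAESat.Instance n m d k =>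
                NAESat.Snear lam T (NAESat.Hstar d k T lam q) G) =
            (1 - ε n) *
              NAESat.expectation
                (fun G : NAESat.Instance n m d k =>
                  NAESat.Znear lam T (NAESat.Hstar d k T lam q) G) := by
  intro C
  by_cases hC : 0 ≤ C
  swap
  -- For negative `C` no `q` satisfies `Gamma`.
  · exact ⟨0, fun k _ d _ _ lam _ _ T _ _ q hq => absurd hq.const_nonneg hC⟩
  obtain ⟨k₀, hk₀⟩ := Filter.eventually_atTop.1 (NAESat.eventually_expectation_sub_le hC)
  refine ⟨max k₀ 1, fun k hk d hd1 hd2 lam hl _ T _ _ q hq _ => ?_⟩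
  have hk0 : 0 < k := le_trans (le_max_right _ _) hk
  have hmain := hk₀ k (le_trans (le_max_left _ _) hk) d hd1 hd2 lam hl T q hq
  set Z : ℕ → ℕ → ℝ := fun n m => NAESat.expectation
    (fun G : NAESat.Instance n m d k => NAESat.Znear lam T (NAESat.Hstar d k T lam q) G) with hZ
  set S : ℕ → ℕ → ℝ := fun n m => NAESat.expectation
    (fun G : NAESat.Instance n m d k => NAESat.Snear lam T (NAESat.Hstar d k T lam q) G) with hS
  have hS0 : ∀ n m, 0 ≤ S n m := fun n m =>
    NAESat.expectation_nonneg fun G => NAESat.Snear_nonneg hk0 G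
  have hSZ : ∀ n m, S n m ≤ Z n m := fun n m =>
    NAESat.expectation_mono fun G => NAESat.Snear_le_Znear hk0 G
  -- The error is the relative deficit of the separable part. It depends on `n` alone, since `m` is
  -- recovered as `n * d / k`; where the expected partition function vanishes so does its separable
  -- part, and the value `0` serves.
  refine ⟨fun n => if Z n (n * d / k) = 0 then 0 else 1 - S n (n * d / k) / Z n (n * d / k), ?_,
    fun n m hnm => ?_⟩
  · refine squeeze_zero' (Eventually.of_forall fun n => ?_) ?_ (NAESat.tendsto_error_bound d k)
    · split_ifs with h
      · exact le_rfl
      · have : 0 < Z n (n * d / k) :=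
          lt_of_le_of_ne ((hS0 _ _).trans (hSZ _ _)) (Ne.symm h)
        rw [sub_nonneg, div_le_one this]
        exact hSZ _ _
    · filter_upwards [hmain] with n hn
      split_ifs with h
      · positivity
      · have hpos : 0 < Z n (n * d / k) :=
          lt_of_le_of_ne ((hS0 _ _).trans (hSZ _ _)) (Ne.symm h)
        rw [one_sub_div h, div_le_iff₀ hpos]
        exact hn (n * d / k)
  · have hm : n * d / k = m := by rw [hnm, Nat.mul_div_cancel _ hk0]
    change S n m = (1 - if Z n (n * d / k) = 0 then 0 else
      1 - S n (n * d / k) / Z n (n * d / k)) * Z n m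
    rw [hm]
    split_ifs with h
    · rw [h, mul_zero]
      exact le_antisymm (h ▸ hSZ n m) (hS0 n m)
    · field_simp
      ring
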